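/- Let $\mathcal N$ be the space of boundedly finite counting measures on $\mathbf R$ (measures $\mu$ on the Borel sets with $\mu(A)\in\{0,1,2,\dots\}$ for every bounded Borel set $A$; the zero measure is included), with the $\sigma$-algebra generated by the maps $\mu\mapsto\mu(A)$, $A$ Borel. A point process is a random variable with values in $\mathcal N$. For $x\in\mathbf R$ let $(T_x\mu)(A)=\mu(A-x)$, and let $$M(\mu)=\inf\{x\in\mathbf R:\mu((x,\infty))<\min(1,\mu(\mathbf R)/2)\}\qquad(\inf\emptyset=+\infty),$$ which for $\mu\in\mathcal N\setminus\{0\}$ is the position of the rightmost atom of $\mu$ ($+\infty$ if the atoms are unbounded to the right). A point process $Z$ is called superposable if, for all $\alpha,\beta\in\mathbf R$ with $e^\alpha+e^\beta=1$, $Z$ is equal in law to $T_\alpha Z+T_\beta Z'$, where $Z'$ is an independent copy of $Z$. For a point process $D$, consider the two conditions (a) $\displaystyle\int_0^\infty \mathbf P(D(A+x)>0)\,e^x\,dx<\infty$ for every bounded Borel set $A\subset\mathbf R$; (b) $Z$ is equal in law to $\displaystyle\sum_{i=1}^\infty T_{\xi_i}D_i$, where $(\xi_i)_{i\ge1}$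 are the atoms of a Poisson process on $\mathbf R$ with intensity $e^{-x}\,dx$, and $D_1,D_2,\dots$ are independent copies of $D$, independent of $(\xi_i)_{i\ge1}$. A point process $Z$ is superposable if and only if there is a point process $D$ satisfying (a) and (b). If moreover $Z$ is superposable and $\mathbf P(Z\neq0)>0$, then there is a unique pair consisting of a number $m\in\mathbf R$ and (the law of) a point process $D$ such that $D$ satisfies (a) and (b) and $\mathbf P(M(D)=m)=1$. -/

import Mathlib

open MeasureTheory ProbabilityTheory Set
open scoped ENNReal

/-- Boundedly finite counting measures on `ℝ` (multiplicities allowed): the mass of every bounded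
Borel set is a (finite) natural number. -/
def IsCountingMeasure (μ : Measure ℝ) : Prop :=
  ∀ A : Set ℝ, MeasurableSet A → Bornology.IsBounded A → ∃ n : ℕ, μ A = n

/-- The space of boundedly finite counting measures on `ℝ`, the zero measure included, with the
`σ`-algebra generated by the evaluations `μ ↦ μ A`, `A` Borel (the Borel `σ`-algebra of the vague
topology). A point process is a random variable with values in this space. -/
abbrev CountingMeasure : Type := {μ : Measure ℝ // IsCountingMeasure μ}

/-- The translate `T_x μ`, that is `(T_x μ)(A) = μ (A - x)`. -/
noncomputable def translateMeasure (x : ℝ) (μ : Measure ℝ) : Measure ℝ :=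
  μ.map (fun y => y + x)

/-- `Z` is superposable: whenever `e^α + e^β = 1`, it is equal in law to `T_α Z + T_β Z'` with `Z'`
an independent copy of `Z`. The pair `(Z, Z')` is realised on the product space. -/
def Superposable {Ω : Type*} [MeasurableSpace Ω] (P : Measure Ω) (Z : Ω → CountingMeasure) :
    Prop :=
  ∀ α β : ℝ, Real.exp α + Real.exp β = 1 →
    IdentDistrib (fun ω : Ω => (Z ω : Measure ℝ))
      (fun ω : Ω × Ω =>
        translateMeasure α (Z ω.1 : Measure ℝ) + translateMeasure β (Z ω.2 : Measure ℝ))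
      P (P.prod P)

/-- The random measure `N` is a Poisson process on `ℝ` with intensity measure `ν`: the number of
points in a Borel set `A` with `ν A < ∞` is Poisson distributed with mean `ν A`, and the numbers of
points in pairwise disjoint Borel sets are independent. -/
structure IsPoissonProcess {Ω : Type*} [MeasurableSpace Ω] (P : Measure Ω) (ν : Measure ℝ)
    (N : Ω → Measure ℝ) : Prop where
  hasLaw : ∀ A : Set ℝ, MeasurableSet A → ν A ≠ ∞ →
    HasLaw (fun ω => N ω A)
      ((poissonMeasure (ν A).toNNReal).map (fun n : ℕ => (n : ℝ≥0∞))) P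
  indep : ∀ (n : ℕ) (A : Fin n → Set ℝ), (∀ i, MeasurableSet (A i)) →
    Pairwise (fun i j => Disjoint (A i) (A j)) → iIndepFun (fun i ω => N ω (A i)) P

/-- The measure `e^{-x} dx` on `ℝ`. -/
noncomputable def expIntensity : Measure ℝ :=
  volume.withDensity (fun x => ENNReal.ofReal (Real.exp (-x)))

/-- The point process `Z` is (in law) the Poisson process of intensity `e^{-x} dx` decorated by
i.i.d. copies of the point process with law `D`: on some probability space there are the atoms
`ξ_i` of such a Poisson process and i.i.d. `X_i` with law `D`, independent of `(ξ_i)_i`, such that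
`Z` is equal in law to `∑ i, T_{ξ_i} X_i`. -/
def HasLePageRepresentation {Ω : Type*} [MeasurableSpace Ω] (P : Measure Ω)
    (Z : Ω → CountingMeasure) (D : ProbabilityMeasure CountingMeasure) : Prop :=
  ∃ (Ω' : Type) (_ : MeasurableSpace Ω') (P' : Measure Ω') (_ : IsProbabilityMeasure P')
    (ξ : ℕ → Ω' → ℝ) (X : ℕ → Ω' → CountingMeasure),
    (∀ i, Measurable (ξ i)) ∧
    IsPoissonProcess P' expIntensity (fun ω => Measure.sum fun i => Measure.dirac (ξ i ω)) ∧
    (∀ i, Measurable (X i)) ∧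
    (∀ i, HasLaw (X i) (D : Measure CountingMeasure) P') ∧
    iIndepFun X P' ∧
    IndepFun (fun ω i => ξ i ω) (fun ω i => X i ω) P' ∧
    IdentDistrib (fun ω => (Z ω : Measure ℝ))
      (fun ω => Measure.sum fun i => translateMeasure (ξ i ω) (X i ω : Measure ℝ)) P P'

/-- `∫^∞ P(D(A + x) > 0) e^x dx < ∞` for every bounded Borel set `A`. As the integrand is at most
`e^x`, the lower limit of the integral is immaterial. -/
def DecorationCondition (D : ProbabilityMeasure CountingMeasure) : Prop :=
  ∀ A : Set ℝ, MeasurableSet A → Bornology.IsBounded A →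
    ∫⁻ x in Ioi (0 : ℝ),
      (D : Measure CountingMeasure) {μ | 0 < (μ : Measure ℝ) {y | y - x ∈ A}}
        * ENNReal.ofReal (Real.exp x) < ∞

/-- `M(μ) = inf {x : μ (x, ∞) < min (1, μ(ℝ)/2)}`, the position of the rightmost atom if `μ` is a
nonzero counting measure (`+∞` if there are atoms arbitrarily far to the right, and also if
`μ = 0`). -/
noncomputable def rightmost (μ : Measure ℝ) : EReal :=
  ⨅ (x : ℝ) (_ : μ (Ioi x) < min 1 (μ univ / 2)), (x : EReal)

/-! Everything is read off the Laplace exponent L(f) = -log E exp(-∫ f dZ), for f with values in [0,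
∞]. The value ∞ matters: L(∞·1_A) = -log P(Z(A) = 0), and adding ∞·1_A to f inserts the event {Z(A)
= 0} into the expectation.

Superposability says L(f) = L(f(· + α)) + L(f(· + β)) when e^α + e^β = 1. Hence c ↦ L(f(· + log c))
is additive on (0, ∞), therefore linear, and L(f(· + t)) = e^t L(f)
(`Superposable.laplaceExponent_add`). Conversely, a decorated Poisson process has exponent ∫ (1 - E
exp(-∫ f(y + x) D(dy))) e^{-x} dx (`lintegral_expNeg_sum_translateMeasure`), which scales in this
way by a change of variables, so it is superposable.

For the existence of D, scaling and Borel–Cantelli show that Z has finitely many atoms in each (x,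
∞). Put C = L(∞·1_(0,∞)). It is finite, and positive when Z is not a.s. zero. Condition Z on having
an atom beyond n and shift it by -n: as n → ∞ the Laplace functionals converge to (L(f + ∞·1_(0,∞))
- L(f)) / C (`Superposable.tendsto_cond`). Compactness of (ℕ∞)^ℚ provides a limit law Q, that of one
cluster conditioned to reach (0, ∞). Scaling shows that Q conditioned on reaching (s, ∞) and shifted
back by s is again Q. So under Q the rightmost atom is exponential of rate 1 and independent of the
cluster seen from it (`Superposable.map_maxAtom_shiftMax`). Integrating over this exponential
variable gives L as C times the exponent of the recentred cluster, and shifting that cluster by m =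
log C absorbs the constant. Condition (a) then amounts to the finiteness of L(∞·1_(-k,∞)) for all k.

For uniqueness, a decoration D with rightmost atom m forces C = e^m. Moreover Q must be the law of D
shifted by an independent variable of density e^{-x-m} on (-m, ∞). Recentring at m removes that
shift, so D is the image of Q under recentring, and Q depends on Z alone
(`HasLePageRepresentation.eq_map_shiftMax`). -/

open Filter Topology
open scoped NNReal BoundedContinuousFunction

/-! ### The function `x ↦ e⁻ˣ` on `[0, ∞]` -/

/-- The function `x ↦ e⁻ˣ` from `[0, ∞]` to `[0, 1]`. -/
noncomputable def expNeg (x : ℝ≥0∞) : ℝ≥0∞ := EReal.exp (-(x : EReal))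

@[simp] lemma expNeg_zero : expNeg 0 = 1 := by simp [expNeg]

@[simp] lemma expNeg_top : expNeg ∞ = 0 := by simp [expNeg]

lemma expNeg_ofReal {r : ℝ} (hr : 0 ≤ r) :
    expNeg (ENNReal.ofReal r) = ENNReal.ofReal (Real.exp (-r)) := by
  rw [expNeg, EReal.coe_ennreal_ofReal, max_eq_left hr, ← EReal.coe_neg, EReal.exp_coe]

lemma expNeg_add (x y : ℝ≥0∞) : expNeg (x + y) = expNeg x * expNeg y := by
  rw [expNeg, EReal.coe_ennreal_add, EReal.neg_add, sub_eq_add_neg, EReal.exp_add]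
  · rfl
  · left; simp
  · right; simp

lemma expNeg_strictAnti : StrictAnti expNeg := fun x y h ↦ by
  unfold expNeg
  rw [EReal.exp_lt_exp_iff, EReal.neg_lt_neg_iff]
  exact_mod_cast h

lemma expNeg_antitone : Antitone expNeg := expNeg_strictAnti.antitone

lemma expNeg_le_one (x : ℝ≥0∞) : expNeg x ≤ 1 := by
  simpa using expNeg_antitone (bot_le : (0 : ℝ≥0∞) ≤ x)

lemma expNeg_ne_top (x : ℝ≥0∞) : expNeg x ≠ ∞ := ((expNeg_le_one x).trans_lt (by simp)).ne

lemma expNeg_eq_zero {x : ℝ≥0∞} : expNeg x = 0 ↔ x = ∞ := by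
  rw [← expNeg_top, expNeg_strictAnti.injective.eq_iff]

lemma continuous_expNeg : Continuous expNeg := by
  unfold expNeg
  exact ENNReal.continuous_exp.comp (continuous_neg.comp continuous_coe_ennreal_ereal)

@[fun_prop] lemma measurable_expNeg : Measurable expNeg := continuous_expNeg.measurable

lemma expNeg_sum {ι : Type*} (s : Finset ι) (f : ι → ℝ≥0∞) :
    expNeg (∑ i ∈ s, f i) = ∏ i ∈ s, expNeg (f i) := by
  classical
  induction s using Finset.induction_on with
  | empty => simp
  | insert a s ha ih => rw [Finset.sum_insert ha, Finset.prod_insert ha, expNeg_add, ih]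

lemma tendsto_expNeg_tsum (f : ℕ → ℝ≥0∞) :
    Tendsto (fun n ↦ ∏ i ∈ Finset.range n, expNeg (f i)) atTop (𝓝 (expNeg (∑' i, f i))) := by
  simp_rw [← expNeg_sum]
  exact (continuous_expNeg.tendsto _).comp ENNReal.summable.hasSum.tendsto_sum_nat

lemma expNeg_natCast_mul (n : ℕ) (x : ℝ≥0∞) : expNeg (n * x) = expNeg x ^ n := by
  rw [← nsmul_eq_mul, ← Finset.card_range n, ← Finset.sum_const, expNeg_sum, Finset.prod_const]

/-! ### Laplace transforms determine laws on `[0, ∞]^ι` -/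

/-- A finite measure on `[0, ∞]^ι`, `ι` finite, is determined by its Laplace transform at integer
points. -/
lemma ext_of_lintegral_expNeg_fintype {ι : Type*} [Fintype ι] {P Q : Measure (ι → ℝ≥0∞)}
    [IsFiniteMeasure P] [IsFiniteMeasure Q]
    (h : ∀ c : ι → ℕ, ∫⁻ x, expNeg (∑ i, c i * x i) ∂P = ∫⁻ x, expNeg (∑ i, c i * x i) ∂Q) :
    P = Q := by
  -- Stone–Weierstrass: polynomials in the coordinates e^{-x_i} separate the points of the compact
  -- space [0, ∞]^ι, and their monomials are exactly the Laplace kernels at integer points.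
  let g : ι → ((ι → ℝ≥0∞) →ᵇ ℝ) := fun i ↦
    BoundedContinuousFunction.mkOfCompact ⟨fun x ↦ (expNeg (x i)).toReal, by
      refine continuous_iff_continuousAt.2 fun x ↦ ?_
      exact (ENNReal.tendsto_toReal (expNeg_ne_top _)).comp
        (continuous_expNeg.comp (continuous_apply i)).continuousAt⟩
  let A : StarSubalgebra ℝ ((ι → ℝ≥0∞) →ᵇ ℝ) :=
    { (MvPolynomial.aeval g : MvPolynomial ι ℝ →ₐ[ℝ] _).range with
      star_mem' := fun {a} ha ↦ by
        have : star a = a := by ext x; simp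
        rw [this]; exact ha }
  have hg : ∀ i x, g i x = (expNeg (x i)).toReal := fun i x ↦ rfl
  refine ext_of_forall_mem_subalgebra_integral_eq_of_polish (𝕜 := ℝ) (A := A) ?_ ?_
  · intro x y hxy
    obtain ⟨i, hi⟩ := Function.ne_iff.1 hxy
    refine ⟨fun z ↦ g i z, ⟨g i, ⟨g i, ⟨MvPolynomial.X i, by simp⟩, rfl⟩, rfl⟩, ?_⟩
    intro hE
    change g i x = g i y at hE
    rw [hg, hg] at hE
    exact hi (expNeg_strictAnti.injective
      ((ENNReal.toReal_eq_toReal_iff' (expNeg_ne_top _) (expNeg_ne_top _)).1 hE))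
  · rintro _ ⟨p, rfl⟩
    change ∫ x, (MvPolynomial.aeval g p) x ∂P = ∫ x, (MvPolynomial.aeval g p) x ∂Q
    induction p using MvPolynomial.induction_on' with
    | monomial u a =>
      have key : ∀ x, (MvPolynomial.aeval g (MvPolynomial.monomial u a)) x =
          a * (expNeg (∑ i, u i * x i)).toReal := by
        intro x
        rw [MvPolynomial.aeval_monomial, Finsupp.prod_fintype _ _ (by simp), expNeg_sum,
          ENNReal.toReal_prod]
        simp only [expNeg_natCast_mul, ENNReal.toReal_pow, ← hg]
        simp [BoundedContinuousFunction.coe_prod]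
      simp_rw [key, integral_const_mul]
      congr 1
      have hm : Measurable fun x : ι → ℝ≥0∞ ↦ expNeg (∑ i, u i * x i) := by fun_prop
      rw [integral_toReal hm.aemeasurable (ae_of_all _ fun _ ↦ (expNeg_ne_top _).lt_top),
        integral_toReal hm.aemeasurable (ae_of_all _ fun _ ↦ (expNeg_ne_top _).lt_top), h]
    | add p q hp hq =>
      simp only [map_add, BoundedContinuousFunction.coe_add, Pi.add_apply]
      rw [integral_add, integral_add, hp, hq]
      all_goals exact BoundedContinuousFunction.integrable _ _

/-- Two finite measures with the same joint Laplace transforms of the functions `e i` give the same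
law to the family `e`. -/
lemma map_eq_of_lintegral_expNeg {ι X Y : Type*} [MeasurableSpace X] [MeasurableSpace Y]
    {e : ι → X → ℝ≥0∞} {e' : ι → Y → ℝ≥0∞}
    {P : Measure X} {Q : Measure Y} [IsFiniteMeasure P] [IsFiniteMeasure Q]
    (he : ∀ i, Measurable (e i)) (he' : ∀ i, Measurable (e' i))
    (h : ∀ (s : Finset ι) (c : ι → ℕ), ∫⁻ x, expNeg (∑ i ∈ s, c i * e i x) ∂P =
      ∫⁻ x, expNeg (∑ i ∈ s, c i * e' i x) ∂Q) :
    P.map (fun x i ↦ e i x) = Q.map (fun x i ↦ e' i x) := by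
  classical
  have hm : Measurable fun x i ↦ e i x := measurable_pi_lambda _ he
  have hm' : Measurable fun x i ↦ e' i x := measurable_pi_lambda _ he'
  -- It suffices to match the finite-dimensional marginals, because a finite measure on a product is
  -- determined by them.
  have hproj : ∀ I : Finset ι, (P.map (fun x i ↦ e i x)).map I.restrict =
      (Q.map (fun x i ↦ e' i x)).map I.restrict := by
    intro I
    refine ext_of_lintegral_expNeg_fintype fun c ↦ ?_
    have hmc : Measurable fun x : I → ℝ≥0∞ ↦ expNeg (∑ i, c i * x i) := by fun_prop
    rw [lintegral_map hmc (by fun_prop), lintegral_map hmc (by fun_prop),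
      lintegral_map (by fun_prop) hm, lintegral_map (by fun_prop) hm']
    have := h I (fun i ↦ if hi : i ∈ I then c ⟨i, hi⟩ else 0)
    convert this using 4
    all_goals
      rw [← Finset.sum_coe_sort I]
      exact Finset.sum_congr rfl fun i _ ↦ by simp
  refine (IsProjectiveLimit.unique (P := fun I ↦ (Q.map (fun x i ↦ e' i x)).map I.restrict)
    (fun I ↦ hproj I) fun I ↦ rfl)

/-! ### Laplace functionals determine laws of random measures -/

/-- Laws on the space of measures are determined by the Laplace functional. -/
lemma identDistrib_of_lintegral_expNeg {Ω Ω' : Type*} [MeasurableSpace Ω] [MeasurableSpace Ω']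
    {P : Measure Ω} {P' : Measure Ω'} [IsFiniteMeasure P] [IsFiniteMeasure P']
    {N : Ω → Measure ℝ} {N' : Ω' → Measure ℝ} (hN : Measurable N) (hN' : Measurable N')
    (h : ∀ f : ℝ → ℝ≥0∞, Measurable f →
      ∫⁻ ω, expNeg (∫⁻ x, f x ∂(N ω)) ∂P = ∫⁻ ω, expNeg (∫⁻ x, f x ∂(N' ω)) ∂P') :
    IdentDistrib N N' P P' := by
  refine ⟨hN.aemeasurable, hN'.aemeasurable, ?_⟩
  let e : {A : Set ℝ // MeasurableSet A} → Measure ℝ → ℝ≥0∞ := fun A μ ↦ μ A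
  have he : ∀ A, Measurable (e A) := fun A ↦ Measure.measurable_coe A.2
  have hE : Measurable fun μ A ↦ e A μ := measurable_pi_lambda _ he
  have hmap : (P.map N).map (fun μ A ↦ e A μ) = (P'.map N').map (fun μ A ↦ e A μ) := by
    rw [Measure.map_map hE hN, Measure.map_map hE hN']
    refine map_eq_of_lintegral_expNeg (e := fun A ω ↦ e A (N ω)) (e' := fun A ω ↦ e A (N' ω))
      (fun A ↦ (he A).comp hN) (fun A ↦ (he A).comp hN') fun s c ↦ ?_
    have key : ∀ μ : Measure ℝ, ∑ A ∈ s, (c A : ℝ≥0∞) * e A μ =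
        ∫⁻ x, ∑ A ∈ s, (A : Set ℝ).indicator (fun _ ↦ (c A : ℝ≥0∞)) x ∂μ := by
      intro μ
      rw [lintegral_finsetSum _ fun A _ ↦ measurable_const.indicator A.2]
      exact Finset.sum_congr rfl fun A _ ↦ by rw [lintegral_indicator_const A.2]
    simp_rw [key]
    exact h _ (Finset.measurable_sum _ fun A _ ↦ measurable_const.indicator A.2)
  ext S hS
  -- The σ-algebra on measures is generated by the evaluations, so equality of the joint laws of all
  -- evaluations is equality of laws.
  have hle : (inferInstance : MeasurableSpace (Measure ℝ)) ≤
      MeasurableSpace.comap (fun μ A ↦ e A μ) inferInstance := by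
    refine iSup₂_le fun A hA ↦ ?_
    rw [← measurable_iff_comap_le]
    exact (measurable_pi_apply (X := fun _ : {A : Set ℝ // MeasurableSet A} ↦ ℝ≥0∞) ⟨A, hA⟩).comp
      (comap_measurable (fun μ A ↦ e A μ))
  obtain ⟨B, hB, rfl⟩ := hle S hS
  rw [← Measure.map_apply hE hB, hmap, Measure.map_apply hE hB]

/-- Nonnegative combinations of indicator functions of half-lines `(q, ∞)` with `q` rational. -/
def IsRatStep (f : ℝ → ℝ≥0∞) : Prop :=
  ∃ (s : Finset ℚ) (c : ℚ → ℝ≥0∞), f = fun x ↦ ∑ q ∈ s, (Ioi (q : ℝ)).indicator (fun _ ↦ c q) x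

lemma lintegral_ratStep (μ : Measure ℝ) (s : Finset ℚ) (c : ℚ → ℝ≥0∞) :
    ∫⁻ x, ∑ q ∈ s, (Ioi (q : ℝ)).indicator (fun _ ↦ c q) x ∂μ = ∑ q ∈ s, c q * μ (Ioi (q : ℝ)) := by
  rw [lintegral_finsetSum _ fun q _ ↦ measurable_const.indicator measurableSet_Ioi]
  exact Finset.sum_congr rfl fun q _ ↦ by rw [lintegral_indicator_const measurableSet_Ioi]

/-- The measure `μ` if it is finite on all half-lines `(x, ∞)`, and `0` otherwise. -/
noncomputable def truncFinite (μ : Measure ℝ) : Measure ℝ :=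
  open Classical in if ∀ q : ℚ, μ (Ioi (q : ℝ)) < ∞ then μ else 0

lemma truncFinite_apply_Ioi_lt_top (μ : Measure ℝ) (x : ℝ) : truncFinite μ (Ioi x) < ∞ := by
  unfold truncFinite
  split_ifs with h
  · obtain ⟨q, hq⟩ := exists_rat_lt x
    exact (measure_mono (Ioi_subset_Ioi hq.le)).trans_lt (h q)
  · simp

/-- Half-lines form a generating π-system, but tail masses determine a measure only when they are
finite. Replacing the other measures by 0 makes the result a measurable function of the countably
many rational tail masses alone. -/
lemma measurable_truncFinite_comap :
    Measurable[MeasurableSpace.comap (fun (μ : Measure ℝ) (q : ℚ) ↦ μ (Ioi (q : ℝ))) inferInstance]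
      truncFinite := by
  let m : MeasurableSpace (Measure ℝ) :=
    MeasurableSpace.comap (fun (μ : Measure ℝ) (q : ℚ) ↦ μ (Ioi (q : ℝ))) inferInstance
  have hev : ∀ q : ℚ, Measurable[m] fun μ : Measure ℝ ↦ μ (Ioi (q : ℝ)) := fun q ↦
    (measurable_pi_apply (X := fun _ : ℚ ↦ ℝ≥0∞) q).comp
      (comap_measurable (fun (μ : Measure ℝ) (q : ℚ) ↦ μ (Ioi (q : ℝ))))
  have hset : MeasurableSet[m] {μ : Measure ℝ | ∀ q : ℚ, μ (Ioi (q : ℝ)) < ∞} := by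
    simp only [ofPred_forall]
    exact MeasurableSet.iInter fun q ↦ hev q measurableSet_Iio
  have htr : ∀ q : ℚ, Measurable[m] fun μ : Measure ℝ ↦ truncFinite μ (Ioi (q : ℝ)) := by
    intro q
    have : (fun μ : Measure ℝ ↦ truncFinite μ (Ioi (q : ℝ))) =
        {μ : Measure ℝ | ∀ q : ℚ, μ (Ioi (q : ℝ)) < ∞}.indicator (fun μ ↦ μ (Ioi (q : ℝ))) := by
      ext μ
      by_cases h : ∀ q : ℚ, μ (Ioi (q : ℝ)) < ∞
      · rw [indicator_of_mem (by exact h), truncFinite, if_pos h]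
      · rw [indicator_of_notMem (by exact h), truncFinite, if_neg h]; rfl
    rw [this]
    exact (hev q).indicator hset
  -- The total mass may still be infinite, so the π-system argument is run on each (-n, ∞), where
  -- the mass is finite.
  have hres : ∀ n : ℕ, @Measurable _ _ m Measure.instMeasurableSpace fun μ : Measure ℝ ↦
      (truncFinite μ).restrict (Ioi (((-n : ℤ) : ℚ) : ℝ)) := by
    intro n
    have : ∀ μ : Measure ℝ, IsFiniteMeasure ((truncFinite μ).restrict (Ioi (((-n : ℤ) : ℚ) : ℝ))) :=
      fun μ ↦ ⟨by simpa using truncFinite_apply_Ioi_lt_top μ _⟩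
    refine @Measurable.measure_of_isPiSystem _ _ m _ _ this _
      (by rw [← Real.borel_eq_generateFrom_Ioi_rat]; exact BorelSpace.measurable_eq)
      Real.isPiSystem_Ioi_rat ?_ ?_
    · simp only [mem_iUnion, mem_singleton_iff]
      rintro _ ⟨q, rfl⟩
      have : Ioi (q : ℝ) ∩ Ioi (((-n : ℤ) : ℚ) : ℝ) = Ioi ((max q (-n : ℤ) : ℚ) : ℝ) := by
        rw [Ioi_inter_Ioi, Rat.cast_max]
      simp only [Measure.restrict_apply measurableSet_Ioi, this]
      exact htr _
    · simp only [Measure.restrict_apply MeasurableSet.univ, univ_inter]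
      exact htr _
  refine @Measure.measurable_of_measurable_coe _ _ _ m _ fun A hA ↦ ?_
  have : ∀ μ : Measure ℝ, truncFinite μ A =
      ⨆ n : ℕ, (truncFinite μ).restrict (Ioi (((-n : ℤ) : ℚ) : ℝ)) A := by
    intro μ
    simp only [Measure.restrict_apply hA]
    rw [← Monotone.measure_iUnion, ← inter_iUnion]
    · congr 1
      refine (inter_eq_left.2 fun x _ ↦ mem_iUnion.2 ?_).symm
      obtain ⟨n, hn⟩ := exists_nat_gt (-x)
      exact ⟨n, by simp; linarith⟩
    · intro a b hab
      refine inter_subset_inter_right _ (Ioi_subset_Ioi ?_)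
      have : (a : ℝ) ≤ b := by exact_mod_cast hab
      simpa using this
  simp_rw [this]
  exact Measurable.iSup fun n ↦ (Measure.measurable_coe hA).comp (hres n)

lemma ae_eq_truncFinite {Ω : Type*} [MeasurableSpace Ω] {P : Measure Ω} {N : Ω → Measure ℝ}
    (hfin : ∀ q : ℚ, ∀ᵐ ω ∂P, N ω (Ioi (q : ℝ)) < ∞) : N =ᵐ[P] truncFinite ∘ N := by
  filter_upwards [ae_all_iff.2 hfin] with ω hω
  rw [Function.comp_apply, truncFinite, if_pos hω]

/-- Laws of random measures which are finite on half-lines `(x, ∞)` are determined by the Laplace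
functional on rational step functions. -/
lemma map_eq_of_lintegral_expNeg_ratStep {Ω Ω' : Type*} [MeasurableSpace Ω]
    [MeasurableSpace Ω'] {P : Measure Ω} {P' : Measure Ω'} [IsFiniteMeasure P] [IsFiniteMeasure P']
    {N : Ω → Measure ℝ} {N' : Ω' → Measure ℝ} (hN : Measurable N) (hN' : Measurable N')
    (hfin : ∀ q : ℚ, ∀ᵐ ω ∂P, N ω (Ioi (q : ℝ)) < ∞)
    (h : ∀ f : ℝ → ℝ≥0∞, IsRatStep f →
      ∫⁻ ω, expNeg (∫⁻ x, f x ∂(N ω)) ∂P = ∫⁻ ω, expNeg (∫⁻ x, f x ∂(N' ω)) ∂P') :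
    P.map N = P'.map N' := by
  let e : ℚ → Measure ℝ → ℝ≥0∞ := fun q μ ↦ μ (Ioi (q : ℝ))
  have he : ∀ q, Measurable (e q) := fun q ↦ Measure.measurable_coe measurableSet_Ioi
  have hE : Measurable fun μ q ↦ e q μ := measurable_pi_lambda _ he
  have hmap : (P.map N).map (fun μ q ↦ e q μ) = (P'.map N').map (fun μ q ↦ e q μ) := by
    rw [Measure.map_map hE hN, Measure.map_map hE hN']
    refine map_eq_of_lintegral_expNeg (e := fun A ω ↦ e A (N ω)) (e' := fun A ω ↦ e A (N' ω))
      (fun A ↦ (he A).comp hN) (fun A ↦ (he A).comp hN') fun s c ↦ ?_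
    simp only [e, ← lintegral_ratStep]
    exact h _ ⟨s, fun q ↦ c q, rfl⟩
  -- Finiteness of a tail is an event of the joint law of the tail masses, so it passes from `N` to
  -- `N'`.
  have hfin' : ∀ q : ℚ, ∀ᵐ ω ∂P', N' ω (Ioi (q : ℝ)) < ∞ := by
    intro q
    have hS : MeasurableSet {x : ℚ → ℝ≥0∞ | ¬ x q < ∞} :=
      (measurableSet_lt (measurable_pi_apply q) measurable_const).compl
    have h0 : ((P.map N).map (fun μ q ↦ e q μ)) {x : ℚ → ℝ≥0∞ | ¬ x q < ∞} =
        ((P'.map N').map (fun μ q ↦ e q μ)) {x : ℚ → ℝ≥0∞ | ¬ x q < ∞} := by rw [hmap]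
    rw [Measure.map_apply hE hS, Measure.map_apply hE hS, Measure.map_apply hN (hE hS),
      Measure.map_apply hN' (hE hS)] at h0
    exact h0.symm.trans (hfin q)
  have hle : MeasurableSpace.comap (fun (μ : Measure ℝ) (q : ℚ) ↦ μ (Ioi (q : ℝ))) inferInstance ≤
      (inferInstance : MeasurableSpace (Measure ℝ)) := measurable_iff_comap_le.1 hE
  have hmt : Measurable truncFinite := measurable_truncFinite_comap.mono hle le_rfl
  rw [Measure.map_congr (ae_eq_truncFinite hfin), Measure.map_congr (ae_eq_truncFinite hfin')]
  ext S hS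
  obtain ⟨B, hB, hBS⟩ := measurable_truncFinite_comap hS
  rw [Measure.map_apply (hmt.comp hN) hS, Measure.map_apply (hmt.comp hN') hS]
  change P (N ⁻¹' (truncFinite ⁻¹' S)) = P' (N' ⁻¹' (truncFinite ⁻¹' S))
  rw [← hBS, ← Measure.map_apply hN (hE hB), ← Measure.map_apply hN' (hE hB),
    ← Measure.map_apply hE hB, ← Measure.map_apply hE hB, hmap]

/-! ### Counting measures and translations -/

lemma IsCountingMeasure.lt_top {μ : Measure ℝ} (h : IsCountingMeasure μ) {A : Set ℝ}
    (hA : Bornology.IsBounded A) : μ A < ∞ := by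
  obtain ⟨r, hr⟩ := hA.subset_closedBall 0
  obtain ⟨n, hn⟩ := h _ measurableSet_closedBall Metric.isBounded_closedBall
  exact (measure_mono hr).trans_lt (hn ▸ ENNReal.natCast_lt_top n)

/-- The mass of a Borel set under a counting measure is a natural number or infinite. -/
lemma IsCountingMeasure.exists_enat {μ : Measure ℝ} (h : IsCountingMeasure μ) {A : Set ℝ}
    (hA : MeasurableSet A) : ∃ n : ℕ∞, μ A = n := by
  have hmono : Monotone fun n : ℕ ↦ A ∩ Metric.closedBall 0 n := fun a b hab ↦
    inter_subset_inter_right _ (Metric.closedBall_subset_closedBall (by exact_mod_cast hab))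
  have hU : ⋃ n : ℕ, A ∩ Metric.closedBall (0 : ℝ) n = A := by
    rw [← inter_iUnion, Metric.iUnion_closedBall_nat, inter_univ]
  choose k hk using fun n : ℕ ↦ h (A ∩ Metric.closedBall 0 n)
    (hA.inter measurableSet_closedBall) (Metric.isBounded_closedBall.subset inter_subset_right)
  have ht := tendsto_measure_iUnion_atTop (μ := μ) hmono
  rw [hU] at ht
  -- The mass of `A` is the limit of the integer masses of its bounded pieces, and the extended
  -- integers are closed in [0, ∞].
  have hcl : IsClosed (range ((↑) : ℕ∞ → ℝ≥0∞)) :=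
    ENat.isClosedEmbedding_toENNReal.isClosed_range
  obtain ⟨m, hm⟩ := hcl.mem_of_tendsto ht (Eventually.of_forall fun n ↦ ⟨k n, by
    simp [hk]⟩)
  exact ⟨m, hm.symm⟩

@[fun_prop] lemma measurable_translateMeasure_left (x : ℝ) : Measurable (translateMeasure x) :=
  Measure.measurable_map _ (by fun_prop)

lemma translateMeasure_apply (x : ℝ) (μ : Measure ℝ) {A : Set ℝ} (hA : MeasurableSet A) :
    translateMeasure x μ A = μ {y | y + x ∈ A} :=
  Measure.map_apply (by fun_prop) hA

lemma translateMeasure_apply_Ioi (x a : ℝ) (μ : Measure ℝ) :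
    translateMeasure x μ (Ioi a) = μ (Ioi (a - x)) := by
  rw [translateMeasure_apply _ _ measurableSet_Ioi]
  congr 1
  ext y
  simp [sub_lt_iff_lt_add]

lemma translateMeasure_univ (x : ℝ) (μ : Measure ℝ) : translateMeasure x μ univ = μ univ := by
  rw [translateMeasure_apply _ _ MeasurableSet.univ]; simp

lemma lintegral_translateMeasure (x : ℝ) (μ : Measure ℝ) {f : ℝ → ℝ≥0∞} (hf : Measurable f) :
    ∫⁻ y, f y ∂(translateMeasure x μ) = ∫⁻ y, f (y + x) ∂μ :=
  lintegral_map hf (by fun_prop)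

lemma translateMeasure_translateMeasure (x y : ℝ) (μ : Measure ℝ) :
    translateMeasure x (translateMeasure y μ) = translateMeasure (y + x) μ := by
  unfold translateMeasure
  rw [Measure.map_map (by fun_prop) (by fun_prop)]
  congr 1
  ext z
  simp [add_assoc]

lemma translateMeasure_zero (μ : Measure ℝ) : translateMeasure 0 μ = μ := by
  unfold translateMeasure; simp

lemma IsCountingMeasure.translate {μ : Measure ℝ} (h : IsCountingMeasure μ) (x : ℝ) :
    IsCountingMeasure (translateMeasure x μ) := by
  intro A hA hb
  rw [translateMeasure_apply _ _ hA]
  refine h _ ((measurable_id.add_const x) hA) ?_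
  obtain ⟨r, hr⟩ := hb.subset_closedBall 0
  refine (Metric.isBounded_closedBall (x := -x) (r := r)).subset fun y hy ↦ ?_
  have := hr hy
  simpa [Real.dist_eq, sub_neg_eq_add] using this

lemma isCountingMeasure_zero : IsCountingMeasure 0 := fun _ _ _ ↦ ⟨0, by simp⟩

namespace CountingMeasure

/-- Translation on the space of counting measures. -/
noncomputable def translate (x : ℝ) (μ : CountingMeasure) : CountingMeasure :=
  ⟨translateMeasure x μ, μ.2.translate x⟩

lemma measurable_apply {A : Set ℝ} (hA : MeasurableSet A) :
    Measurable fun μ : CountingMeasure ↦ (μ : Measure ℝ) A :=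
  (Measure.measurable_coe hA).comp measurable_subtype_coe

/-- The tautological kernel from counting measures to `ℝ`. -/
noncomputable def kernel : Kernel CountingMeasure ℝ where
  toFun := fun μ ↦ μ
  measurable' := measurable_subtype_coe

lemma kernel_apply (μ : CountingMeasure) : kernel μ = μ := rfl

/-- Needed for joint measurability of parametrised integrals. Since masses of bounded sets are
integers, splitting by unit interval and by the value k of its mass gives countably many kernels,
each bounded by its k. -/
instance : IsSFiniteKernel kernel := by
  classical
  have hset : ∀ (n : ℤ) (k : ℕ), MeasurableSet
      {μ : CountingMeasure | (μ : Measure ℝ) (Ioc (n : ℝ) (n + 1)) = k} := fun n k ↦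
    measurable_apply measurableSet_Ioc (measurableSet_singleton _)
  let κ : ℤ → ℕ → Kernel CountingMeasure ℝ := fun n k ↦
    Kernel.piecewise (hset n k) (kernel.restrict (measurableSet_Ioc (a := (n : ℝ)) (b := n + 1))) 0
  have hfin : ∀ n k, IsFiniteKernel (κ n k) := fun n k ↦ by
    refine ⟨⟨k, ENNReal.natCast_lt_top k, fun μ ↦ ?_⟩⟩
    simp only [κ, Kernel.piecewise_apply]
    split_ifs with h
    · rw [Kernel.restrict_apply, Measure.restrict_apply_univ, kernel_apply]
      exact h.le
    · simp
  have hκ : kernel = Kernel.sum fun n ↦ Kernel.sum fun k ↦ κ n k := by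
    ext μ A hA
    have hsum : ∀ n, ∑' k, κ n k μ A = (μ : Measure ℝ) (A ∩ Ioc (n : ℝ) (n + 1)) := by
      intro n
      obtain ⟨k, hk⟩ := μ.2 _ (measurableSet_Ioc (a := (n : ℝ)) (b := n + 1))
        (Metric.isBounded_Ioc _ _)
      rw [tsum_eq_single k]
      · simp only [κ, Kernel.piecewise_apply]
        rw [if_pos (by exact hk), Kernel.restrict_apply, Measure.restrict_apply hA, kernel_apply]
      · intro j hj
        simp only [κ, Kernel.piecewise_apply]
        rw [if_neg]
        · simp
        · intro h
          have : (μ : Measure ℝ) (Ioc (n : ℝ) (n + 1)) = j := h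
          rw [hk] at this
          exact hj (by exact_mod_cast this.symm)
    rw [Kernel.sum_apply' _ _ hA]
    simp_rw [Kernel.sum_apply' _ _ hA, hsum]
    rw [← measure_iUnion, ← inter_iUnion, iUnion_Ioc_intCast, inter_univ, kernel_apply]
    · intro m n hmn
      exact (pairwise_disjoint_Ioc_intCast ℝ hmn).mono inter_subset_right inter_subset_right
    · exact fun n ↦ hA.inter measurableSet_Ioc
  rw [hκ]
  infer_instance

/-- Joint measurability of `(x, μ) ↦ ∫ f(y + x) μ(dy)`. -/
@[fun_prop]
lemma measurable_lintegral_add {f : ℝ → ℝ≥0∞} (hf : Measurable f) :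
    Measurable fun p : ℝ × CountingMeasure ↦ ∫⁻ y, f (y + p.1) ∂(p.2 : Measure ℝ) := by
  have : Measurable fun q : CountingMeasure × ℝ ↦ ∫⁻ y, f (y + q.2) ∂(kernel q.1) := by
    have h := Measurable.lintegral_kernel_prod_right
      (κ := kernel.comap (Prod.fst : CountingMeasure × ℝ → CountingMeasure) measurable_fst)
      (f := fun (q : CountingMeasure × ℝ) y ↦ f (y + q.2)) (by
        simp only [Function.uncurry_def]; fun_prop)
    simpa using h
  exact this.comp measurable_swap

lemma measurable_translate :
    Measurable fun p : ℝ × CountingMeasure ↦ translate p.1 p.2 := by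
  refine Measurable.subtype_mk (Measure.measurable_of_measurable_coe _ fun A hA ↦ ?_)
  have h := measurable_lintegral_add (f := A.indicator 1) (measurable_one.indicator hA)
  have heq : ∀ p : ℝ × CountingMeasure, translateMeasure p.1 (p.2 : Measure ℝ) A =
      ∫⁻ y, A.indicator 1 (y + p.1) ∂(p.2 : Measure ℝ) := fun p ↦ by
    rw [← lintegral_translateMeasure _ _ (measurable_one.indicator hA), lintegral_indicator_one hA]
  simpa only [heq] using h

@[fun_prop] lemma measurable_translate_right (x : ℝ) : Measurable (translate x) :=
  measurable_translate.comp (measurable_const.prodMk measurable_id)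

lemma translate_translate (x y : ℝ) (μ : CountingMeasure) :
    translate x (translate y μ) = translate (y + x) μ :=
  Subtype.ext (translateMeasure_translateMeasure x y μ)

lemma translate_zero (μ : CountingMeasure) : translate 0 μ = μ :=
  Subtype.ext (translateMeasure_zero _)

lemma coe_translate (x : ℝ) (μ : CountingMeasure) :
    (translate x μ : Measure ℝ) = translateMeasure x μ := rfl

end CountingMeasure

/-! ### The position of the rightmost atom -/

lemma rightmost_le_of_measure_Ioi_eq_zero {μ : Measure ℝ} (h0 : μ ≠ 0) {x : ℝ}
    (hx : μ (Ioi x) = 0) : rightmost μ ≤ x := by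
  refine iInf₂_le x ?_
  rw [hx]
  refine lt_min (by simp) (ENNReal.div_pos ?_ (by simp))
  simpa using h0

lemma rightmost_zero : rightmost 0 = ⊤ := by simp [rightmost]

lemma IsCountingMeasure.measure_eq_zero_of_lt_one {μ : Measure ℝ} (h : IsCountingMeasure μ)
    {A : Set ℝ} (hA : MeasurableSet A) (h1 : μ A < 1) : μ A = 0 := by
  obtain ⟨n, hn⟩ := h.exists_enat hA
  rw [hn] at h1 ⊢
  have : n < 1 := by exact_mod_cast h1
  simp [Order.lt_one_iff.1 this]

/-- The rightmost atom is at most `x` exactly when there is no mass to the right of `x`. -/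
lemma IsCountingMeasure.rightmost_le_iff {μ : Measure ℝ} (h : IsCountingMeasure μ) (h0 : μ ≠ 0)
    (x : ℝ) : rightmost μ ≤ x ↔ μ (Ioi x) = 0 := by
  refine ⟨fun hx ↦ ?_, rightmost_le_of_measure_Ioi_eq_zero h0⟩
  have hy : ∀ y : ℝ, x < y → μ (Ioi y) = 0 := by
    intro y hxy
    have : rightmost μ < (y : EReal) := hx.trans_lt (by exact_mod_cast hxy)
    simp only [rightmost, iInf_lt_iff] at this
    obtain ⟨z, hz, hzy⟩ := this
    have hzy' : z < y := by exact_mod_cast hzy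
    have : μ (Ioi z) = 0 :=
      h.measure_eq_zero_of_lt_one measurableSet_Ioi (hz.trans_le (min_le_left _ _))
    exact measure_mono_null (Ioi_subset_Ioi hzy'.le) this
  have hU : Ioi x = ⋃ n : ℕ, Ioi (x + 1 / (n + 1 : ℝ)) := by
    ext z
    simp only [mem_Ioi, mem_iUnion]
    constructor
    · intro hz
      obtain ⟨n, hn⟩ := exists_nat_one_div_lt (sub_pos.2 hz)
      exact ⟨n, by linarith⟩
    · rintro ⟨n, hn⟩
      have : (0 : ℝ) < 1 / (n + 1 : ℝ) := by positivity
      linarith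
  rw [hU]
  exact measure_iUnion_null fun n ↦ hy _ (by
    have : (0 : ℝ) < 1 / (n + 1 : ℝ) := by positivity
    linarith)

/-! ### The inverse of `expNeg` -/

/-- The inverse of `expNeg`. -/
noncomputable def negLog (p : ℝ≥0∞) : ℝ≥0∞ := (-ENNReal.log p).toENNReal

@[fun_prop] lemma measurable_negLog : Measurable negLog := by
  unfold negLog
  exact measurable_ereal_toENNReal.comp (measurable_neg.comp ENNReal.measurable_log)

lemma expNeg_negLog {p : ℝ≥0∞} (hp : p ≤ 1) : expNeg (negLog p) = p := by
  unfold expNeg negLog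
  rw [EReal.coe_toENNReal, neg_neg, ENNReal.exp_log]
  rw [EReal.neg_nonneg]
  simpa using hp

lemma negLog_expNeg (x : ℝ≥0∞) : negLog (expNeg x) = x :=
  expNeg_strictAnti.injective (expNeg_negLog (expNeg_le_one x))

/-! ### Laplace transforms of sums -/

lemma lintegral_expNeg_le_one {Ω : Type*} [MeasurableSpace Ω] {P : Measure Ω}
    [IsProbabilityMeasure P] (Y : Ω → ℝ≥0∞) : ∫⁻ ω, expNeg (Y ω) ∂P ≤ 1 :=
  (lintegral_mono fun ω ↦ expNeg_le_one (Y ω)).trans (by simp)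

lemma tendsto_lintegral_expNeg {Ω : Type*} [MeasurableSpace Ω] {P : Measure Ω} [IsFiniteMeasure P]
    {Y : ℕ → Ω → ℝ≥0∞} {Z : Ω → ℝ≥0∞} (hY : ∀ n, Measurable (Y n))
    (h : ∀ᵐ ω ∂P, Tendsto (fun n ↦ Y n ω) atTop (𝓝 (Z ω))) :
    Tendsto (fun n ↦ ∫⁻ ω, expNeg (Y n ω) ∂P) atTop (𝓝 (∫⁻ ω, expNeg (Z ω) ∂P)) := by
  refine tendsto_lintegral_of_dominated_convergence (fun _ ↦ 1) (fun n ↦ by fun_prop)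
    (fun n ↦ ae_of_all _ fun ω ↦ expNeg_le_one _) (by simp) ?_
  filter_upwards [h] with ω hω
  exact (continuous_expNeg.tendsto _).comp hω

/-- Independence factorises the partial sums, and dominated convergence passes to the limit. Writing
each expectation as e^{-a_i} turns the infinite product into a sum in [0, ∞]. -/
lemma lintegral_expNeg_tsum {Ω : Type*} [MeasurableSpace Ω] {P : Measure Ω}
    {Y : ℕ → Ω → ℝ≥0∞} {a : ℕ → ℝ≥0∞} (hY : ∀ i, Measurable (Y i)) (hind : iIndepFun Y P)
    (h : ∀ i, ∫⁻ ω, expNeg (Y i ω) ∂P = expNeg (a i)) :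
    ∫⁻ ω, expNeg (∑' i, Y i ω) ∂P = expNeg (∑' i, a i) := by
  have : IsProbabilityMeasure P := hind.isProbabilityMeasure
  have h1 : Tendsto (fun n ↦ ∫⁻ ω, expNeg (∑ i ∈ Finset.range n, Y i ω) ∂P) atTop
      (𝓝 (∫⁻ ω, expNeg (∑' i, Y i ω) ∂P)) :=
    tendsto_lintegral_expNeg (fun n ↦ by fun_prop)
      (ae_of_all _ fun ω ↦ ENNReal.summable.hasSum.tendsto_sum_nat)
  have h2 := tendsto_expNeg_tsum a
  refine tendsto_nhds_unique h1 (h2.congr fun n ↦ ?_)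
  simp_rw [expNeg_sum]
  rw [lintegral_prod_eq_prod_lintegral_of_indepFun (Finset.range n) (fun i ω ↦ expNeg (Y i ω))
    (hind.comp (fun _ ↦ expNeg) fun _ ↦ measurable_expNeg) (fun i ↦ by fun_prop)]
  exact Finset.prod_congr rfl fun i _ ↦ (h i).symm

lemma lintegral_expNeg_poissonMeasure (r : ℝ≥0) (x : ℝ≥0∞) :
    ∫⁻ n : ℕ, expNeg (x * n) ∂(poissonMeasure r) = expNeg (r * (1 - expNeg x)) := by
  set q : ℝ := (expNeg x).toReal with hq
  have hq1 : q ≤ 1 := ENNReal.toReal_le_of_le_ofReal (by simp) (by simpa using expNeg_le_one x)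
  have hq0 : 0 ≤ q := ENNReal.toReal_nonneg
  have hx : expNeg x = ENNReal.ofReal q := (ENNReal.ofReal_toReal (expNeg_ne_top _)).symm
  have hterm : ∀ n : ℕ, expNeg (x * n) * poissonMeasure r {n} =
      ENNReal.ofReal (Real.exp (-r) * ((q * r) ^ n / n.factorial)) := by
    intro n
    rw [mul_comm x, expNeg_natCast_mul, hx, poissonMeasure_singleton, ← ENNReal.ofReal_pow hq0,
      ← ENNReal.ofReal_mul (by positivity)]
    congr 1
    rw [mul_pow]; ring
  have hsum : HasSum (fun n : ℕ ↦ Real.exp (-r) * ((q * r) ^ n / n.factorial))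
      (Real.exp (-r) * Real.exp (q * r)) := by
    rw [Real.exp_eq_exp_ℝ]
    exact (NormedSpace.expSeries_div_hasSum_exp (q * (r : ℝ))).mul_left _
  rw [lintegral_countable']
  simp_rw [hterm]
  rw [← ENNReal.ofReal_tsum_of_nonneg (fun n ↦ by positivity) hsum.summable, hsum.tsum_eq,
    ← Real.exp_add, hx, ← ENNReal.ofReal_one, ← ENNReal.ofReal_sub _ hq0, ← ENNReal.ofReal_coe_nnreal,
    ← ENNReal.ofReal_mul (by positivity), expNeg_ofReal (by
      exact mul_nonneg r.2 (by linarith))]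
  congr 2
  ring

/-! ### Laplace functionals of Poisson processes -/

section Poisson

variable {Ω : Type*} [MeasurableSpace Ω] {P : Measure Ω} {ν : Measure ℝ} {N : Ω → Measure ℝ}

lemma IsPoissonProcess.lintegral_expNeg_apply (h : IsPoissonProcess P ν N) {A : Set ℝ}
    (hA : MeasurableSet A) (hν : ν A ≠ ∞) (x : ℝ≥0∞) :
    ∫⁻ ω, expNeg (x * N ω A) ∂P = expNeg ((1 - expNeg x) * ν A) := by
  have hl := (h.hasLaw A hA hν).lintegral_comp (f := fun y ↦ expNeg (x * y))
    (by fun_prop)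
  rw [hl, lintegral_map (by fun_prop) (by fun_prop), lintegral_expNeg_poissonMeasure,
    ENNReal.coe_toNNReal hν, mul_comm]

/-- The level sets of the nonzero values are disjoint, so their counts are independent Poisson
variables and the functional factorises. The support must have finite intensity because only then
does the definition prescribe the laws of the counts. -/
lemma IsPoissonProcess.lintegral_expNeg_simpleFunc (h : IsPoissonProcess P ν N)
    (hN : Measurable N) (g : SimpleFunc ℝ ℝ≥0∞) (hg : ν {x | g x ≠ 0} ≠ ∞) :
    ∫⁻ ω, expNeg (∫⁻ x, g x ∂(N ω)) ∂P = expNeg (∫⁻ x, (1 - expNeg (g x)) ∂ν) := by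
  classical
  set T : Finset ℝ≥0∞ := g.range.filter (· ≠ 0) with hT
  have hsum : ∀ (μ : Measure ℝ) (u : ℝ≥0∞ → ℝ≥0∞), u 0 = 0 →
      ∫⁻ x, u (g x) ∂μ = ∑ y ∈ T, u y * μ (g ⁻¹' {y}) := by
    intro μ u hu
    have : ∀ x, u (g x) = g.map u x := fun x ↦ rfl
    simp_rw [this]
    rw [SimpleFunc.lintegral_eq_lintegral, SimpleFunc.map_lintegral, hT,
      Finset.sum_filter_of_ne]
    rintro y - hy rfl
    simp [hu] at hy
  let A : Fin T.card → Set ℝ := fun i ↦ g ⁻¹' {(T.equivFin.symm i : ℝ≥0∞)}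
  have hAm : ∀ i, MeasurableSet (A i) := fun i ↦ g.measurableSet_preimage _
  have hne : ∀ i, (T.equivFin.symm i : ℝ≥0∞) ≠ 0 := fun i ↦
    (Finset.mem_filter.1 (T.equivFin.symm i).2).2
  have hAfin : ∀ i, ν (A i) ≠ ∞ := fun i ↦ ne_top_of_le_ne_top hg <| measure_mono <| by
    intro x hx
    change g x = _ at hx
    change g x ≠ 0
    rw [hx]
    exact hne i
  have hdisj : Pairwise fun i j ↦ Disjoint (A i) (A j) := by
    intro i j hij
    refine Disjoint.preimage _ (disjoint_singleton.2 fun he ↦ hij ?_)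
    exact T.equivFin.symm.injective (Subtype.ext he)
  have hfin : ∀ F : ℝ≥0∞ → ℝ≥0∞, ∑ y ∈ T, F y = ∑ i, F (T.equivFin.symm i) := by
    intro F
    rw [← Finset.sum_coe_sort T, ← Equiv.sum_comp T.equivFin.symm]
  simp_rw [hsum _ (fun y ↦ y) rfl, hsum ν (fun y ↦ 1 - expNeg y) (by simp), hfin, expNeg_sum]
  have hm : ∀ i, Measurable fun ω ↦ N ω (A i) := fun i ↦
    (Measure.measurable_coe (hAm i)).comp hN
  have hp := lintegral_prod_eq_prod_lintegral_of_indepFun Finset.univ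
    (fun i ω ↦ expNeg ((T.equivFin.symm i : ℝ≥0∞) * N ω (A i)))
    ((h.indep _ A hAm hdisj).comp (fun i y ↦ expNeg ((T.equivFin.symm i : ℝ≥0∞) * y))
      fun i ↦ by fun_prop) (fun i ↦ by fun_prop)
  rw [hp]
  exact Finset.prod_congr rfl fun i _ ↦ h.lintegral_expNeg_apply (hAm i) (hAfin i) _

/-- The Laplace functional of a Poisson process. -/
lemma IsPoissonProcess.lintegral_expNeg (h : IsPoissonProcess P ν N) [IsProbabilityMeasure P]
    [SigmaFinite ν] (hN : Measurable N) {g : ℝ → ℝ≥0∞} (hg : Measurable g) :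
    ∫⁻ ω, expNeg (∫⁻ x, g x ∂(N ω)) ∂P = expNeg (∫⁻ x, (1 - expNeg (g x)) ∂ν) := by
  -- Cutting the simple approximations to the spanning sets keeps their supports of finite intensity
  -- without losing monotone convergence to `g`.
  let G : ℕ → SimpleFunc ℝ ℝ≥0∞ := fun n ↦ (SimpleFunc.eapprox g n).restrict (spanningSets ν n)
  have hGapp : ∀ n x, G n x = (spanningSets ν n).indicator (SimpleFunc.eapprox g n) x := fun n x ↦
    by rw [SimpleFunc.coe_restrict _ (measurableSet_spanningSets ν n)]
  have hmono : ∀ x, Monotone fun n ↦ G n x := by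
    intro x m n hmn
    simp only [hGapp]
    exact (indicator_le_indicator_of_subset (monotone_spanningSets ν hmn) (fun _ ↦ bot_le) x).trans
      (indicator_le_indicator (SimpleFunc.monotone_eapprox g hmn x))
  have hlim : ∀ x, Tendsto (fun n ↦ G n x) atTop (𝓝 (g x)) := by
    intro x
    have h1 : Tendsto (fun n ↦ SimpleFunc.eapprox g n x) atTop (𝓝 (g x)) := by
      rw [← SimpleFunc.iSup_eapprox_apply hg x]
      exact tendsto_atTop_iSup fun m n hmn ↦ SimpleFunc.monotone_eapprox g hmn x
    refine h1.congr' ?_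
    filter_upwards [eventually_ge_atTop (spanningSetsIndex ν x)] with n hn
    rw [hGapp, indicator_of_mem]
    exact monotone_spanningSets ν hn (mem_spanningSetsIndex ν x)
  have hsup : ∀ μ : Measure ℝ, Tendsto (fun n ↦ ∫⁻ x, G n x ∂μ) atTop (𝓝 (∫⁻ x, g x ∂μ)) :=
    fun μ ↦ lintegral_tendsto_of_tendsto_of_monotone (fun n ↦ (G n).measurable.aemeasurable)
      (ae_of_all _ hmono) (ae_of_all _ hlim)
  have hG : ∀ n, ∫⁻ ω, expNeg (∫⁻ x, G n x ∂(N ω)) ∂P =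
      expNeg (∫⁻ x, (1 - expNeg (G n x)) ∂ν) := by
    intro n
    refine h.lintegral_expNeg_simpleFunc hN _ (ne_top_of_le_ne_top
      (measure_spanningSets_lt_top ν n).ne (measure_mono fun x hx ↦ ?_))
    by_contra hx'
    exact hx (by rw [hGapp, indicator_of_notMem hx'])
  have h1 := tendsto_lintegral_expNeg (P := P) (Y := fun n ω ↦ ∫⁻ x, G n x ∂(N ω))
    (fun n ↦ (Measure.measurable_lintegral (G n).measurable).comp hN) (ae_of_all _ fun ω ↦ hsup (N ω))
  have h2 : Tendsto (fun n ↦ expNeg (∫⁻ x, (1 - expNeg (G n x)) ∂ν)) atTop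
      (𝓝 (expNeg (∫⁻ x, (1 - expNeg (g x)) ∂ν))) := by
    refine (continuous_expNeg.tendsto _).comp (lintegral_tendsto_of_tendsto_of_monotone
      (fun n ↦ by fun_prop) (ae_of_all _ fun x m n hmn ↦ ?_)
      (ae_of_all _ fun x ↦ ?_))
    · exact tsub_le_tsub_left (expNeg_antitone (hmono x hmn)) _
    · exact ENNReal.Tendsto.sub tendsto_const_nhds ((continuous_expNeg.tendsto _).comp (hlim x))
        (Or.inl (by simp))
  exact tendsto_nhds_unique h1 (h2.congr fun n ↦ (hG n).symm)

lemma lintegral_sum_indicator_const {n : ℕ} (μ : Measure ℝ) {A : Fin n → Set ℝ}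
    (hA : ∀ i, MeasurableSet (A i)) (c : Fin n → ℝ≥0∞) :
    ∫⁻ x, ∑ i, (A i).indicator (fun _ ↦ c i) x ∂μ = ∑ i, c i * μ (A i) := by
  rw [lintegral_finsetSum _ fun q _ ↦ measurable_const.indicator (hA q)]
  exact Finset.sum_congr rfl fun q _ ↦ by rw [lintegral_indicator_const (hA q)]

/-- A random measure with the Laplace functional of a Poisson process is a Poisson process. -/
lemma isPoissonProcess_of_lintegral_expNeg [IsProbabilityMeasure P] (hN : Measurable N)
    (h : ∀ g : ℝ → ℝ≥0∞, Measurable g →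
      ∫⁻ ω, expNeg (∫⁻ x, g x ∂(N ω)) ∂P = expNeg (∫⁻ x, (1 - expNeg (g x)) ∂ν)) :
    IsPoissonProcess P ν N := by
  have h1 : ∀ A, MeasurableSet A → ∀ c : ℝ≥0∞, ∫⁻ ω, expNeg (c * N ω A) ∂P =
      expNeg ((1 - expNeg c) * ν A) := by
    intro A hA c
    have := h (A.indicator fun _ ↦ c) (measurable_const.indicator hA)
    simp_rw [lintegral_indicator_const hA] at this
    rw [this, ← lintegral_indicator_const hA]
    congr 2
    ext x
    by_cases hx : x ∈ A <;> simp [hx]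
  have hm : ∀ A, MeasurableSet A → Measurable fun ω ↦ N ω A := fun A hA ↦
    (Measure.measurable_coe hA).comp hN
  refine ⟨fun A hA hν ↦ ⟨(hm A hA).aemeasurable, ?_⟩, fun n A hA hd ↦ ?_⟩
  · have hpi := map_eq_of_lintegral_expNeg (ι := Unit) (e := fun _ ω ↦ N ω A)
      (e' := fun _ (k : ℕ) ↦ (k : ℝ≥0∞)) (P := P) (Q := poissonMeasure (ν A).toNNReal)
      (fun _ ↦ hm A hA) (fun _ ↦ by fun_prop) fun s c ↦ by
        rcases Finset.eq_empty_or_nonempty s with rfl | hs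
        · simp
        · obtain rfl : s = {()} := Finset.eq_singleton_iff_unique_mem.2
            ⟨by obtain ⟨v, hv⟩ := hs; exact hv, fun _ _ ↦ rfl⟩
          simp only [Finset.sum_singleton]
          rw [h1 A hA, lintegral_expNeg_poissonMeasure, ENNReal.coe_toNNReal hν, mul_comm]
    have := congrArg (Measure.map fun x : Unit → ℝ≥0∞ ↦ x ()) hpi
    rwa [Measure.map_map (by fun_prop) (measurable_pi_lambda _ fun _ ↦ hm A hA),
      Measure.map_map (by fun_prop) (by fun_prop)] at this
  · rw [iIndepFun_iff_map_fun_eq_pi_map fun i ↦ (hm _ (hA i)).aemeasurable]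
    have hprob : ∀ i, IsProbabilityMeasure (P.map fun ω ↦ N ω (A i)) := fun i ↦
      Measure.isProbabilityMeasure_map (hm _ (hA i)).aemeasurable
    refine ext_of_lintegral_expNeg_fintype fun c ↦ ?_
    rw [lintegral_map (by fun_prop) (measurable_pi_lambda _ fun i ↦ hm _ (hA i))]
    simp_rw [← lintegral_sum_indicator_const _ hA]
    rw [h _ (Finset.measurable_sum _ fun i _ ↦ measurable_const.indicator (hA i))]
    simp_rw [expNeg_sum]
    have hp := lintegral_prod_eq_prod_lintegral_of_indepFun
      (μ := Measure.pi fun i ↦ P.map fun ω ↦ N ω (A i)) Finset.univ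
      (fun i x ↦ expNeg ((c i : ℝ≥0∞) * x i))
      (iIndepFun_pi (X := fun i y ↦ expNeg ((c i : ℝ≥0∞) * y)) fun i ↦ by fun_prop)
      (fun i ↦ by fun_prop)
    rw [hp]
    have hcoord : ∀ i, ∫⁻ x, expNeg ((c i : ℝ≥0∞) * x i)
        ∂(Measure.pi fun i ↦ P.map fun ω ↦ N ω (A i)) =
        expNeg ((1 - expNeg (c i)) * ν (A i)) := by
      intro i
      rw [← h1 _ (hA i), ← lintegral_map (f := fun y ↦ expNeg ((c i : ℝ≥0∞) * y))
        (g := fun ω ↦ N ω (A i)) (by fun_prop) (hm _ (hA i))]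
      exact (measurePreserving_eval (fun i ↦ P.map fun ω ↦ N ω (A i)) i).lintegral_comp
        (f := fun y ↦ expNeg ((c i : ℝ≥0∞) * y)) (by fun_prop)
    simp_rw [hcoord, ← expNeg_sum, ← lintegral_sum_indicator_const ν hA]
    congr 2
    ext x
    -- At most one `A i` contains `x`, so 1 - exp(-∑ c_i 1_{A_i}) equals ∑ (1 - e^{-c_i}) 1_{A_i} at
    -- `x`.
    by_cases hx : ∃ i, x ∈ A i
    · obtain ⟨i, hi⟩ := hx
      have hne : ∀ j, j ≠ i → x ∉ A j := fun j hj hxj ↦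
        Set.disjoint_left.1 (hd hj) hxj hi
      rw [Finset.sum_eq_single i (fun j _ hj ↦ indicator_of_notMem (hne j hj) _) (by simp),
        Finset.sum_eq_single i (fun j _ hj ↦ indicator_of_notMem (hne j hj) _) (by simp),
        indicator_of_mem hi, indicator_of_mem hi]
    · push Not at hx
      simp [indicator_of_notMem (hx _)]

end Poisson

/-! ### The measure `e⁻ˣ dx` -/

lemma expIntensity_Ioi (x : ℝ) : expIntensity (Ioi x) = ENNReal.ofReal (Real.exp (-x)) := by
  rw [expIntensity, withDensity_apply _ measurableSet_Ioi,
    ← ofReal_integral_eq_lintegral_ofReal (integrableOn_exp_neg_Ioi x)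
      (ae_of_all _ fun y ↦ (Real.exp_pos _).le), integral_exp_neg_Ioi]

lemma expIntensity_Ici (x : ℝ) : expIntensity (Ici x) = ENNReal.ofReal (Real.exp (-x)) := by
  rw [← expIntensity_Ioi]
  exact measure_congr ((withDensity_absolutelyContinuous _ _).ae_eq Ioi_ae_eq_Ici).symm

lemma lintegral_expIntensity {g : ℝ → ℝ≥0∞} (hg : Measurable g) :
    ∫⁻ x, g x ∂expIntensity = ∫⁻ x, ENNReal.ofReal (Real.exp (-x)) * g x := by
  rw [expIntensity, lintegral_withDensity_eq_lintegral_mul _ (by fun_prop) hg]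
  rfl

instance : SigmaFinite expIntensity :=
  SigmaFinite.withDensity_of_ne_top (ae_of_all _ fun _ ↦ ENNReal.ofReal_ne_top)

lemma lintegral_expIntensity_add {g : ℝ → ℝ≥0∞} (hg : Measurable g) (t : ℝ) :
    ∫⁻ x, g (x + t) ∂expIntensity = ENNReal.ofReal (Real.exp t) * ∫⁻ x, g x ∂expIntensity := by
  rw [lintegral_expIntensity (by fun_prop), lintegral_expIntensity hg,
    ← lintegral_const_mul _ (by fun_prop),
    ← lintegral_add_right_eq_self (fun x ↦ ENNReal.ofReal (Real.exp t) *
      (ENNReal.ofReal (Real.exp (-x)) * g x)) t]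
  refine lintegral_congr fun x ↦ ?_
  rw [← mul_assoc, ← ENNReal.ofReal_mul (Real.exp_pos _).le, ← Real.exp_add]
  ring_nf

lemma expIntensity_univ : expIntensity univ = ∞ := by
  refine ENNReal.eq_top_of_forall_nnreal_le fun r ↦ ?_
  calc (r : ℝ≥0∞) ≤ ENNReal.ofReal (Real.exp (-(-(r : ℝ)))) := by
        rw [neg_neg, ← ENNReal.ofReal_coe_nnreal]
        exact ENNReal.ofReal_le_ofReal (by linarith [Real.add_one_le_exp (r : ℝ)])
    _ = expIntensity (Ioi (-(r : ℝ))) := (expIntensity_Ioi _).symm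
    _ ≤ _ := measure_mono (subset_univ _)

lemma expIntensity_setOf_exp_neg_le {a : ℝ} (ha : 0 ≤ a) :
    expIntensity {x | Real.exp (-x) ≤ a} = ENNReal.ofReal a := by
  rcases ha.eq_or_lt with rfl | ha
  · have : {x : ℝ | Real.exp (-x) ≤ 0} = ∅ := by
      ext x; simpa using Real.exp_pos (-x)
    simp [this]
  · have : {x : ℝ | Real.exp (-x) ≤ a} = Ici (-Real.log a) := by
      ext x
      simp only [mem_ofPred_eq, mem_Ici, ← Real.le_log_iff_exp_le ha]
      constructor <;> intro h <;> linarith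
    rw [this, expIntensity_Ici, neg_neg, Real.exp_log ha]

/-- The pieces `{n < e⁻ˣ ≤ n + 1}` of unit mass for `e⁻ˣ dx`. -/
def expPiece (n : ℕ) : Set ℝ := {x | Real.exp (-x) ≤ n + 1} \ {x | Real.exp (-x) ≤ n}

lemma measurableSet_expPiece (n : ℕ) : MeasurableSet (expPiece n) :=
  (measurableSet_le (by fun_prop) (by fun_prop)).diff (measurableSet_le (by fun_prop) (by fun_prop))

lemma expIntensity_expPiece (n : ℕ) : expIntensity (expPiece n) = 1 := by
  have hs : {x : ℝ | Real.exp (-x) ≤ n} ⊆ {x | Real.exp (-x) ≤ n + 1} := fun x hx ↦ by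
    have : Real.exp (-x) ≤ n := hx
    change Real.exp (-x) ≤ n + 1
    linarith
  rw [expPiece, measure_sdiff hs
    (measurableSet_le (by fun_prop) (by fun_prop)).nullMeasurableSet
    (by rw [expIntensity_setOf_exp_neg_le (by positivity)]; exact ENNReal.ofReal_ne_top),
    expIntensity_setOf_exp_neg_le (by positivity), expIntensity_setOf_exp_neg_le (by positivity),
    ← ENNReal.ofReal_sub _ (by positivity)]
  simp

lemma sum_restrict_expPiece :
    Measure.sum (fun n ↦ expIntensity.restrict (expPiece n)) = expIntensity := by
  rw [← Measure.restrict_iUnion _ measurableSet_expPiece]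
  · have : ⋃ n, expPiece n = univ := by
      refine eq_univ_of_forall fun x ↦ mem_iUnion.2 ⟨⌈Real.exp (-x)⌉₊ - 1, ?_⟩
      have hpos : 0 < ⌈Real.exp (-x)⌉₊ := Nat.ceil_pos.2 (Real.exp_pos _)
      have hcast : ((⌈Real.exp (-x)⌉₊ - 1 : ℕ) : ℝ) + 1 = ⌈Real.exp (-x)⌉₊ := by
        rw [Nat.cast_sub hpos]; simp
      refine ⟨?_, ?_⟩
      · change Real.exp (-x) ≤ _ + 1
        rw [hcast]; exact Nat.le_ceil _
      · change ¬ (Real.exp (-x) ≤ _)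
        have := Nat.ceil_lt_add_one (Real.exp_pos (-x)).le
        intro h
        linarith
    rw [this, Measure.restrict_univ]
  · have hlt : ∀ m n : ℕ, m < n → Disjoint (expPiece m) (expPiece n) := by
      intro m n hmn
      refine Set.disjoint_left.2 fun x hx hx' ↦ hx'.2 ?_
      have h1 : Real.exp (-x) ≤ m + 1 := hx.1
      have h2 : (m : ℝ) + 1 ≤ n := by exact_mod_cast hmn
      exact h1.trans h2
    intro m n hmn
    rcases hmn.lt_or_gt with h | h
    · exact hlt _ _ h
    · exact (hlt _ _ h).symm

/-! ### Existence of Poisson processes -/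

/-- The `p`-th potential point is used if its rank in its cell is less than the number of points
of the cell. -/
def validPoint (K : ℕ → ℕ) (p : ℕ) : Prop := (Nat.unpair p).2 < K (Nat.unpair p).1

instance (K : ℕ → ℕ) : DecidablePred (validPoint K) := fun p ↦
  inferInstanceAs (Decidable ((Nat.unpair p).2 < K (Nat.unpair p).1))

lemma measurableSet_validPoint (p : ℕ) : MeasurableSet {K : ℕ → ℕ | validPoint K p} :=
  measurableSet_lt measurable_const (measurable_pi_apply _)

/-- The validity predicate, made true everywhere when it holds finitely often. -/
def validPoint' (K : ℕ → ℕ) (p : ℕ) : Prop := validPoint K p ∨ ¬ {q | validPoint K q}.Infinite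

lemma measurableSet_infinite_validPoint : MeasurableSet {K : ℕ → ℕ | {q | validPoint K q}.Infinite} := by
  have : {K : ℕ → ℕ | {q | validPoint K q}.Infinite} =
      ⋂ n : ℕ, ⋃ p : ℕ, {K | n ≤ p ∧ validPoint K p} := by
    ext K
    simp only [mem_ofPred_eq, mem_iInter, mem_iUnion]
    rw [← Nat.frequently_atTop_iff_infinite, frequently_atTop]
  rw [this]
  refine MeasurableSet.iInter fun n ↦ MeasurableSet.iUnion fun p ↦ ?_
  exact (MeasurableSet.const _).inter (measurableSet_validPoint p)

lemma measurableSet_validPoint' (p : ℕ) : MeasurableSet {K : ℕ → ℕ | validPoint' K p} :=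
  (measurableSet_validPoint p).union measurableSet_infinite_validPoint.compl

lemma infinite_validPoint' (K : ℕ → ℕ) : {p | validPoint' K p}.Infinite := by
  by_cases h : {q | validPoint K q}.Infinite
  · exact h.mono fun p hp ↦ Or.inl hp
  · have : {p | validPoint' K p} = univ := eq_univ_of_forall fun p ↦ Or.inr h
    rw [this]
    exact infinite_univ

-- The i-th valid index is k exactly when k is valid and i valid indices precede it. Infinitude of
-- the valid set keeps `Nat.nth` away from its default value 0.
open Classical in
lemma measurable_nth_validPoint' (i : ℕ) : Measurable fun K ↦ Nat.nth (validPoint' K) i := by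
  have hcount : ∀ k, Measurable fun K ↦ Nat.count (validPoint' K) k := by
    intro k
    induction k with
    | zero => simp
    | succ k ih =>
      simp only [Nat.count_succ]
      exact ih.add (Measurable.ite (measurableSet_validPoint' k) measurable_const measurable_const)
  refine measurable_to_countable' fun k ↦ ?_
  have : (fun K ↦ Nat.nth (validPoint' K) i) ⁻¹' {k} =
      {K | validPoint' K k} ∩ (fun K ↦ Nat.count (validPoint' K) k) ⁻¹' {i} := by
    ext K
    simp only [mem_preimage, mem_singleton_iff, mem_inter_iff, mem_ofPred_eq]
    constructor
    · rintro rfl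
      exact ⟨Nat.nth_mem_of_infinite (infinite_validPoint' K) i,
        Nat.count_nth_of_infinite (infinite_validPoint' K) i⟩
    · rintro ⟨h1, rfl⟩
      exact Nat.nth_count h1
  rw [this]
  exact (measurableSet_validPoint' k).inter (hcount k (measurableSet_singleton i))

/-- Cell n receives a Poisson(1) number of points drawn independently from `ν n`. Given the numbers
K, the functional is exp(-∑ t_n K_n) with e^{-t_n} = ∫ e^{-g} dν_n, and the Poisson generating
function integrates K out. -/
lemma lintegral_expNeg_validPoint (ν : ℕ → Measure ℝ) [∀ n, IsProbabilityMeasure (ν n)]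
    {g : ℝ → ℝ≥0∞} (hg : Measurable g) :
    ∫⁻ ω : (ℕ → ℕ) × (ℕ → ℝ), expNeg (∑' p, if validPoint ω.1 p then g (ω.2 p) else 0)
      ∂((Measure.infinitePi fun _ ↦ poissonMeasure 1).prod
        (Measure.infinitePi fun p ↦ ν (Nat.unpair p).1)) =
      expNeg (∫⁻ x, (1 - expNeg (g x)) ∂(Measure.sum ν)) := by
  have hm : Measurable fun ω : (ℕ → ℕ) × (ℕ → ℝ) ↦
      ∑' p, if validPoint ω.1 p then g (ω.2 p) else 0 :=
    Measurable.tsum fun p ↦ Measurable.ite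
      (measurable_fst (measurableSet_validPoint p)) (by fun_prop) measurable_const
  rw [lintegral_prod _ (by exact (measurable_expNeg.comp hm).aemeasurable)]
  let t : ℕ → ℝ≥0∞ := fun n ↦ negLog (∫⁻ x, expNeg (g x) ∂(ν n))
  have ht : ∀ n, expNeg (t n) = ∫⁻ x, expNeg (g x) ∂(ν n) := fun n ↦
    expNeg_negLog (lintegral_expNeg_le_one _)
  have hinner : ∀ K : ℕ → ℕ, ∫⁻ u : ℕ → ℝ, expNeg (∑' p, if validPoint K p then g (u p) else 0)
      ∂(Measure.infinitePi fun p ↦ ν (Nat.unpair p).1) = expNeg (∑' n, t n * K n) := by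
    intro K
    have hsum : ∑' n, t n * K n = ∑' p, if validPoint K p then t (Nat.unpair p).1 else 0 := by
      have hpair : (∑' p, if validPoint K p then t (Nat.unpair p).1 else 0) =
          ∑' c : ℕ × ℕ, if c.2 < K c.1 then t c.1 else 0 := by
        rw [← Nat.pairEquiv.tsum_eq]
        refine tsum_congr fun c ↦ ?_
        simp [validPoint, Nat.pairEquiv_apply, Function.uncurry]
      rw [hpair, ENNReal.tsum_prod (f := fun a b ↦ if b < K a then t a else 0)]
      congr 1
      ext n
      rw [tsum_eq_sum (s := Finset.range (K n)) (by
        intro b hb; rw [if_neg]; simpa using hb), Finset.sum_congr rfl (g := fun _ ↦ t n) (by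
        intro b hb; rw [if_pos]; simpa using hb)]
      simp [mul_comm]
    rw [hsum]
    refine lintegral_expNeg_tsum (Y := fun p (u : ℕ → ℝ) ↦ if validPoint K p then g (u p) else 0)
      (fun p ↦ ?_) ?_ fun p ↦ ?_
    · split_ifs <;> fun_prop
    · exact iIndepFun_infinitePi (X := fun p x ↦ if validPoint K p then g x else 0)
        fun p ↦ by split_ifs <;> fun_prop
    · split_ifs with hv
      · rw [ht]
        exact (measurePreserving_eval_infinitePi (fun p ↦ ν (Nat.unpair p).1) p).lintegral_comp
          (f := fun x ↦ expNeg (g x)) (by fun_prop)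
      · simp
  simp_rw [hinner]
  rw [lintegral_expNeg_tsum (a := fun n ↦ 1 - expNeg (t n)) (fun n ↦ by fun_prop)
    (iIndepFun_infinitePi (X := fun n (k : ℕ) ↦ t n * (k : ℝ≥0∞)) fun n ↦ by fun_prop)
    fun n ↦ ?_]
  · rw [lintegral_sum_measure]
    congr 2
    ext n
    rw [lintegral_sub (by fun_prop) (ne_top_of_le_ne_top ENNReal.one_ne_top
      (lintegral_expNeg_le_one _)) (ae_of_all _ fun x ↦ expNeg_le_one _), ht]
    simp
  · rw [(measurePreserving_eval_infinitePi (fun _ : ℕ ↦ poissonMeasure 1) n).lintegral_comp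
      (f := fun k : ℕ ↦ expNeg (t n * k)) (by fun_prop), lintegral_expNeg_poissonMeasure]
    simp

/-- Existence of the Poisson process of intensity `e⁻ˣ dx`, with an enumeration of its points. -/
lemma exists_poisson_points : ∃ (Ω : Type) (_ : MeasurableSpace Ω) (P : Measure Ω)
    (_ : IsProbabilityMeasure P) (ξ : ℕ → Ω → ℝ), (∀ i, Measurable (ξ i)) ∧
    ∀ g : ℝ → ℝ≥0∞, Measurable g →
      ∫⁻ ω, expNeg (∑' i, g (ξ i ω)) ∂P = expNeg (∫⁻ x, (1 - expNeg (g x)) ∂expIntensity) := by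
  have hprob : ∀ n, IsProbabilityMeasure (expIntensity.restrict (expPiece n)) := fun n ↦
    ⟨by rw [Measure.restrict_apply_univ, expIntensity_expPiece]⟩
  let P : Measure ((ℕ → ℕ) × (ℕ → ℝ)) := (Measure.infinitePi fun _ ↦ poissonMeasure 1).prod
    (Measure.infinitePi fun p ↦ expIntensity.restrict (expPiece (Nat.unpair p).1))
  have hP : ∀ g : ℝ → ℝ≥0∞, Measurable g →
      ∫⁻ ω, expNeg (∑' p, if validPoint ω.1 p then g (ω.2 p) else 0) ∂P =
      expNeg (∫⁻ x, (1 - expNeg (g x)) ∂expIntensity) := by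
    intro g hg
    have := lintegral_expNeg_validPoint (fun n ↦ expIntensity.restrict (expPiece n)) hg
    rwa [sum_restrict_expPiece] at this
  -- Take g = 1: the intensity has infinite mass, so the number of points has Laplace transform 0
  -- and is a.s. infinite. Hence the points can be enumerated by all of ℕ.
  have hinf : ∀ᵐ ω ∂P, {p | validPoint ω.1 p}.Infinite := by
    have h := hP (fun _ ↦ 1) measurable_const
    have hm : Measurable fun ω : (ℕ → ℕ) × (ℕ → ℝ) ↦
        ∑' p, if validPoint ω.1 p then (1 : ℝ≥0∞) else 0 :=
      Measurable.tsum fun p ↦ Measurable.ite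
        (measurable_fst (measurableSet_validPoint p)) (by fun_prop) measurable_const
    rw [lintegral_const, expIntensity_univ, ENNReal.mul_top, expNeg_top,
      lintegral_eq_zero_iff (by fun_prop)] at h
    · filter_upwards [h] with ω hω hfin
      rw [Pi.zero_apply, expNeg_eq_zero,
        tsum_eq_sum (s := hfin.toFinset) (by
          intro p hp; rw [if_neg]; simpa using hp)] at hω
      refine (ENNReal.sum_lt_top.2 fun p _ ↦ ?_).ne hω
      split_ifs <;> simp
    · rw [← expNeg_zero]
      exact (tsub_pos_iff_lt.2 (expNeg_strictAnti (by simp))).ne'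
  refine ⟨_, _, P, inferInstance, fun i ω ↦ ω.2 (Nat.nth (validPoint' ω.1) i), fun i ↦ ?_,
    fun g hg ↦ ?_⟩
  · have h1 : Measurable fun q : (ℕ → ℝ) × ℕ ↦ q.1 q.2 :=
      measurable_from_prod_countable_left fun n ↦ measurable_pi_apply n
    exact h1.comp (measurable_snd.prodMk ((measurable_nth_validPoint' i).comp measurable_fst))
  · rw [← hP g hg]
    refine lintegral_congr_ae ?_
    filter_upwards [hinf] with ω hω
    have hv : ∀ p, validPoint' ω.1 p ↔ validPoint ω.1 p := fun p ↦
      ⟨fun h ↦ h.resolve_right (not_not.2 hω), Or.inl⟩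
    congr 1
    have hinj := Nat.nth_injective (infinite_validPoint' ω.1)
    rw [← hinj.tsum_eq (f := fun p ↦ if validPoint ω.1 p then g (ω.2 p) else 0)]
    · refine tsum_congr fun i ↦ ?_
      rw [if_pos ((hv _).1 (Nat.nth_mem_of_infinite (infinite_validPoint' ω.1) i))]
    · rw [Nat.range_nth_of_infinite (infinite_validPoint' ω.1)]
      intro p hp
      refine (hv p).2 ?_
      by_contra h
      exact hp (if_neg h)

/-! ### Decorated Poisson processes -/

/-- The Laplace exponent of the Poisson process of intensity `e⁻ˣ dx` decorated by copies of `D`. -/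
noncomputable def clusterExponent (D : Measure CountingMeasure) (f : ℝ → ℝ≥0∞) : ℝ≥0∞ :=
  ∫⁻ x, (1 - ∫⁻ μ, expNeg (∫⁻ y, f (y + x) ∂(μ : Measure ℝ)) ∂D) ∂expIntensity

lemma measurable_lintegral_expNeg_add (D : Measure CountingMeasure) [SFinite D] {f : ℝ → ℝ≥0∞}
    (hf : Measurable f) :
    Measurable fun x ↦ ∫⁻ μ, expNeg (∫⁻ y, f (y + x) ∂(μ : Measure ℝ)) ∂D :=
  (measurable_expNeg.comp (CountingMeasure.measurable_lintegral_add hf)).lintegral_prod_right'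

/-- Translating the variable of integration multiplies the density e^{-x} by e^t. This is the
scaling that makes decorated processes superposable. -/
lemma clusterExponent_add (D : Measure CountingMeasure) [SFinite D] {f : ℝ → ℝ≥0∞}
    (hf : Measurable f) (t : ℝ) :
    clusterExponent D (fun y ↦ f (y + t)) = ENNReal.ofReal (Real.exp t) * clusterExponent D f := by
  have hm : Measurable fun x ↦ 1 - ∫⁻ μ, expNeg (∫⁻ y, f (y + x) ∂(μ : Measure ℝ)) ∂D :=
    measurable_const.sub (measurable_lintegral_expNeg_add D hf)
  unfold clusterExponent
  rw [← lintegral_expIntensity_add hm]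
  refine lintegral_congr fun x ↦ ?_
  simp only [add_assoc]

lemma measurable_sum_translateMeasure {Ω : Type*} [MeasurableSpace Ω] {ξ : ℕ → Ω → ℝ}
    {X : ℕ → Ω → CountingMeasure} (hξ : ∀ i, Measurable (ξ i)) (hX : ∀ i, Measurable (X i)) :
    Measurable fun ω ↦ Measure.sum fun i ↦ translateMeasure (ξ i ω) (X i ω : Measure ℝ) := by
  refine Measure.measurable_of_measurable_coe _ fun A hA ↦ ?_
  simp_rw [Measure.sum_apply _ hA]
  exact Measurable.tsum fun i ↦ (CountingMeasure.measurable_apply hA).comp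
    (CountingMeasure.measurable_translate.comp ((hξ i).prodMk (hX i)))

lemma measurable_sum_dirac {Ω : Type*} [MeasurableSpace Ω] {ξ : ℕ → Ω → ℝ}
    (hξ : ∀ i, Measurable (ξ i)) : Measurable fun ω ↦ Measure.sum fun i ↦ Measure.dirac (ξ i ω) := by
  refine Measure.measurable_of_measurable_coe _ fun A hA ↦ ?_
  simp_rw [Measure.sum_apply _ hA]
  exact Measurable.tsum fun i ↦ (Measure.measurable_coe hA).comp
    (Measure.measurable_dirac.comp (hξ i))

/-- The Laplace functional of a decorated Poisson process. -/
lemma lintegral_expNeg_sum_translateMeasure {Ω : Type*} [MeasurableSpace Ω] {P : Measure Ω}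
    [IsProbabilityMeasure P] {ξ : ℕ → Ω → ℝ} {X : ℕ → Ω → CountingMeasure}
    {D : Measure CountingMeasure} [IsProbabilityMeasure D]
    (hξ : ∀ i, Measurable (ξ i)) (hX : ∀ i, Measurable (X i))
    (hpois : IsPoissonProcess P expIntensity fun ω ↦ Measure.sum fun i ↦ Measure.dirac (ξ i ω))
    (hlaw : ∀ i, HasLaw (X i) D P) (hind : iIndepFun X P)
    (hξX : IndepFun (fun ω i ↦ ξ i ω) (fun ω i ↦ X i ω) P) {f : ℝ → ℝ≥0∞} (hf : Measurable f) :
    ∫⁻ ω, expNeg (∫⁻ y, f y ∂(Measure.sum fun i ↦ translateMeasure (ξ i ω) (X i ω : Measure ℝ))) ∂P =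
      expNeg (clusterExponent D f) := by
  let h : ℝ → ℝ≥0∞ := fun x ↦ ∫⁻ μ, expNeg (∫⁻ y, f (y + x) ∂(μ : Measure ℝ)) ∂D
  have hh : Measurable h := measurable_lintegral_expNeg_add D hf
  have hh1 : ∀ x, h x ≤ 1 := fun x ↦ lintegral_expNeg_le_one _
  have hH : Measurable fun x ↦ negLog (h x) := measurable_negLog.comp hh
  have hmξ : Measurable fun ω i ↦ ξ i ω := measurable_pi_lambda _ hξ
  have hmX : Measurable fun ω i ↦ X i ω := measurable_pi_lambda _ hX
  have hΦ : ∀ i, Measurable fun p : (ℕ → ℝ) × (ℕ → CountingMeasure) ↦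
      ∫⁻ y, f (y + p.1 i) ∂(p.2 i : Measure ℝ) := fun i ↦
    (CountingMeasure.measurable_lintegral_add hf).comp
      (f := fun p : (ℕ → ℝ) × (ℕ → CountingMeasure) ↦ (p.1 i, p.2 i)) (by fun_prop)
  have hmeas : Measurable fun p : (ℕ → ℝ) × (ℕ → CountingMeasure) ↦
      expNeg (∑' i, ∫⁻ y, f (y + p.1 i) ∂(p.2 i : Measure ℝ)) :=
    measurable_expNeg.comp (Measurable.tsum hΦ)
  -- With the atoms frozen at `a`, the independent decorations contribute the product of the `h (a
  -- i)`. As the exponential of a sum it becomes a Laplace functional of the undecorated Poisson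
  -- process at `negLog ∘ h`.
  have hinner : ∀ a : ℕ → ℝ, ∫⁻ b, expNeg (∑' i, ∫⁻ y, f (y + a i) ∂(b i : Measure ℝ))
      ∂(P.map fun ω i ↦ X i ω) = expNeg (∑' i, negLog (h (a i))) := by
    intro a
    rw [lintegral_map (by exact hmeas.comp (measurable_const.prodMk measurable_id)) hmX]
    refine lintegral_expNeg_tsum
      (Y := fun i ω ↦ ∫⁻ y, f (y + a i) ∂(X i ω : Measure ℝ)) (fun i ↦ ?_) ?_ fun i ↦ ?_
    · exact (CountingMeasure.measurable_lintegral_add hf).comp (measurable_const.prodMk (hX i))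
    · exact hind.comp (fun i (μ : CountingMeasure) ↦ ∫⁻ y, f (y + a i) ∂(μ : Measure ℝ)) fun i ↦
        (CountingMeasure.measurable_lintegral_add hf).comp (measurable_const.prodMk measurable_id)
    · rw [expNeg_negLog (hh1 _)]
      exact (hlaw i).lintegral_comp
        (f := fun μ : CountingMeasure ↦ expNeg (∫⁻ y, f (y + a i) ∂(μ : Measure ℝ)))
        (measurable_expNeg.comp ((CountingMeasure.measurable_lintegral_add hf).comp
          (measurable_const.prodMk measurable_id))).aemeasurable
  have hprob : IsProbabilityMeasure (P.map fun ω i ↦ X i ω) :=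
    Measure.isProbabilityMeasure_map hmX.aemeasurable
  calc _ = ∫⁻ ω, expNeg (∑' i, ∫⁻ y, f (y + ξ i ω) ∂(X i ω : Measure ℝ)) ∂P := by
        refine lintegral_congr fun ω ↦ ?_
        rw [lintegral_sum_measure]
        simp_rw [lintegral_translateMeasure _ _ hf]
    _ = ∫⁻ p : (ℕ → ℝ) × (ℕ → CountingMeasure),
          expNeg (∑' i, ∫⁻ y, f (y + p.1 i) ∂(p.2 i : Measure ℝ))
          ∂((P.map fun ω i ↦ ξ i ω).prod (P.map fun ω i ↦ X i ω)) := by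
        rw [← (indepFun_iff_map_prod_eq_prod_map_map hmξ.aemeasurable hmX.aemeasurable).1 hξX,
          lintegral_map hmeas (hmξ.prodMk hmX)]
    _ = ∫⁻ a, expNeg (∑' i, negLog (h (a i))) ∂(P.map fun ω i ↦ ξ i ω) := by
        rw [lintegral_prod _ hmeas.aemeasurable]
        exact lintegral_congr hinner
    _ = ∫⁻ ω, expNeg (∑' i, negLog (h (ξ i ω))) ∂P :=
        lintegral_map (by fun_prop) hmξ
    _ = ∫⁻ ω, expNeg (∫⁻ x, negLog (h x) ∂(Measure.sum fun i ↦ Measure.dirac (ξ i ω))) ∂P := by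
        refine lintegral_congr fun ω ↦ ?_
        rw [lintegral_sum_measure]
        simp_rw [lintegral_dirac' _ hH]
    _ = _ := by
        rw [hpois.lintegral_expNeg (measurable_sum_dirac hξ) hH]
        simp_rw [expNeg_negLog (hh1 _)]
        rfl

lemma measurable_coe_comp {Ω : Type*} [MeasurableSpace Ω] {Z : Ω → CountingMeasure}
    (hZ : Measurable Z) : Measurable fun ω ↦ (Z ω : Measure ℝ) :=
  measurable_subtype_coe.comp hZ

section Representation

variable {Ω : Type*} [MeasurableSpace Ω] {P : Measure Ω} {Z : Ω → CountingMeasure}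
  {D : ProbabilityMeasure CountingMeasure}

lemma HasLePageRepresentation.lintegral_expNeg (h : HasLePageRepresentation P Z D)
    {f : ℝ → ℝ≥0∞} (hf : Measurable f) :
    ∫⁻ ω, expNeg (∫⁻ y, f y ∂(Z ω : Measure ℝ)) ∂P = expNeg (clusterExponent D f) := by
  obtain ⟨Ω', _, P', _, ξ, X, hξ, hpois, hX, hlaw, hind, hξX, hid⟩ := h
  rw [← lintegral_expNeg_sum_translateMeasure hξ hX hpois hlaw hind hξX hf]
  exact (hid.comp (measurable_expNeg.comp (Measure.measurable_lintegral hf))).lintegral_eq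

/-- To check that `D` decorates a Poisson process to give `Z` it suffices to compare Laplace
functionals on rational step functions. -/
lemma hasLePageRepresentation_of_ratStep [IsProbabilityMeasure P] (hZ : Measurable Z)
    (hfin : ∀ q : ℚ, ∀ᵐ ω ∂P, (Z ω : Measure ℝ) (Ioi (q : ℝ)) < ∞)
    (h : ∀ f, IsRatStep f → ∫⁻ ω, expNeg (∫⁻ y, f y ∂(Z ω : Measure ℝ)) ∂P =
      expNeg (clusterExponent D f)) :
    HasLePageRepresentation P Z D := by
  obtain ⟨Ω₁, _, P₁, _, ξ, hξ, hL⟩ := exists_poisson_points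
  let P' : Measure (Ω₁ × (ℕ → CountingMeasure)) :=
    P₁.prod (Measure.infinitePi fun _ ↦ (D : Measure CountingMeasure))
  have hξ' : ∀ i, Measurable fun ω : Ω₁ × (ℕ → CountingMeasure) ↦ ξ i ω.1 := fun i ↦
    (hξ i).comp measurable_fst
  have hX' : ∀ i, Measurable fun ω : Ω₁ × (ℕ → CountingMeasure) ↦ ω.2 i := fun i ↦ by fun_prop
  have hpois : IsPoissonProcess P' expIntensity
      fun ω ↦ Measure.sum fun i ↦ Measure.dirac (ξ i ω.1) := by
    refine isPoissonProcess_of_lintegral_expNeg (measurable_sum_dirac hξ') fun g hg ↦ ?_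
    rw [← hL g hg]
    simp_rw [lintegral_sum_measure, lintegral_dirac' _ hg]
    rw [lintegral_prod _ (by fun_prop)]
    simp
  have hlaw : ∀ i, HasLaw (fun ω : Ω₁ × (ℕ → CountingMeasure) ↦ ω.2 i) D P' := fun i ↦
    ((measurePreserving_eval_infinitePi (fun _ : ℕ ↦ (D : Measure CountingMeasure)) i).comp
      measurePreserving_snd).hasLaw
  have hind : iIndepFun (fun i (ω : Ω₁ × (ℕ → CountingMeasure)) ↦ ω.2 i) P' := by
    rw [iIndepFun_iff_map_fun_eq_infinitePi_map hX']
    simp_rw [fun i ↦ (hlaw i).map_eq]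
    exact (measurePreserving_snd (μ := P₁)
      (ν := Measure.infinitePi fun _ : ℕ ↦ (D : Measure CountingMeasure))).map_eq
  have hξX : IndepFun (fun (ω : Ω₁ × (ℕ → CountingMeasure)) i ↦ ξ i ω.1)
      (fun ω i ↦ ω.2 i) P' :=
    indepFun_prod (X := fun ω i ↦ ξ i ω) (Y := fun b : ℕ → CountingMeasure ↦ b)
      (measurable_pi_lambda _ hξ) measurable_id
  have hm := measurable_sum_translateMeasure hξ' hX'
  refine ⟨_, _, P', inferInstance, fun i ω ↦ ξ i ω.1, fun i ω ↦ ω.2 i, hξ', hpois, hX', hlaw,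
    hind, hξX, (measurable_coe_comp hZ).aemeasurable, hm.aemeasurable, ?_⟩
  refine map_eq_of_lintegral_expNeg_ratStep (measurable_coe_comp hZ) hm hfin fun f hf ↦ ?_
  have hfm : Measurable f := by
    obtain ⟨s, c, rfl⟩ := hf
    exact Finset.measurable_sum _ fun q _ ↦ measurable_const.indicator measurableSet_Ioi
  rw [h f hf, lintegral_expNeg_sum_translateMeasure hξ' hX' hpois hlaw hind hξX hfm]

/-- The exponent of the superposition is (e^α + e^β) times that of Z, by scaling, and Laplace
functionals determine laws. -/
lemma HasLePageRepresentation.superposable [IsProbabilityMeasure P]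
    (h : HasLePageRepresentation P Z D) (hZ : Measurable Z) : Superposable P Z := by
  intro α β hαβ
  have hm := measurable_coe_comp hZ
  have hm2 : Measurable fun ω : Ω × Ω ↦ translateMeasure α (Z ω.1 : Measure ℝ) +
      translateMeasure β (Z ω.2 : Measure ℝ) := by
    refine Measure.measurable_of_measurable_coe _ fun A hA ↦ ?_
    simp only [Measure.add_apply]
    exact ((Measure.measurable_coe hA).comp ((measurable_translateMeasure_left α).comp
      (hm.comp measurable_fst))).add ((Measure.measurable_coe hA).comp
      ((measurable_translateMeasure_left β).comp (hm.comp measurable_snd)))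
  refine identDistrib_of_lintegral_expNeg hm hm2 fun f hf ↦ ?_
  simp_rw [lintegral_add_measure, lintegral_translateMeasure _ _ hf, expNeg_add]
  have hmt : ∀ t, AEMeasurable (fun ω ↦ expNeg (∫⁻ y, f (y + t) ∂(Z ω : Measure ℝ))) P := fun t ↦
    (measurable_expNeg.comp ((Measure.measurable_lintegral
      (hf.comp (measurable_id.add_const t))).comp hm)).aemeasurable
  have hL : ∀ t, ∫⁻ ω, expNeg (∫⁻ y, f (y + t) ∂(Z ω : Measure ℝ)) ∂P =
      expNeg (clusterExponent D fun y ↦ f (y + t)) := fun t ↦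
    h.lintegral_expNeg (f := fun y ↦ f (y + t)) (by fun_prop)
  rw [lintegral_prod_mul (hmt α) (hmt β), h.lintegral_expNeg hf, hL, hL, ← expNeg_add,
    clusterExponent_add _ hf, clusterExponent_add _ hf, ← add_mul,
    ← ENNReal.ofReal_add (Real.exp_pos _).le (Real.exp_pos _).le, hαβ]
  simp

end Representation

/-! ### Additive functions on the positive half-line -/

lemma Real.eq_of_forall_nat_mul_sub_le {x y C : ℝ} (h : ∀ n : ℕ, |n * x - n * y| ≤ C) : x = y := by
  by_contra hne
  have hpos : 0 < |x - y| := abs_pos.2 (sub_ne_zero.2 hne)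
  obtain ⟨n, hn⟩ := exists_nat_gt (C / |x - y|)
  have := h n
  rw [← mul_sub, abs_mul, Nat.abs_cast] at this
  rw [div_lt_iff₀ hpos] at hn
  linarith

/-- An additive function from `(0, ∞)` to `[0, ∞]` is linear. -/
lemma ENNReal.eq_ofReal_mul_of_additive {F : ℝ → ℝ≥0∞}
    (hF : ∀ a b : ℝ, 0 < a → 0 < b → F (a + b) = F a + F b) {c : ℝ} (hc : 0 < c) :
    F c = ENNReal.ofReal c * F 1 := by
  -- Nonnegativity turns additivity into monotonicity, which replaces any regularity assumption.
  have hmono : ∀ a b : ℝ, 0 < a → a ≤ b → F a ≤ F b := by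
    intro a b ha hab
    rcases hab.eq_or_lt with rfl | hlt
    · exact le_rfl
    · have := hF a (b - a) ha (sub_pos.2 hlt)
      rw [add_sub_cancel] at this
      rw [this]; exact le_self_add
  have hnat : ∀ (n : ℕ) (a : ℝ), 0 < a → F ((n + 1 : ℕ) * a) = (n + 1 : ℕ) * F a := by
    intro n a ha
    induction n with
    | zero => simp
    | succ n ih =>
      have : ((n + 1 + 1 : ℕ) : ℝ) * a = (n + 1 : ℕ) * a + a := by push_cast; ring
      rw [this, hF _ _ (by positivity) ha, ih]
      push_cast; ring
  have hnat' : ∀ (n : ℕ) (a : ℝ), 0 < n → 0 < a → F (n * a) = n * F a := by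
    intro n a hn ha
    obtain ⟨k, rfl⟩ := Nat.exists_eq_succ_of_ne_zero hn.ne'
    exact hnat k a ha
  by_cases h1 : F 1 = ∞
  · have hc0 : ENNReal.ofReal c ≠ 0 := by simpa using hc
    rw [h1, ENNReal.mul_top hc0]
    obtain ⟨n, hn⟩ := exists_nat_gt (1 / c)
    have hn0 : 0 < n := by
      have : (0 : ℝ) < n := lt_trans (by positivity) hn
      exact_mod_cast this
    rw [div_lt_iff₀ hc] at hn
    have := hmono 1 _ one_pos hn.le
    rw [h1, hnat' n c hn0 hc, top_le_iff, ENNReal.mul_eq_top] at this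
    rcases this with h | h
    · exact h.2
    · exact absurd h.1 (ENNReal.natCast_ne_top n)
  · have hfc : F c ≠ ∞ := by
      obtain ⟨n, hn⟩ := exists_nat_gt c
      have hn0 : 0 < n := by exact_mod_cast hc.trans hn
      refine ne_top_of_le_ne_top ?_ (hmono c n hc hn.le)
      have := hnat' n 1 hn0 one_pos
      rw [mul_one] at this
      rw [this]
      exact ENNReal.mul_ne_top (ENNReal.natCast_ne_top n) h1
    -- Squeezing n c between consecutive integers bounds |n F(c) - n c F(1)| by F(1) for all n.
    have key : (F c).toReal = c * (F 1).toReal := by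
      refine Real.eq_of_forall_nat_mul_sub_le (C := (F 1).toReal) fun n ↦ ?_
      rcases Nat.eq_zero_or_pos n with rfl | hn
      · simp
      have hncpos : 0 < n * c := by positivity
      have hup : n * F c ≤ ((⌊n * c⌋₊ + 1 : ℕ) : ℝ≥0∞) * F 1 := by
        rw [← hnat' n c hn hc, ← hnat _ 1 one_pos, mul_one]
        refine hmono _ _ hncpos ?_
        push_cast
        exact (Nat.lt_floor_add_one _).le
      have hlow : (⌊n * c⌋₊ : ℝ≥0∞) * F 1 ≤ n * F c := by
        rcases Nat.eq_zero_or_pos ⌊n * c⌋₊ with h0 | h0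
        · simp [h0]
        · rw [← hnat' n c hn hc, ← hnat' _ 1 h0 one_pos, mul_one]
          exact hmono _ _ (by exact_mod_cast h0) (Nat.floor_le hncpos.le)
      have hup' := ENNReal.toReal_mono (ENNReal.mul_ne_top (ENNReal.natCast_ne_top _) h1) hup
      have hlow' := ENNReal.toReal_mono (ENNReal.mul_ne_top (ENNReal.natCast_ne_top _) hfc) hlow
      simp only [ENNReal.toReal_mul, ENNReal.toReal_natCast] at hup' hlow'
      push_cast at hup'
      have h0 : 0 ≤ (F 1).toReal := ENNReal.toReal_nonneg
      have hfl := Nat.floor_le hncpos.le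
      have hfl' := (Nat.lt_floor_add_one (n * c)).le
      rw [abs_le]
      constructor <;> nlinarith
    rw [← ENNReal.toReal_eq_toReal_iff' hfc (ENNReal.mul_ne_top ENNReal.ofReal_ne_top h1), key,
      ENNReal.toReal_mul, ENNReal.toReal_ofReal hc.le]

/-! ### The Laplace exponent of a superposable process -/

lemma continuous_negLog : Continuous negLog := by
  unfold negLog
  exact EReal.continuous_toENNReal.comp (continuous_neg.comp ENNReal.continuous_log)

lemma negLog_antitone : Antitone negLog := fun p q h ↦ by
  unfold negLog
  exact EReal.toENNReal_le_toENNReal (EReal.neg_le_neg_iff.2 (ENNReal.log_le_log h))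

lemma one_sub_expNeg_le (x : ℝ≥0∞) : 1 - expNeg x ≤ x := by
  rcases eq_or_ne x ∞ with rfl | hx
  · simp
  · rw [← ENNReal.ofReal_toReal hx, expNeg_ofReal ENNReal.toReal_nonneg, ← ENNReal.ofReal_one,
      ← ENNReal.ofReal_sub _ (Real.exp_pos _).le]
    exact ENNReal.ofReal_le_ofReal (by linarith [Real.add_one_le_exp (-x.toReal)])

/-- The Laplace exponent `-log E exp (-∫ f dZ)`. -/
noncomputable def laplaceExponent {Ω : Type*} [MeasurableSpace Ω] (P : Measure Ω)
    (Z : Ω → CountingMeasure) (f : ℝ → ℝ≥0∞) : ℝ≥0∞ :=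
  negLog (∫⁻ ω, expNeg (∫⁻ y, f y ∂(Z ω : Measure ℝ)) ∂P)

lemma laplaceExponent_mono {Ω : Type*} [MeasurableSpace Ω] {P : Measure Ω}
    {Z : Ω → CountingMeasure} {f g : ℝ → ℝ≥0∞} (h : ∀ x, f x ≤ g x) :
    laplaceExponent P Z f ≤ laplaceExponent P Z g :=
  negLog_antitone (lintegral_mono fun _ ↦ expNeg_antitone (lintegral_mono h))

section Exponent

variable {Ω : Type*} [MeasurableSpace Ω] {P : Measure Ω} [IsProbabilityMeasure P]
  {Z : Ω → CountingMeasure}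

lemma expNeg_laplaceExponent (f : ℝ → ℝ≥0∞) : expNeg (laplaceExponent P Z f) =
    ∫⁻ ω, expNeg (∫⁻ y, f y ∂(Z ω : Measure ℝ)) ∂P :=
  expNeg_negLog (lintegral_expNeg_le_one _)

lemma measurable_lintegral_coe (hZ : Measurable Z) {f : ℝ → ℝ≥0∞} (hf : Measurable f) :
    Measurable fun ω ↦ ∫⁻ y, f y ∂(Z ω : Measure ℝ) :=
  (Measure.measurable_lintegral hf).comp (measurable_coe_comp hZ)

lemma measurable_expNeg_lintegral_coe (hZ : Measurable Z) {f : ℝ → ℝ≥0∞} (hf : Measurable f) :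
    Measurable fun ω ↦ expNeg (∫⁻ y, f y ∂(Z ω : Measure ℝ)) :=
  measurable_expNeg.comp (measurable_lintegral_coe hZ hf)

lemma tendsto_laplaceExponent (hZ : Measurable Z) {f : ℕ → ℝ → ℝ≥0∞} {g : ℝ → ℝ≥0∞}
    (hf : ∀ n, Measurable (f n))
    (h : ∀ᵐ ω ∂P, Tendsto (fun n ↦ ∫⁻ y, f n y ∂(Z ω : Measure ℝ)) atTop
      (𝓝 (∫⁻ y, g y ∂(Z ω : Measure ℝ)))) :
    Tendsto (fun n ↦ laplaceExponent P Z (f n)) atTop (𝓝 (laplaceExponent P Z g)) :=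
  (continuous_negLog.tendsto _).comp
    (tendsto_lintegral_expNeg (fun n ↦ measurable_lintegral_coe hZ (hf n)) h)

lemma Superposable.laplaceExponent_eq_add (h : Superposable P Z) (hZ : Measurable Z)
    {f : ℝ → ℝ≥0∞} (hf : Measurable f) {α β : ℝ} (hαβ : Real.exp α + Real.exp β = 1) :
    laplaceExponent P Z f = laplaceExponent P Z (fun y ↦ f (y + α)) +
      laplaceExponent P Z (fun y ↦ f (y + β)) := by
  apply expNeg_strictAnti.injective
  rw [expNeg_add]
  simp_rw [expNeg_laplaceExponent]
  have hid := ((h α β hαβ).comp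
    (measurable_expNeg.comp (Measure.measurable_lintegral hf))).lintegral_eq
  simp only [Function.comp_def] at hid
  rw [hid]
  simp_rw [lintegral_add_measure, lintegral_translateMeasure _ _ hf, expNeg_add]
  have hmt : ∀ t, AEMeasurable (fun ω ↦ expNeg (∫⁻ y, f (y + t) ∂(Z ω : Measure ℝ))) P := fun t ↦
    (measurable_expNeg_lintegral_coe hZ (hf.comp (measurable_id.add_const t))).aemeasurable
  rw [lintegral_prod_mul (hmt α) (hmt β)]

/-- The scaling property of the Laplace exponent of a superposable process. -/
lemma Superposable.laplaceExponent_add (h : Superposable P Z) (hZ : Measurable Z)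
    {f : ℝ → ℝ≥0∞} (hf : Measurable f) (t : ℝ) :
    laplaceExponent P Z (fun y ↦ f (y + t)) =
      ENNReal.ofReal (Real.exp t) * laplaceExponent P Z f := by
  -- Additivity in c comes from superposability applied to f(· + log(a + b)), with α = log(a/(a+b))
  -- and β = log(b/(a+b)).
  have key := ENNReal.eq_ofReal_mul_of_additive
    (F := fun c ↦ laplaceExponent P Z fun y ↦ f (y + Real.log c)) (fun a b ha hb ↦ ?_)
    (Real.exp_pos t)
  · simpa using key
  · have hab : 0 < a + b := add_pos ha hb
    have hsum : Real.exp (Real.log (a / (a + b))) + Real.exp (Real.log (b / (a + b))) = 1 := by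
      rw [Real.exp_log (by positivity), Real.exp_log (by positivity)]
      field_simp
    have := h.laplaceExponent_eq_add hZ (f := fun y ↦ f (y + Real.log (a + b))) (by fun_prop) hsum
    rw [this]
    congr 3
    · ext y
      rw [Real.log_div ha.ne' hab.ne']; ring_nf
    · ext y
      rw [Real.log_div hb.ne' hab.ne']; ring_nf

lemma laplaceExponent_ne_top_of_ae_lt_top (hZ : Measurable Z) {f : ℝ → ℝ≥0∞} (hf : Measurable f)
    (hfin : ∀ᵐ ω ∂P, ∫⁻ y, f y ∂(Z ω : Measure ℝ) < ∞) : laplaceExponent P Z f ≠ ∞ := by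
  intro htop
  have h0 := expNeg_laplaceExponent (P := P) (Z := Z) f
  rw [htop, expNeg_top, eq_comm, lintegral_eq_zero_iff
    (measurable_expNeg_lintegral_coe hZ hf)] at h0
  obtain ⟨ω, hω, hω'⟩ := (h0.and hfin).exists
  exact hω'.ne (expNeg_eq_zero.1 hω)

/-- If `Z A` is almost surely finite, then `Z A = 0` with positive probability. -/
lemma Superposable.laplaceExponent_top_indicator_ne_top (h : Superposable P Z) (hZ : Measurable Z)
    {A : Set ℝ} (hA : MeasurableSet A) (hfin : ∀ᵐ ω ∂P, (Z ω : Measure ℝ) A < ∞) :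
    laplaceExponent P Z (A.indicator fun _ ↦ ∞) ≠ ∞ := by
  intro htop
  have hm1 : Measurable (A.indicator fun _ ↦ (1 : ℝ≥0∞)) := measurable_const.indicator hA
  have hmt : Measurable (A.indicator fun _ ↦ (∞ : ℝ≥0∞)) := measurable_const.indicator hA
  have hfin1 : laplaceExponent P Z (A.indicator fun _ ↦ 1) ≠ ∞ := by
    refine laplaceExponent_ne_top_of_ae_lt_top hZ hm1 ?_
    filter_upwards [hfin] with ω hω
    rwa [lintegral_indicator_const hA, one_mul]
  -- If the exponent of ∞·1_A were ∞, scaling would give Z(A - t) ≥ 1 a.s. for every t, so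
  -- L(1_{A-t}) ≥ 1. But L(1_{A-t}) = e^t L(1_A) tends to 0 as t → -∞.
  have hge : ∀ t : ℝ, 1 ≤ ENNReal.ofReal (Real.exp t) *
      laplaceExponent P Z (A.indicator fun _ ↦ 1) := by
    intro t
    have hAt : MeasurableSet {y : ℝ | y + t ∈ A} := (measurable_id.add_const t) hA
    have hind : ∀ c : ℝ≥0∞, (fun y ↦ A.indicator (fun _ ↦ c) (y + t)) =
        {y : ℝ | y + t ∈ A}.indicator fun _ ↦ c := by
      intro c; ext y; simp [indicator]
    have htop' := h.laplaceExponent_add hZ hmt t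
    rw [htop, ENNReal.mul_top (by simpa using Real.exp_pos t), hind] at htop'
    have h0 := expNeg_laplaceExponent (P := P) (Z := Z) ({y : ℝ | y + t ∈ A}.indicator fun _ ↦ ∞)
    rw [htop', expNeg_top, eq_comm, lintegral_eq_zero_iff
      (measurable_expNeg_lintegral_coe hZ (measurable_const.indicator hAt))] at h0
    rw [← h.laplaceExponent_add hZ hm1 t, hind]
    refine (negLog_expNeg 1).ge.trans (negLog_antitone ?_)
    calc _ ≤ ∫⁻ _, expNeg 1 ∂P := by
          refine lintegral_mono_ae ?_
          filter_upwards [h0] with ω hω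
          rw [Pi.zero_apply, expNeg_eq_zero, lintegral_indicator_const hAt] at hω
          refine expNeg_antitone ?_
          rw [lintegral_indicator_const hAt, one_mul]
          by_contra hlt
          rw [(Z ω).2.measure_eq_zero_of_lt_one hAt (not_le.1 hlt)] at hω
          simp at hω
      _ = expNeg 1 := by simp
  have hlim : Tendsto (fun n : ℕ ↦ ENNReal.ofReal (Real.exp (-(n : ℝ))) *
      laplaceExponent P Z (A.indicator fun _ ↦ 1)) atTop (𝓝 0) := by
    have h1 : Tendsto (fun n : ℕ ↦ ENNReal.ofReal (Real.exp (-(n : ℝ)))) atTop (𝓝 0) := by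
      rw [← ENNReal.ofReal_zero]
      exact ENNReal.tendsto_ofReal (Real.tendsto_exp_neg_atTop_nhds_zero.comp
        tendsto_natCast_atTop_atTop)
    simpa using ENNReal.Tendsto.mul_const h1 (Or.inr hfin1)
  have := ge_of_tendsto' hlim fun n : ℕ ↦ hge (-(n : ℝ))
  simp at this

/-- A superposable process has finitely many atoms in every half-line `(x, ∞)`. -/
lemma Superposable.ae_Ioi_lt_top (h : Superposable P Z) (hZ : Measurable Z) :
    ∀ᵐ ω ∂P, ∀ x : ℝ, (Z ω : Measure ℝ) (Ioi x) < ∞ := by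
  set κ := laplaceExponent P Z ((Ioc (0 : ℝ) 1).indicator fun _ ↦ ∞) with hκ
  have hκt : κ ≠ ∞ := h.laplaceExponent_top_indicator_ne_top hZ measurableSet_Ioc
    (ae_of_all _ fun ω ↦ (Z ω).2.lt_top (Metric.isBounded_Ioc _ _))
  -- The probability is 1 - exp(-e^{-n} κ) by scaling. The bounds are summable, so by Borel–Cantelli
  -- only finitely many of these intervals are charged.
  have hP : ∀ n : ℕ, P {ω | (Z ω : Measure ℝ) (Ioc (n : ℝ) (n + 1)) ≠ 0} ≤
      ENNReal.ofReal (Real.exp (-(n : ℝ))) * κ := by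
    intro n
    have hind : (fun y ↦ (Ioc (0 : ℝ) 1).indicator (fun _ ↦ (∞ : ℝ≥0∞)) (y + -(n : ℝ))) =
        (Ioc (n : ℝ) (n + 1)).indicator fun _ ↦ ∞ := by
      ext y
      simp only [indicator, mem_Ioc]
      congr 1
      refine propext ⟨fun hy ↦ ⟨by linarith [hy.1], by linarith [hy.2]⟩,
        fun hy ↦ ⟨by linarith [hy.1], by linarith [hy.2]⟩⟩
    rw [hκ, ← h.laplaceExponent_add hZ (measurable_const.indicator measurableSet_Ioc), hind]
    refine le_trans ?_ (one_sub_expNeg_le _)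
    rw [expNeg_laplaceExponent]
    have hms : MeasurableSet {ω | (Z ω : Measure ℝ) (Ioc (n : ℝ) (n + 1)) = 0} :=
      (CountingMeasure.measurable_apply measurableSet_Ioc).comp hZ (measurableSet_singleton 0)
    have heq : ∫⁻ ω, expNeg (∫⁻ y, (Ioc (n : ℝ) (n + 1)).indicator (fun _ ↦ ∞) y
        ∂(Z ω : Measure ℝ)) ∂P = P {ω | (Z ω : Measure ℝ) (Ioc (n : ℝ) (n + 1)) = 0} := by
      rw [← lintegral_indicator_one hms]
      refine lintegral_congr fun ω ↦ ?_
      rw [lintegral_indicator_const measurableSet_Ioc]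
      by_cases h0 : (Z ω : Measure ℝ) (Ioc (n : ℝ) (n + 1)) = 0
      · simp [h0]
      · simp [h0, ENNReal.top_mul]
    rw [heq, ← prob_compl_eq_one_sub hms]
    rfl
  have hsum : ∑' n : ℕ, P {ω | (Z ω : Measure ℝ) (Ioc (n : ℝ) (n + 1)) ≠ 0} ≠ ∞ := by
    refine ne_top_of_le_ne_top ?_ (ENNReal.tsum_le_tsum hP)
    rw [ENNReal.tsum_mul_right]
    refine ENNReal.mul_ne_top ?_ hκt
    have hs : Summable fun n : ℕ ↦ Real.exp (-(n : ℝ)) := by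
      simpa using Real.summable_exp_neg_nat
    rw [← ENNReal.ofReal_tsum_of_nonneg (fun n ↦ (Real.exp_pos _).le) hs]
    exact ENNReal.ofReal_ne_top
  filter_upwards [ae_eventually_notMem hsum] with ω hω x
  obtain ⟨N, hN⟩ := eventually_atTop.1 hω
  have h0 : (Z ω : Measure ℝ) (Ioi (N : ℝ)) = 0 := by
    refine measure_mono_null (t := ⋃ n : ℕ, Ioc ((N + n : ℕ) : ℝ) ((N + n : ℕ) + 1)) ?_
      (measure_iUnion_null fun n ↦ by simpa using hN (N + n) (by omega))
    intro y hy
    have hNy : (N : ℝ) < y := hy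
    have hpos : 0 < y := lt_of_le_of_lt (Nat.cast_nonneg N) hNy
    have hc1 : N < ⌈y⌉₊ := Nat.lt_ceil.2 hNy
    refine mem_iUnion.2 ⟨⌈y⌉₊ - 1 - N, ?_⟩
    have he : N + (⌈y⌉₊ - 1 - N) = ⌈y⌉₊ - 1 := by omega
    have hcast : ((⌈y⌉₊ - 1 : ℕ) : ℝ) + 1 = ⌈y⌉₊ := by
      rw [Nat.cast_sub (by omega)]; simp
    rw [he]
    refine ⟨?_, by rw [hcast]; exact Nat.le_ceil y⟩
    have := Nat.ceil_lt_add_one hpos.le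
    linarith
  refine (measure_mono (t := Ioc x N ∪ Ioi (N : ℝ)) fun y hy ↦ ?_).trans_lt
    ((measure_union_le _ _).trans_lt ?_)
  · rcases le_or_gt y N with hyN | hyN
    · exact Or.inl ⟨hy, hyN⟩
    · exact Or.inr hyN
  · rw [h0, add_zero]
    exact (Z ω).2.lt_top (Metric.isBounded_Ioc _ _)

/-! ### The law of the rightmost atom of a superposable process -/

/-- Half-line indicators with infinite weight. -/
noncomputable def topIoi (x : ℝ) : ℝ → ℝ≥0∞ := (Ioi x).indicator fun _ ↦ ∞

lemma measurable_topIoi (x : ℝ) : Measurable (topIoi x) := measurable_const.indicator measurableSet_Ioi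

lemma topIoi_add (x t : ℝ) : (fun y ↦ topIoi x (y + t)) = topIoi (x - t) := by
  ext y
  simp [topIoi, indicator, sub_lt_iff_lt_add]

lemma lintegral_topIoi (μ : Measure ℝ) (x : ℝ) : ∫⁻ y, topIoi x y ∂μ = ∞ * μ (Ioi x) :=
  lintegral_indicator_const measurableSet_Ioi _

lemma Superposable.laplaceExponent_topIoi_ne_top (h : Superposable P Z) (hZ : Measurable Z)
    (x : ℝ) : laplaceExponent P Z (topIoi x) ≠ ∞ :=
  h.laplaceExponent_top_indicator_ne_top hZ measurableSet_Ioi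
    ((h.ae_Ioi_lt_top hZ).mono fun _ hω ↦ hω x)

/-- In probabilistic terms, P(Z(x, ∞) = 0) = exp(-C e^{-x}): the rightmost atom follows a Gumbel
law. -/
lemma Superposable.laplaceExponent_topIoi (h : Superposable P Z) (hZ : Measurable Z) (x : ℝ) :
    laplaceExponent P Z (topIoi x) = ENNReal.ofReal (Real.exp (-x)) *
      laplaceExponent P Z (topIoi 0) := by
  rw [← h.laplaceExponent_add hZ (measurable_topIoi 0), topIoi_add]
  simp

/-- If the constant vanished, scaling would make every half-line (x, ∞) a.s. empty, and Z would be
a.s. zero. -/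
lemma Superposable.laplaceExponent_topIoi_zero_ne_zero (h : Superposable P Z) (hZ : Measurable Z)
    (h0 : 0 < P {ω | (Z ω : Measure ℝ) ≠ 0}) : laplaceExponent P Z (topIoi 0) ≠ 0 := by
  intro hc
  have hx : ∀ x : ℝ, ∀ᵐ ω ∂P, (Z ω : Measure ℝ) (Ioi x) = 0 := by
    intro x
    have hL := expNeg_laplaceExponent (P := P) (Z := Z) (topIoi x)
    rw [h.laplaceExponent_topIoi hZ, hc, mul_zero, expNeg_zero] at hL
    have hm : Measurable fun ω ↦ expNeg (∫⁻ y, topIoi x y ∂(Z ω : Measure ℝ)) :=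
      measurable_expNeg.comp (measurable_lintegral_coe hZ (measurable_topIoi x))
    have hsub : ∫⁻ ω, (1 - expNeg (∫⁻ y, topIoi x y ∂(Z ω : Measure ℝ))) ∂P = 0 := by
      rw [lintegral_sub hm (by rw [← hL]; simp) (ae_of_all _ fun _ ↦ expNeg_le_one _), ← hL]
      simp
    rw [lintegral_eq_zero_iff (by exact measurable_const.sub hm)] at hsub
    filter_upwards [hsub] with ω hω
    by_contra hne
    rw [Pi.zero_apply, lintegral_topIoi, ENNReal.top_mul hne] at hω
    simp at hω
  have hall : ∀ᵐ ω ∂P, (Z ω : Measure ℝ) = 0 := by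
    filter_upwards [ae_all_iff.2 fun n : ℕ ↦ hx (-(n : ℝ))] with ω hω
    rw [← Measure.measure_univ_eq_zero]
    have : (univ : Set ℝ) = ⋃ n : ℕ, Ioi (-(n : ℝ)) := by
      refine (eq_univ_of_forall fun y ↦ mem_iUnion.2 ?_).symm
      obtain ⟨n, hn⟩ := exists_nat_gt (-y)
      exact ⟨n, by simp only [mem_Ioi]; linarith⟩
    rw [this]
    exact measure_iUnion_null hω
  exact h0.ne' hall

end Exponent

/-! ### A compactness argument for families of tail counts -/

instance : BorelSpace ℕ∞ := by
  refine ⟨le_antisymm (fun s _ ↦ ?_) le_top⟩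
  have hx : ∀ x : ℕ∞, MeasurableSet[borel ℕ∞] {x} := fun x ↦
    (MeasurableSpace.measurableSet_generateFrom (isClosed_singleton (x := x)).isOpen_compl).of_compl
  rw [← biUnion_of_singleton s]
  exact @MeasurableSet.biUnion _ _ (borel ℕ∞) _ _ (to_countable s) fun x _ ↦ hx x

/-- For c = ∞ this fails at 0 on [0, ∞]. On ℕ∞ the finite points are isolated and only ⊤ has to be
checked, which is why limits are taken for counts in ℕ∞. -/
lemma continuous_expNeg_mul_enat (c : ℝ≥0∞) : Continuous fun n : ℕ∞ ↦ expNeg (c * n) := by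
  refine continuous_expNeg.comp (continuous_iff_continuousAt.2 fun n ↦ ?_)
  by_cases hn : n = ⊤
  · subst hn
    exact (ENNReal.continuousAt_const_mul (a := c) (b := ((⊤ : ℕ∞) : ℝ≥0∞)) (Or.inr (by simp))).comp
      (f := fun n : ℕ∞ ↦ (n : ℝ≥0∞)) ENat.continuous_toENNReal.continuousAt
  · rw [ContinuousAt, ENat.nhds_eq_pure hn]
    exact tendsto_pure_nhds _ _

lemma continuous_expNeg_sum_enat (s : Finset ℚ) (c : ℚ → ℝ≥0∞) :
    Continuous fun N : ℚ → ℕ∞ ↦ expNeg (∑ q ∈ s, c q * N q) := by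
  -- Multiplication is not jointly continuous on [0, ∞], so the product is formed in `ℝ≥0`.
  have : (fun N : ℚ → ℕ∞ ↦ (expNeg (∑ q ∈ s, c q * N q)).toNNReal) =
      fun N ↦ ∏ q ∈ s, (expNeg (c q * N q)).toNNReal := by
    ext N
    rw [expNeg_sum, ENNReal.toNNReal_prod]
  have h2 : Continuous fun N : ℚ → ℕ∞ ↦ (expNeg (∑ q ∈ s, c q * N q)).toNNReal := by
    rw [this]
    refine continuous_finsetProd _ fun q _ ↦ ?_
    refine continuous_iff_continuousAt.2 fun N ↦ ?_
    exact (ENNReal.tendsto_toNNReal (expNeg_ne_top _)).comp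
      ((continuous_expNeg_mul_enat (c q)).comp (continuous_apply q)).continuousAt
  have h3 := ENNReal.continuous_coe.comp h2
  refine h3.congr fun N ↦ ?_
  exact ENNReal.coe_toNNReal (expNeg_ne_top _)

/-- Laws of families of counts with converging Laplace transforms have a limit law. -/
lemma exists_limit_of_tendsto_lintegral_expNeg (ρ : ℕ → ProbabilityMeasure (ℚ → ℕ∞))
    {ψ : Finset ℚ → (ℚ → ℝ≥0∞) → ℝ≥0∞}
    (h : ∀ s c, Tendsto (fun n ↦ ∫⁻ N, expNeg (∑ q ∈ s, c q * N q) ∂(ρ n : Measure (ℚ → ℕ∞))) atTop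
      (𝓝 (ψ s c))) (hanti : ∀ n, ∀ᵐ N ∂(ρ n : Measure (ℚ → ℕ∞)), Antitone N) :
    ∃ R : ProbabilityMeasure (ℚ → ℕ∞), (∀ᵐ N ∂(R : Measure (ℚ → ℕ∞)), Antitone N) ∧
      ∀ s c, ∫⁻ N, expNeg (∑ q ∈ s, c q * N q) ∂(R : Measure (ℚ → ℕ∞)) = ψ s c := by
  -- Probability measures on the compact space (ℕ∞)^ℚ form a compact space, so an ultrafilter limit
  -- exists; no subsequence is needed since the Laplace transforms already converge.
  let U : Ultrafilter (ProbabilityMeasure (ℚ → ℕ∞)) := (hyperfilter ℕ).map ρ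
  have hU : Tendsto ρ (hyperfilter ℕ) (𝓝 U.lim) := U.le_nhds_lim
  have hle : (hyperfilter ℕ : Filter ℕ) ≤ atTop := by
    rw [← Nat.cofinite_eq_atTop]; exact hyperfilter_le_cofinite
  refine ⟨U.lim, ?_, fun s c ↦ ?_⟩
  -- Monotonicity is a closed condition, so by the portmanteau theorem it survives weak limits.
  · have hcl : IsClosed {N : ℚ → ℕ∞ | Antitone N} := by
      have : {N : ℚ → ℕ∞ | Antitone N} = ⋂ (p : ℚ) (q : ℚ) (_ : p ≤ q), {N | N q ≤ N p} := by
        ext N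
        simp only [mem_ofPred_eq, mem_iInter]
        exact ⟨fun hN p q hpq ↦ hN hpq, fun hN p q hpq ↦ hN p q hpq⟩
      rw [this]
      exact isClosed_iInter fun p ↦ isClosed_iInter fun q ↦ isClosed_iInter fun _ ↦
        isClosed_le (continuous_apply q) (continuous_apply p)
    have hlim := ProbabilityMeasure.limsup_measure_closed_le_of_tendsto hU hcl
    have h1 : ∀ n, (ρ n : Measure (ℚ → ℕ∞)) {N : ℚ → ℕ∞ | Antitone N} = 1 := fun n ↦
      (prob_compl_eq_zero_iff hcl.measurableSet).1 (hanti n)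
    simp only [h1, limsup_const] at hlim
    exact (prob_compl_eq_zero_iff hcl.measurableSet).2 (le_antisymm prob_le_one hlim)
  · let g : (ℚ → ℕ∞) →ᵇ ℝ≥0 := BoundedContinuousFunction.mkOfCompact
      ⟨fun N ↦ (expNeg (∑ q ∈ s, c q * N q)).toNNReal, continuous_iff_continuousAt.2 fun N ↦
        (ENNReal.tendsto_toNNReal (expNeg_ne_top _)).comp
          (continuous_expNeg_sum_enat s c).continuousAt⟩
    have hg : ∀ N, ((g N : ℝ≥0) : ℝ≥0∞) = expNeg (∑ q ∈ s, c q * N q) := fun N ↦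
      ENNReal.coe_toNNReal (expNeg_ne_top _)
    have := ProbabilityMeasure.tendsto_iff_forall_lintegral_tendsto.1 hU g
    simp only [hg] at this
    exact tendsto_nhds_unique this ((h s c).mono_left hle)

/-! ### Counting measures with prescribed tail counts -/

/-- The families of tail counts of counting measures on `ℝ` which are bounded to the right. -/
def tailCounts : Set (ℚ → ℕ∞) :=
  {N | Antitone N ∧ (∀ q, N q ≠ ⊤) ∧ (∀ q, ∃ k : ℕ, N (q + 1 / (k + 1)) = N q) ∧ ∃ k : ℕ, N k = 0}

lemma measurableSet_tailCounts : MeasurableSet tailCounts := by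
  have h1 : {N : ℚ → ℕ∞ | Antitone N} = ⋂ (p : ℚ) (q : ℚ) (_ : p ≤ q), {N | N q ≤ N p} := by
    ext N
    simp only [mem_ofPred_eq, mem_iInter]
    exact ⟨fun hN p q hpq ↦ hN hpq, fun hN p q hpq ↦ hN p q hpq⟩
  have h2 : tailCounts = {N : ℚ → ℕ∞ | Antitone N} ∩ ((⋂ q, {N | N q ≠ ⊤}) ∩
      ((⋂ q : ℚ, ⋃ k : ℕ, {N | N (q + 1 / (k + 1)) = N q}) ∩ ⋃ k : ℕ, {N | N k = 0})) := by
    ext N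
    simp [tailCounts]
  rw [h2, h1]
  refine MeasurableSet.inter (MeasurableSet.iInter fun p ↦ MeasurableSet.iInter fun q ↦
    MeasurableSet.iInter fun _ ↦ measurableSet_le (measurable_pi_apply q) (measurable_pi_apply p))
    (MeasurableSet.inter (MeasurableSet.iInter fun q ↦ ?_) (MeasurableSet.inter
      (MeasurableSet.iInter fun q ↦ MeasurableSet.iUnion fun k ↦
        measurableSet_eq_fun (measurable_pi_apply _) (measurable_pi_apply _))
      (MeasurableSet.iUnion fun k ↦ measurable_pi_apply (k : ℚ) (measurableSet_singleton 0))))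
  exact (measurable_pi_apply q (measurableSet_singleton ⊤)).compl

/-- The position of the `i`-th point from the right (`⊥` if there is no such point). -/
noncomputable def rankedPoint (i : ℕ) (N : ℚ → ℕ∞) : EReal :=
  ⨆ q : ℚ, if (i : ℕ∞) < N q then ((q : ℝ) : EReal) else ⊥

lemma measurable_rankedPoint (i : ℕ) : Measurable (rankedPoint i) :=
  Measurable.iSup fun q ↦ Measurable.ite
    (measurableSet_lt measurable_const (measurable_pi_apply q)) measurable_const measurable_const

/-- The third clause of `tailCounts` is right-continuity of integer-valued tails: if i < N q, then i
< N p for some rational p > q, and the inequality with the supremum is strict. -/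
lemma lt_rankedPoint_iff {N : ℚ → ℕ∞} (hN : N ∈ tailCounts) (i : ℕ) (q : ℚ) :
    ((q : ℝ) : EReal) < rankedPoint i N ↔ (i : ℕ∞) < N q := by
  rw [rankedPoint, lt_iSup_iff]
  constructor
  · rintro ⟨p, hp⟩
    split_ifs at hp with h
    · have : q < p := by exact_mod_cast hp
      exact h.trans_le (hN.1 this.le)
    · simp at hp
  · intro h
    obtain ⟨k, hk⟩ := hN.2.2.1 q
    refine ⟨q + 1 / (k + 1), ?_⟩
    rw [if_pos (by rwa [hk])]
    have : q < q + 1 / (k + 1) := by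
      have : (0 : ℚ) < 1 / (k + 1) := by positivity
      linarith
    exact_mod_cast this

lemma rankedPoint_ne_top {N : ℚ → ℕ∞} (hN : N ∈ tailCounts) (i : ℕ) : rankedPoint i N ≠ ⊤ := by
  intro h
  obtain ⟨k, hk⟩ := hN.2.2.2
  have := (lt_rankedPoint_iff hN i k).1 (by rw [h]; exact EReal.coe_lt_top _)
  rw [hk] at this
  simp at this

open Classical in
/-- The measure with the given tail counts (zero if there is none). -/
noncomputable def ofTailCounts (N : ℚ → ℕ∞) : Measure ℝ :=
  if N ∈ tailCounts then
    Measure.sum fun i ↦ if rankedPoint i N = ⊥ then 0 else Measure.dirac (rankedPoint i N).toReal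
  else 0

lemma measurable_ofTailCounts : Measurable ofTailCounts := by
  refine Measurable.ite measurableSet_tailCounts ?_ measurable_const
  refine Measure.measurable_of_measurable_coe _ fun A hA ↦ ?_
  simp_rw [Measure.sum_apply _ hA]
  refine Measurable.tsum fun i ↦ (Measure.measurable_coe hA).comp (Measurable.ite
    (measurable_rankedPoint i (measurableSet_singleton ⊥)) measurable_const
    (Measure.measurable_dirac.comp (measurable_ereal_toReal.comp (measurable_rankedPoint i))))

lemma tsum_natCast_lt (n : ℕ∞) : ∑' i : ℕ, (if (i : ℕ∞) < n then (1 : ℝ≥0∞) else 0) = n := by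
  induction n using ENat.recTopCoe with
  | top => simp
  | coe n =>
    rw [tsum_eq_sum (s := Finset.range n) fun i hi ↦ by
      rw [if_neg]; simpa using hi]
    rw [Finset.sum_congr rfl (g := fun _ ↦ 1) fun i hi ↦ by
      rw [if_pos]; simpa using hi]
    simp

open Classical in
lemma rankedPoint_dirac_apply {N : ℚ → ℕ∞} (hN : N ∈ tailCounts) (i : ℕ) {A : Set ℝ}
    (hA : MeasurableSet A) :
    (if rankedPoint i N = ⊥ then 0 else Measure.dirac (rankedPoint i N).toReal : Measure ℝ) A =
      if ∃ y ∈ A, rankedPoint i N = (y : EReal) then 1 else 0 := by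
  split_ifs with h1 h2 h2
  · obtain ⟨y, -, hy⟩ := h2
    rw [h1] at hy
    exact absurd hy.symm (EReal.coe_ne_bot y)
  · simp
  · obtain ⟨y, hyA, hy⟩ := h2
    rw [hy, EReal.toReal_coe, Measure.dirac_apply' _ hA, indicator_of_mem hyA, Pi.one_apply]
  · rw [Measure.dirac_apply' _ hA, indicator_of_notMem]
    exact fun hmem ↦ h2 ⟨_, hmem, (EReal.coe_toReal (rankedPoint_ne_top hN i) h1).symm⟩

/-- The i-th ranked point lies in (q, ∞) exactly when i < N q, and there are N q such indices. -/
lemma ofTailCounts_Ioi {N : ℚ → ℕ∞} (hN : N ∈ tailCounts) (q : ℚ) :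
    ofTailCounts N (Ioi (q : ℝ)) = N q := by
  classical
  rw [ofTailCounts, if_pos hN, Measure.sum_apply _ measurableSet_Ioi, ← tsum_natCast_lt (N q)]
  refine tsum_congr fun i ↦ ?_
  have := rankedPoint_dirac_apply hN i (measurableSet_Ioi (a := (q : ℝ)))
  rw [this]
  refine if_congr ?_ rfl rfl
  rw [← lt_rankedPoint_iff hN]
  constructor
  · rintro ⟨y, hy, he⟩
    rw [he]; exact_mod_cast hy
  · intro h
    have hb : rankedPoint i N ≠ ⊥ := (bot_le.trans_lt h).ne'
    refine ⟨(rankedPoint i N).toReal, ?_, (EReal.coe_toReal (rankedPoint_ne_top hN i) hb).symm⟩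
    rw [← EReal.coe_toReal (rankedPoint_ne_top hN i) hb] at h
    exact_mod_cast h

lemma isCountingMeasure_ofTailCounts (N : ℚ → ℕ∞) : IsCountingMeasure (ofTailCounts N) := by
  classical
  by_cases hN : N ∈ tailCounts
  · intro A hA hb
    obtain ⟨r, hr⟩ := hb.subset_closedBall 0
    obtain ⟨q, hq⟩ := exists_rat_lt (-r)
    have hAq : A ⊆ Ioi (q : ℝ) := fun y hy ↦ by
      have := hr hy
      rw [Metric.mem_closedBall, Real.dist_eq, sub_zero, abs_le] at this
      exact hq.trans_le this.1
    have hfin : ofTailCounts N A ≠ ∞ := by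
      refine ne_top_of_le_ne_top ?_ (measure_mono hAq)
      rw [ofTailCounts_Ioi hN]
      simpa using hN.2.1 q
    rw [ofTailCounts, if_pos hN, Measure.sum_apply _ hA] at hfin ⊢
    simp_rw [rankedPoint_dirac_apply hN _ hA] at hfin ⊢
    have hset : {i | (if ∃ y ∈ A, rankedPoint i N = (y : EReal) then (1 : ℝ≥0∞) else 0) ≠ 0}.Finite :=
      by
        have h := ENNReal.finite_const_le_of_tsum_ne_top hfin one_ne_zero
        refine h.subset fun i hi ↦ ?_
        simp only [mem_ofPred_eq] at hi ⊢
        split_ifs at hi ⊢ with hy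
        · exact le_rfl
        · exact absurd rfl hi
    rw [tsum_eq_sum (s := hset.toFinset) fun i hi ↦ by simpa using hi]
    refine ⟨∑ i ∈ hset.toFinset, if ∃ y ∈ A, rankedPoint i N = (y : EReal) then 1 else 0, ?_⟩
    push_cast
    rfl
  · rw [ofTailCounts, if_neg hN]
    exact isCountingMeasure_zero

/-! ### The law of a cluster reaching the positive half-line -/

lemma IsRatStep.measurable {f : ℝ → ℝ≥0∞} (hf : IsRatStep f) : Measurable f := by
  obtain ⟨s, c, rfl⟩ := hf
  exact Finset.measurable_sum _ fun q _ ↦ measurable_const.indicator measurableSet_Ioi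

lemma IsRatStep.exists_le_topIoi {f : ℝ → ℝ≥0∞} (hf : IsRatStep f) :
    ∃ k : ℕ, ∀ x, f x ≤ topIoi (-(k : ℝ)) x := by
  obtain ⟨s, c, rfl⟩ := hf
  obtain ⟨b, hb⟩ := s.bddBelow
  obtain ⟨k, hk⟩ := exists_nat_gt (-b)
  refine ⟨k, fun x ↦ ?_⟩
  by_cases hx : x ∈ Ioi (-(k : ℝ))
  · simp [topIoi, indicator_of_mem hx]
  · rw [topIoi, indicator_of_notMem hx]
    refine (Finset.sum_eq_zero fun q hq ↦ indicator_of_notMem (fun hxq ↦ hx ?_) _).le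
    have h1 : -(k : ℝ) < b := by
      have : -(k : ℚ) < b := by linarith
      exact_mod_cast this
    have h2 : (b : ℝ) ≤ q := by exact_mod_cast hb hq
    exact h1.trans_le (h2.trans (le_of_lt hxq))

lemma isRatStep_indicator (q : ℚ) (c : ℝ≥0∞) : IsRatStep ((Ioi (q : ℝ)).indicator fun _ ↦ c) :=
  ⟨{q}, fun _ ↦ c, by ext; simp⟩

lemma isRatStep_topIoi (q : ℚ) : IsRatStep (topIoi q) := isRatStep_indicator q ∞

lemma IsRatStep.add {f g : ℝ → ℝ≥0∞} (hf : IsRatStep f) (hg : IsRatStep g) :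
    IsRatStep fun x ↦ f x + g x := by
  classical
  obtain ⟨s, c, rfl⟩ := hf
  obtain ⟨t, d, rfl⟩ := hg
  refine ⟨s ∪ t, fun q ↦ (if q ∈ s then c q else 0) + (if q ∈ t then d q else 0), ?_⟩
  ext x
  have h1 : ∀ (u : Finset ℚ) (e : ℚ → ℝ≥0∞), u ⊆ s ∪ t →
      ∑ q ∈ u, (Ioi (q : ℝ)).indicator (fun _ ↦ e q) x =
        ∑ q ∈ s ∪ t, (Ioi (q : ℝ)).indicator (fun _ ↦ if q ∈ u then e q else 0) x := by
    intro u e hu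
    rw [← Finset.sum_subset hu]
    · exact Finset.sum_congr rfl fun q hq ↦ by simp [hq]
    · intro q _ hq
      simp [hq]
  beta_reduce
  rw [h1 s c Finset.subset_union_left, h1 t d Finset.subset_union_right, ← Finset.sum_add_distrib]
  refine Finset.sum_congr rfl fun q _ ↦ ?_
  by_cases hx : x ∈ Ioi (q : ℝ) <;> simp [indicator, hx]

lemma IsRatStep.comp_add {f : ℝ → ℝ≥0∞} (hf : IsRatStep f) (r : ℚ) :
    IsRatStep fun x ↦ f (x + r) := by
  classical
  obtain ⟨s, c, rfl⟩ := hf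
  refine ⟨s.map (Equiv.subRight r).toEmbedding, fun q ↦ c (q + r), ?_⟩
  ext x
  rw [Finset.sum_map]
  refine Finset.sum_congr rfl fun q _ ↦ ?_
  simp [indicator, sub_lt_iff_lt_add]

/-- Since e^{-∞} = 0 and ∞ · 0 = 0, adding ∞·W to the exponent keeps only {W = 0}. Restriction to {W
≠ 0} is thus a difference of two Laplace transforms. -/
lemma lintegral_expNeg_restrict {Ω : Type*} [MeasurableSpace Ω] {P : Measure Ω} [IsFiniteMeasure P]
    {Y W : Ω → ℝ≥0∞} (hW : Measurable W) :
    ∫⁻ ω in {ω | W ω ≠ 0}, expNeg (Y ω) ∂P =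
      ∫⁻ ω, expNeg (Y ω) ∂P - ∫⁻ ω, expNeg (Y ω + ∞ * W ω) ∂P := by
  have hms : MeasurableSet {ω | W ω ≠ 0} := (hW (measurableSet_singleton 0)).compl
  have h2 : ∫⁻ ω, expNeg (Y ω + ∞ * W ω) ∂P = ∫⁻ ω in {ω | W ω ≠ 0}ᶜ, expNeg (Y ω) ∂P := by
    rw [← lintegral_indicator hms.compl]
    refine lintegral_congr fun ω ↦ ?_
    by_cases h : W ω = 0
    · rw [indicator_of_mem (by simpa using h), h]; simp
    · rw [indicator_of_notMem (by simpa using h), ENNReal.top_mul h]; simp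
  have h3 : ∫⁻ ω in {ω | W ω ≠ 0}ᶜ, expNeg (Y ω) ∂P ≠ ∞ := by
    refine ne_top_of_le_ne_top (measure_ne_top P {ω | W ω ≠ 0}ᶜ) ?_
    calc _ ≤ ∫⁻ _ in {ω | W ω ≠ 0}ᶜ, 1 ∂P := lintegral_mono fun ω ↦ expNeg_le_one _
      _ = _ := by simp
  rw [h2]
  exact ENNReal.eq_sub_of_add_eq h3 (lintegral_add_compl (fun ω ↦ expNeg (Y ω)) hms)

/-- With ε = e^{-n}, the derivative of e^{-εu} at ε = 0 shows that the numerator is of order ε (B -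
A) and the denominator of order ε C. -/
lemma tendsto_expNeg_sub_div {A B C : ℝ≥0∞} (hAB : A ≤ B) (hB : B ≠ ∞) (hC : C ≠ ∞) (hC0 : C ≠ 0) :
    Tendsto (fun n : ℕ ↦ (1 - expNeg (ENNReal.ofReal (Real.exp (-(n : ℝ))) * C))⁻¹ *
      (expNeg (ENNReal.ofReal (Real.exp (-(n : ℝ))) * A) -
        expNeg (ENNReal.ofReal (Real.exp (-(n : ℝ))) * B))) atTop (𝓝 ((B - A) / C)) := by
  have hA : A ≠ ∞ := ne_top_of_le_ne_top hB hAB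
  obtain ⟨a, ha, rfl⟩ : ∃ a : ℝ, 0 ≤ a ∧ A = ENNReal.ofReal a :=
    ⟨A.toReal, ENNReal.toReal_nonneg, (ENNReal.ofReal_toReal hA).symm⟩
  obtain ⟨b, hb, rfl⟩ : ∃ b : ℝ, 0 ≤ b ∧ B = ENNReal.ofReal b :=
    ⟨B.toReal, ENNReal.toReal_nonneg, (ENNReal.ofReal_toReal hB).symm⟩
  obtain ⟨c, hc, rfl⟩ : ∃ c : ℝ, 0 < c ∧ C = ENNReal.ofReal c :=
    ⟨C.toReal, ENNReal.toReal_pos hC0 hC, (ENNReal.ofReal_toReal hC).symm⟩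
  have hε : Tendsto (fun n : ℕ ↦ Real.exp (-(n : ℝ))) atTop (𝓝[≠] 0) := by
    refine tendsto_nhdsWithin_iff.2 ⟨Real.tendsto_exp_neg_atTop_nhds_zero.comp
      tendsto_natCast_atTop_atTop, Eventually.of_forall fun n ↦ (Real.exp_pos _).ne'⟩
  have hd : ∀ u : ℝ, Tendsto (fun ε : ℝ ↦ ε⁻¹ * (Real.exp (-(ε * u)) - 1)) (𝓝[≠] 0) (𝓝 (-u)) := by
    intro u
    have h1 : HasDerivAt (fun ε : ℝ ↦ Real.exp (-(ε * u))) (-u) 0 := by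
      have := (((hasDerivAt_id (0 : ℝ)).mul_const u).neg).exp
      simpa using this
    have := h1.tendsto_slope
    refine this.congr fun ε ↦ ?_
    simp [slope_def_field]
    ring
  have hnum : Tendsto (fun ε : ℝ ↦ ε⁻¹ * (Real.exp (-(ε * a)) - Real.exp (-(ε * b)))) (𝓝[≠] 0)
      (𝓝 (b - a)) := by
    have := (hd a).sub (hd b)
    rw [show -a - -b = b - a by ring] at this
    refine this.congr fun ε ↦ ?_
    ring
  have hden : Tendsto (fun ε : ℝ ↦ ε⁻¹ * (1 - Real.exp (-(ε * c)))) (𝓝[≠] 0) (𝓝 c) := by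
    have := (hd c).neg
    rw [neg_neg] at this
    refine this.congr fun ε ↦ ?_
    ring
  have hreal : Tendsto (fun ε : ℝ ↦ (1 - Real.exp (-(ε * c)))⁻¹ *
      (Real.exp (-(ε * a)) - Real.exp (-(ε * b)))) (𝓝[≠] 0) (𝓝 (c⁻¹ * (b - a))) := by
    refine ((hden.inv₀ hc.ne').mul hnum).congr' ?_
    filter_upwards [self_mem_nhdsWithin] with ε hε
    have : ε ≠ 0 := hε
    rw [mul_inv, inv_inv]
    field_simp
  have hfin := ENNReal.tendsto_ofReal (hreal.comp hε)
  have hval : ENNReal.ofReal (c⁻¹ * (b - a)) =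
      (ENNReal.ofReal b - ENNReal.ofReal a) / ENNReal.ofReal c := by
    rw [ENNReal.ofReal_mul (by positivity), ENNReal.ofReal_inv_of_pos hc, ENNReal.ofReal_sub _ ha,
      mul_comm, ENNReal.div_eq_inv_mul, mul_comm]
  rw [hval] at hfin
  refine hfin.congr fun n ↦ ?_
  have hen := Real.exp_pos (-(n : ℝ))
  have hlt : Real.exp (-(Real.exp (-(n : ℝ)) * c)) < 1 := by
    rw [Real.exp_lt_one_iff]; have := mul_pos hen hc; linarith
  simp only [Function.comp_apply]
  rw [← ENNReal.ofReal_mul hen.le, ← ENNReal.ofReal_mul hen.le, ← ENNReal.ofReal_mul hen.le,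
    expNeg_ofReal (by positivity), expNeg_ofReal (by positivity), expNeg_ofReal (by positivity),
    ← ENNReal.ofReal_one, ← ENNReal.ofReal_sub _ (Real.exp_pos _).le,
    ← ENNReal.ofReal_sub _ (Real.exp_pos _).le, ← ENNReal.ofReal_inv_of_pos (by linarith),
    ← ENNReal.ofReal_mul (by rw [inv_nonneg]; linarith)]

namespace CountingMeasure

/-- The number of atoms in `(x, ∞)`. -/
noncomputable def tail (μ : CountingMeasure) (x : ℝ) : ℕ∞ :=
  (μ.2.exists_enat (measurableSet_Ioi (a := x))).choose

lemma coe_tail (μ : CountingMeasure) (x : ℝ) : (tail μ x : ℝ≥0∞) = (μ : Measure ℝ) (Ioi x) :=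
  (μ.2.exists_enat (measurableSet_Ioi (a := x))).choose_spec.symm

lemma measurable_tail (x : ℝ) : Measurable fun μ ↦ tail μ x := by
  refine ENat.measurable_iff.2 fun n ↦ ?_
  have : (fun μ ↦ tail μ x) ⁻¹' {(n : ℕ∞)} = {μ : CountingMeasure | (μ : Measure ℝ) (Ioi x) = n} := by
    ext μ
    simp only [mem_preimage, mem_singleton_iff, mem_ofPred_eq, ← coe_tail]
    exact ⟨fun h ↦ by simp [h], fun h ↦ by exact_mod_cast h⟩
  rw [this]
  exact measurable_apply measurableSet_Ioi (measurableSet_singleton _)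

lemma tail_antitone (μ : CountingMeasure) : Antitone (tail μ) := fun x y hxy ↦ by
  have : (tail μ y : ℝ≥0∞) ≤ tail μ x := by
    rw [coe_tail, coe_tail]; exact measure_mono (Ioi_subset_Ioi hxy)
  exact_mod_cast this

end CountingMeasure

/-- The Laplace functional of a cluster conditioned on reaching the positive half-line. -/
noncomputable def tailLaplace {Ω : Type*} [MeasurableSpace Ω] (P : Measure Ω)
    (Z : Ω → CountingMeasure) (f : ℝ → ℝ≥0∞) : ℝ≥0∞ :=
  (laplaceExponent P Z (fun x ↦ f x + topIoi 0 x) - laplaceExponent P Z f) /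
    laplaceExponent P Z (topIoi 0)

section Cluster

variable {Ω : Type*} [MeasurableSpace Ω] {P : Measure Ω} [IsProbabilityMeasure P]
  {Z : Ω → CountingMeasure}

lemma Superposable.laplaceExponent_ne_top (h : Superposable P Z) (hZ : Measurable Z)
    {f : ℝ → ℝ≥0∞} (hf : IsRatStep f) : laplaceExponent P Z f ≠ ∞ := by
  obtain ⟨k, hk⟩ := hf.exists_le_topIoi
  exact ne_top_of_le_ne_top (h.laplaceExponent_topIoi_ne_top hZ _) (laplaceExponent_mono hk)

lemma laplaceExponent_zero : laplaceExponent P Z (fun _ ↦ 0) = 0 := by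
  apply expNeg_strictAnti.injective
  rw [expNeg_laplaceExponent]
  simp

lemma lintegral_ne_zero_expNeg (hZ : Measurable Z) {f : ℝ → ℝ≥0∞} (hf : Measurable f) (x : ℝ) :
    ∫⁻ ω in {ω | (Z ω : Measure ℝ) (Ioi x) ≠ 0}, expNeg (∫⁻ y, f y ∂(Z ω : Measure ℝ)) ∂P =
      expNeg (laplaceExponent P Z f) -
        expNeg (laplaceExponent P Z (fun y ↦ f y + topIoi x y)) := by
  have := lintegral_expNeg_restrict (P := P) (W := fun ω ↦ (Z ω : Measure ℝ) (Ioi x))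
    (Y := fun ω ↦ ∫⁻ y, f y ∂(Z ω : Measure ℝ))
    ((CountingMeasure.measurable_apply measurableSet_Ioi).comp hZ)
  rw [this, expNeg_laplaceExponent,
    expNeg_laplaceExponent]
  simp_rw [lintegral_add_left hf, lintegral_topIoi]

/-- By scaling, the conditioned and shifted Laplace functional is (e^{-εA} - e^{-εB}) / (1 -
e^{-εC}) with ε = e^{-n}, A = L(f), B = L(f + ∞·1_(0,∞)) and C = L(∞·1_(0,∞)). -/
lemma Superposable.tendsto_cond (h : Superposable P Z) (hZ : Measurable Z)
    (hc : laplaceExponent P Z (topIoi 0) ≠ 0) {f : ℝ → ℝ≥0∞} (hf : IsRatStep f) :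
    Tendsto (fun n : ℕ ↦ ∫⁻ ω, expNeg (∫⁻ y, f (y + -(n : ℝ)) ∂(Z ω : Measure ℝ))
      ∂(ProbabilityTheory.cond P {ω | (Z ω : Measure ℝ) (Ioi (n : ℝ)) ≠ 0})) atTop
      (𝓝 (tailLaplace P Z f)) := by
  have hfm := hf.measurable
  have hft : IsRatStep fun x ↦ f x + topIoi 0 x := hf.add (by simpa using isRatStep_topIoi 0)
  refine (tendsto_expNeg_sub_div (laplaceExponent_mono fun x ↦ le_self_add)
    (h.laplaceExponent_ne_top hZ hft) (h.laplaceExponent_topIoi_ne_top hZ 0) hc).congr fun n ↦ ?_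
  rw [ProbabilityTheory.cond, lintegral_smul_measure,
    lintegral_ne_zero_expNeg (f := fun y ↦ f (y + -(n : ℝ))) hZ (by fun_prop),
    h.laplaceExponent_add hZ hfm]
  have h1 : (fun y ↦ f (y + -(n : ℝ)) + topIoi (n : ℝ) y) =
      fun y ↦ (fun x ↦ f x + topIoi 0 x) (y + -(n : ℝ)) := by
    ext y
    have := congrFun (topIoi_add 0 (-(n : ℝ))) y
    simp only [sub_neg_eq_add, zero_add] at this
    simp only [this]
  rw [h1, h.laplaceExponent_add hZ hft.measurable]
  have h2 : P {ω | (Z ω : Measure ℝ) (Ioi (n : ℝ)) ≠ 0} =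
      1 - expNeg (ENNReal.ofReal (Real.exp (-(n : ℝ))) * laplaceExponent P Z (topIoi 0)) := by
    have := lintegral_ne_zero_expNeg (P := P) hZ (f := fun _ ↦ 0) measurable_const n
    simp only [lintegral_zero, expNeg_zero, setLIntegral_one, laplaceExponent_zero, zero_add] at this
    rw [this, ← h.laplaceExponent_topIoi hZ]
  rw [h2]
  rfl

/-- This continuity carries almost sure properties of Z over to the limit law. Finiteness of the
exponent of `g` makes the subtraction continuous. -/
lemma tendsto_tailLaplace (hZ : Measurable Z) (hc : laplaceExponent P Z (topIoi 0) ≠ 0)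
    {f : ℕ → ℝ → ℝ≥0∞} {g : ℝ → ℝ≥0∞} (hf : ∀ n, Measurable (f n)) (hg : Measurable g)
    (hgt : laplaceExponent P Z g ≠ ∞)
    (h : ∀ᵐ ω ∂P, Tendsto (fun n ↦ ∫⁻ y, f n y ∂(Z ω : Measure ℝ)) atTop
      (𝓝 (∫⁻ y, g y ∂(Z ω : Measure ℝ)))) :
    Tendsto (fun n ↦ tailLaplace P Z (f n)) atTop (𝓝 (tailLaplace P Z g)) := by
  refine ENNReal.Tendsto.div_const (ENNReal.Tendsto.sub
    (tendsto_laplaceExponent (f := fun n x ↦ f n x + topIoi 0 x) (g := fun x ↦ g x + topIoi 0 x) hZ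
      (fun n ↦ (hf n).add (measurable_topIoi 0)) ?_)
    (tendsto_laplaceExponent hZ hf h) (Or.inr hgt)) (Or.inr hc)
  filter_upwards [h] with ω hω
  simp_rw [lintegral_add_left (hf _), lintegral_add_left hg]
  exact hω.add_const _

lemma Superposable.tailLaplace_zero (h : Superposable P Z) (hZ : Measurable Z)
    (hc : laplaceExponent P Z (topIoi 0) ≠ 0) : tailLaplace P Z (fun _ ↦ 0) = 1 := by
  unfold tailLaplace
  rw [laplaceExponent_zero, tsub_zero]
  simp only [zero_add]
  exact ENNReal.div_self hc (h.laplaceExponent_topIoi_ne_top hZ 0)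

end Cluster

/-! ### Almost sure properties of the limiting tail counts -/

/-- The functions e^{-Y} ≤ e^{-W} have equal finite integrals, so they agree a.e., and `expNeg` is
injective. -/
lemma ae_eq_of_lintegral_expNeg_eq {Ω : Type*} [MeasurableSpace Ω] {P : Measure Ω}
    [IsProbabilityMeasure P] {Y W : Ω → ℝ≥0∞} (hW : Measurable W) (hle : ∀ᵐ ω ∂P, W ω ≤ Y ω)
    (h : ∫⁻ ω, expNeg (W ω) ∂P = ∫⁻ ω, expNeg (Y ω) ∂P) : ∀ᵐ ω ∂P, W ω = Y ω := by
  have hfin : ∫⁻ ω, expNeg (Y ω) ∂P ≠ ∞ :=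
    ne_top_of_le_ne_top ENNReal.one_ne_top (lintegral_expNeg_le_one _)
  have := ae_eq_of_ae_le_of_lintegral_le (μ := P) (f := fun ω ↦ expNeg (Y ω))
    (g := fun ω ↦ expNeg (W ω)) (hle.mono fun ω hω ↦ expNeg_antitone hω) hfin
    (by fun_prop) h.le
  filter_upwards [this] with ω hω
  exact expNeg_strictAnti.injective hω.symm

lemma ae_eq_zero_of_lintegral_expNeg_eq_one {Ω : Type*} [MeasurableSpace Ω] {P : Measure Ω}
    [IsProbabilityMeasure P] {Y : Ω → ℝ≥0∞} (h : ∫⁻ ω, expNeg (Y ω) ∂P = 1) :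
    ∀ᵐ ω ∂P, Y ω = 0 := by
  filter_upwards [ae_eq_of_lintegral_expNeg_eq (P := P) (W := fun _ ↦ 0) (Y := Y) measurable_const
    (ae_of_all _ fun _ ↦ zero_le) (by simp [h])] with ω hω using hω.symm

lemma tendsto_inv_succ_mul_enat (n : ℕ∞) :
    Tendsto (fun k : ℕ ↦ ((k : ℝ≥0∞) + 1)⁻¹ * n) atTop (𝓝 (if n = ⊤ then ∞ else 0)) := by
  by_cases hn : n = ⊤
  · have : ∀ k : ℕ, ((k : ℝ≥0∞) + 1)⁻¹ * n = ∞ := fun k ↦ by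
      rw [hn, ENat.toENNReal_top, ENNReal.mul_top]
      exact ENNReal.inv_ne_zero.2 (by simp)
    rw [if_pos hn]
    simp only [this]
    exact tendsto_const_nhds
  · rw [if_neg hn]
    have h1 : Tendsto (fun k : ℕ ↦ ((k : ℝ≥0∞) + 1)⁻¹) atTop (𝓝 0) := by
      have := (tendsto_add_atTop_iff_nat 1).2 ENNReal.tendsto_inv_nat_nhds_zero
      simpa using this
    have := ENNReal.Tendsto.mul_const (b := (n : ℝ≥0∞)) h1 (Or.inr (by simpa using hn))
    simpa using this

section Cluster

variable {Ω : Type*} [MeasurableSpace Ω] {P : Measure Ω} [IsProbabilityMeasure P]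
  {Z : Ω → CountingMeasure}

lemma Superposable.measure_Ioi_ne_zero (h : Superposable P Z) (hZ : Measurable Z)
    (hc : laplaceExponent P Z (topIoi 0) ≠ 0) (x : ℝ) :
    P {ω | (Z ω : Measure ℝ) (Ioi x) ≠ 0} ≠ 0 := by
  have h1 := lintegral_ne_zero_expNeg (P := P) hZ (f := fun _ ↦ 0) measurable_const x
  simp only [lintegral_zero, expNeg_zero, setLIntegral_one, laplaceExponent_zero, zero_add] at h1
  rw [h1, ← expNeg_zero, Ne, tsub_eq_zero_iff_le, not_le]
  apply expNeg_strictAnti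
  change 0 < laplaceExponent P Z (topIoi x)
  rw [h.laplaceExponent_topIoi hZ]
  exact pos_iff_ne_zero.2 (mul_ne_zero (by simp [Real.exp_pos]) hc)

/-- The tail counts of the limiting law of the process seen from far to the right. -/
lemma Superposable.exists_tail_law (h : Superposable P Z) (hZ : Measurable Z)
    (hc : laplaceExponent P Z (topIoi 0) ≠ 0) :
    ∃ R : ProbabilityMeasure (ℚ → ℕ∞), (∀ᵐ N ∂(R : Measure (ℚ → ℕ∞)), Antitone N) ∧
      ∀ (s : Finset ℚ) (c : ℚ → ℝ≥0∞),
        ∫⁻ N, expNeg (∑ q ∈ s, c q * N q) ∂(R : Measure (ℚ → ℕ∞)) =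
          tailLaplace P Z fun x ↦ ∑ q ∈ s, (Ioi (q : ℝ)).indicator (fun _ ↦ c q) x := by
  -- These are the tail counts of Z shifted by -n; their laws are taken under P conditioned on an
  -- atom beyond n.
  let T : ℕ → Ω → ℚ → ℕ∞ := fun n ω q ↦ (Z ω).tail (q + n)
  have hT : ∀ n, Measurable (T n) := fun n ↦
    measurable_pi_lambda _ fun q ↦ (CountingMeasure.measurable_tail _).comp hZ
  let Q : ℕ → Measure Ω := fun n ↦ ProbabilityTheory.cond P {ω | (Z ω : Measure ℝ) (Ioi (n : ℝ)) ≠ 0}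
  have hQ : ∀ n, IsProbabilityMeasure (Q n) := fun n ↦
    cond_isProbabilityMeasure (h.measure_Ioi_ne_zero hZ hc n)
  refine exists_limit_of_tendsto_lintegral_expNeg
    (fun n ↦ ⟨(Q n).map (T n), Measure.isProbabilityMeasure_map (hT n).aemeasurable⟩)
    (fun s c ↦ ?_) (fun n ↦ ?_)
  · refine (h.tendsto_cond hZ hc ⟨s, c, rfl⟩).congr fun n ↦ ?_
    simp only [ProbabilityMeasure.coe_mk]
    rw [lintegral_map (by exact measurable_expNeg.comp (Finset.measurable_sum _ fun q _ ↦
      ((ENat.continuous_toENNReal.measurable.comp (measurable_pi_apply q)).const_mul _))) (hT n)]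
    refine lintegral_congr fun ω ↦ ?_
    congr 1
    rw [← lintegral_translateMeasure (-(n : ℝ)) (Z ω : Measure ℝ)
      (f := fun x ↦ ∑ q ∈ s, (Ioi (q : ℝ)).indicator (fun _ ↦ c q) x)
      (IsRatStep.measurable ⟨s, c, rfl⟩), lintegral_ratStep]
    refine Finset.sum_congr rfl fun q _ ↦ ?_
    rw [translateMeasure_apply_Ioi, CountingMeasure.coe_tail, sub_neg_eq_add]
  · rw [ProbabilityMeasure.coe_mk]
    have hms : MeasurableSet {N : ℚ → ℕ∞ | Antitone N} := by
      simp only [Antitone, ofPred_forall]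
      exact MeasurableSet.iInter fun a ↦ MeasurableSet.iInter fun b ↦ MeasurableSet.iInter fun _ ↦
        measurableSet_le (measurable_pi_apply b) (measurable_pi_apply a)
    rw [ae_map_iff (hT n).aemeasurable hms]
    exact ae_of_all _ fun ω p q hpq ↦ (Z ω).tail_antitone
      (by have : (p : ℝ) ≤ q := by exact_mod_cast hpq
          linarith)

lemma ratStep_singleton (q : ℚ) (c : ℝ≥0∞) :
    (fun x : ℝ ↦ ∑ p ∈ {q}, (Ioi (p : ℝ)).indicator (fun _ ↦ c) x) =
      (Ioi (q : ℝ)).indicator fun _ ↦ c := by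
  ext; simp

/-- A limit in (ℕ∞)^ℚ could have infinite counts, fail right-continuity or never vanish. Each defect
is excluded by computing the limit of one sequence of Laplace transforms twice: under R, and through
the continuity of `tailLaplace`. -/
lemma Superposable.ae_mem_tailCounts (h : Superposable P Z) (hZ : Measurable Z)
    (hc : laplaceExponent P Z (topIoi 0) ≠ 0) {R : ProbabilityMeasure (ℚ → ℕ∞)}
    (hanti : ∀ᵐ N ∂(R : Measure (ℚ → ℕ∞)), Antitone N)
    (hR : ∀ (s : Finset ℚ) (c : ℚ → ℝ≥0∞),
      ∫⁻ N, expNeg (∑ q ∈ s, c q * N q) ∂(R : Measure (ℚ → ℕ∞)) =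
        tailLaplace P Z fun x ↦ ∑ q ∈ s, (Ioi (q : ℝ)).indicator (fun _ ↦ c q) x) :
    ∀ᵐ N ∂(R : Measure (ℚ → ℕ∞)), N ∈ tailCounts := by
  have hfin := h.ae_Ioi_lt_top hZ
  have hcoe : ∀ q, Measurable fun N : ℚ → ℕ∞ ↦ (N q : ℝ≥0∞) := fun q ↦
    ENat.continuous_toENNReal.measurable.comp (measurable_pi_apply q)
  have hR1 : ∀ (q : ℚ) (c : ℝ≥0∞), ∫⁻ N, expNeg (c * N q) ∂(R : Measure (ℚ → ℕ∞)) =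
      tailLaplace P Z ((Ioi (q : ℝ)).indicator fun _ ↦ c) := fun q c ↦ by
    rw [← ratStep_singleton, ← hR]; simp
  have hm1 : ∀ (q : ℚ) (c : ℝ≥0∞), Measurable ((Ioi (q : ℝ)).indicator fun _ ↦ c) := fun q c ↦
    measurable_const.indicator measurableSet_Ioi
  have hzero : laplaceExponent P Z (fun _ ↦ 0) ≠ ∞ := by simp [laplaceExponent_zero]
  -- Under weights 1/(k+1) → 0, a finite count contributes 0 in the limit and an infinite one ∞. For
  -- Z the limit is 0, which forces N q < ⊤ a.s.
  have htop : ∀ᵐ N ∂(R : Measure (ℚ → ℕ∞)), ∀ q, N q ≠ ⊤ := by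
    refine ae_all_iff.2 fun q ↦ ?_
    have hl := tendsto_lintegral_expNeg (P := (R : Measure (ℚ → ℕ∞)))
      (fun k : ℕ ↦ (hcoe q).const_mul ((k : ℝ≥0∞) + 1)⁻¹)
      (ae_of_all _ fun N ↦ tendsto_inv_succ_mul_enat (N q))
    simp only [hR1] at hl
    have hr := tendsto_tailLaplace (P := P) (f := fun k : ℕ ↦ (Ioi (q : ℝ)).indicator
      fun _ ↦ ((k : ℝ≥0∞) + 1)⁻¹) (g := fun _ ↦ 0) hZ hc (fun k ↦ hm1 _ _) measurable_const hzero (by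
        filter_upwards [hfin] with ω hω
        simp only [lintegral_indicator_const measurableSet_Ioi, lintegral_zero]
        have := tendsto_inv_succ_mul_enat ((Z ω).tail q)
        rw [if_neg, CountingMeasure.coe_tail] at this
        · exact this
        · rw [← ENat.toENNReal_eq_top, CountingMeasure.coe_tail]
          exact (hω q).ne)
    rw [h.tailLaplace_zero hZ hc] at hr
    filter_upwards [ae_eq_zero_of_lintegral_expNeg_eq_one (tendsto_nhds_unique hl hr)] with N hN hN'
    simp [hN'] at hN
  -- The supremum of N over points decreasing to q is at most N q and has the same Laplace
  -- transform, hence equals it a.s. Finite points of ℕ∞ being isolated, the value is attained.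
  have hright : ∀ᵐ N ∂(R : Measure (ℚ → ℕ∞)), ∀ q : ℚ, ∃ k : ℕ, N (q + 1 / (k + 1)) = N q := by
    refine ae_all_iff.2 fun q ↦ ?_
    have hmono : ∀ N : ℚ → ℕ∞, Antitone N → Monotone fun k : ℕ ↦ N (q + 1 / (k + 1)) := by
      intro N hN k l hkl
      apply hN
      have : (1 : ℚ) / (l + 1) ≤ 1 / (k + 1) := by gcongr
      linarith
    have hle : ∀ N : ℚ → ℕ∞, Antitone N → ⨆ k : ℕ, N (q + 1 / (k + 1)) ≤ N q := by
      intro N hN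
      refine iSup_le fun k ↦ hN ?_
      have : (0 : ℚ) ≤ 1 / (k + 1) := by positivity
      linarith
    have hl := tendsto_lintegral_expNeg (P := (R : Measure (ℚ → ℕ∞)))
      (fun k : ℕ ↦ hcoe (q + 1 / (k + 1)))
      (Z := fun N ↦ ((⨆ k : ℕ, N (q + 1 / (k + 1)) : ℕ∞) : ℝ≥0∞)) (by
        filter_upwards [hanti] with N hN
        exact (ENat.continuous_toENNReal.tendsto _).comp (tendsto_atTop_iSup (hmono N hN)))
    have hR1' : ∀ q, ∫⁻ N, expNeg (N q) ∂(R : Measure (ℚ → ℕ∞)) =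
      tailLaplace P Z ((Ioi (q : ℝ)).indicator fun _ ↦ 1) := fun q ↦ by simpa using hR1 q 1
    simp only [hR1'] at hl
    have hr := tendsto_tailLaplace (P := P) (f := fun k : ℕ ↦
      (Ioi ((q + 1 / (k + 1) : ℚ) : ℝ)).indicator fun _ ↦ 1)
      (g := (Ioi (q : ℝ)).indicator fun _ ↦ 1) hZ hc (fun k ↦ hm1 _ _) (hm1 _ _)
      (h.laplaceExponent_ne_top hZ (isRatStep_indicator q 1)) (by
        refine ae_of_all _ fun ω ↦ ?_
        simp only [lintegral_indicator_const measurableSet_Ioi, one_mul]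
        have hU : Ioi (q : ℝ) = ⋃ k : ℕ, Ioi ((q + 1 / (k + 1) : ℚ) : ℝ) := by
          ext x
          simp only [mem_iUnion, mem_Ioi]
          constructor
          · intro hx
            obtain ⟨k, hk⟩ := exists_nat_one_div_lt (sub_pos.2 hx)
            exact ⟨k, by push_cast; linarith⟩
          · rintro ⟨k, hk⟩
            refine lt_trans ?_ hk
            have : (0 : ℝ) < 1 / (k + 1) := by positivity
            push_cast
            linarith
        rw [hU]
        refine tendsto_measure_iUnion_atTop fun k l hkl ↦ Ioi_subset_Ioi ?_
        have : (1 : ℚ) / (l + 1) ≤ 1 / (k + 1) := by gcongr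
        have : q + 1 / (l + 1) ≤ q + 1 / (k + 1) := by linarith
        exact_mod_cast this)
    have heq := tendsto_nhds_unique hl hr
    rw [← hR1'] at heq
    have hmeas : Measurable fun N : ℚ → ℕ∞ ↦ ((⨆ k : ℕ, N (q + 1 / (k + 1)) : ℕ∞) : ℝ≥0∞) :=
      ENat.continuous_toENNReal.measurable.comp
        (Measurable.iSup fun k : ℕ ↦ measurable_pi_apply (q + 1 / ((k : ℚ) + 1)))
    filter_upwards [hanti, htop, ae_eq_of_lintegral_expNeg_eq hmeas
      (hanti.mono fun N hN ↦ by exact_mod_cast hle N hN) heq] with N hN hNt hNe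
    have h1 : ⨆ k : ℕ, N (q + 1 / (k + 1)) = N q := by exact_mod_cast hNe
    have h2 := tendsto_atTop_iSup (hmono N hN)
    rw [h1, ENat.nhds_eq_pure (hNt q), tendsto_pure] at h2
    exact h2.exists
  have hzero' : ∀ᵐ N ∂(R : Measure (ℚ → ℕ∞)), ∃ k : ℕ, N k = 0 := by
    have hmono : ∀ N : ℚ → ℕ∞, Antitone N → Antitone fun k : ℕ ↦ N k := fun N hN k l hkl ↦
      hN (by exact_mod_cast hkl)
    have hl := tendsto_lintegral_expNeg (P := (R : Measure (ℚ → ℕ∞)))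
      (fun k : ℕ ↦ hcoe k) (Z := fun N ↦ ((⨅ k : ℕ, N k : ℕ∞) : ℝ≥0∞)) (by
        filter_upwards [hanti] with N hN
        exact (ENat.continuous_toENNReal.tendsto _).comp (tendsto_atTop_iInf (hmono N hN)))
    have hR1' : ∀ q, ∫⁻ N, expNeg (N q) ∂(R : Measure (ℚ → ℕ∞)) =
      tailLaplace P Z ((Ioi (q : ℝ)).indicator fun _ ↦ 1) := fun q ↦ by simpa using hR1 q 1
    simp only [hR1'] at hl
    have hr := tendsto_tailLaplace (P := P) (f := fun k : ℕ ↦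
      (Ioi ((k : ℚ) : ℝ)).indicator fun _ ↦ 1)
      (g := fun _ ↦ 0) hZ hc (fun k ↦ hm1 _ _) measurable_const hzero (by
        filter_upwards [hfin] with ω hω
        simp only [lintegral_indicator_const measurableSet_Ioi, one_mul, lintegral_zero]
        have hI : ⋂ k : ℕ, Ioi ((k : ℚ) : ℝ) = ∅ := by
          refine eq_empty_of_forall_notMem fun x hx ↦ ?_
          obtain ⟨k, hk⟩ := exists_nat_gt x
          have := mem_iInter.1 hx k
          simp only [mem_Ioi, Rat.cast_natCast] at this
          exact absurd this (not_lt.2 hk.le)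
        have := tendsto_measure_iInter_atTop (μ := (Z ω : Measure ℝ))
          (s := fun k : ℕ ↦ Ioi ((k : ℚ) : ℝ)) (fun k ↦ measurableSet_Ioi.nullMeasurableSet)
          (fun k l hkl ↦ Ioi_subset_Ioi (by exact_mod_cast hkl)) ⟨0, (hω _).ne⟩
        rwa [hI, measure_empty] at this)
    rw [h.tailLaplace_zero hZ hc] at hr
    filter_upwards [hanti, ae_eq_zero_of_lintegral_expNeg_eq_one (tendsto_nhds_unique hl hr)]
      with N hN hN0
    have h1 : ⨅ k : ℕ, N k = 0 := by exact_mod_cast hN0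
    have h2 := tendsto_atTop_iInf (hmono N hN)
    rw [h1, ENat.nhds_eq_pure (by simp), tendsto_pure] at h2
    exact h2.exists
  filter_upwards [hanti, htop, hright, hzero'] with N h1 h2 h3 h4 using ⟨h1, h2, h3, h4⟩

/-- The limiting law of the process seen from far to the right. -/
lemma Superposable.exists_cluster_law (h : Superposable P Z) (hZ : Measurable Z)
    (hc : laplaceExponent P Z (topIoi 0) ≠ 0) :
    ∃ D : ProbabilityMeasure CountingMeasure,
      (∀ᵐ μ : CountingMeasure ∂(D : Measure CountingMeasure),
        (∀ q : ℚ, (μ : Measure ℝ) (Ioi q) < ∞) ∧ ∃ k : ℕ, (μ : Measure ℝ) (Ioi k) = 0) ∧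
      ∀ f, IsRatStep f →
        ∫⁻ μ : CountingMeasure, expNeg (∫⁻ y, f y ∂(μ : Measure ℝ)) ∂(D : Measure CountingMeasure) =
          tailLaplace P Z f := by
  obtain ⟨R, hanti, hR⟩ := h.exists_tail_law hZ hc
  have hmem := h.ae_mem_tailCounts hZ hc hanti hR
  have hF : Measurable fun N ↦ (⟨ofTailCounts N, isCountingMeasure_ofTailCounts N⟩ :
    CountingMeasure) := measurable_ofTailCounts.subtype_mk
  refine ⟨⟨(R : Measure (ℚ → ℕ∞)).map _, Measure.isProbabilityMeasure_map hF.aemeasurable⟩, ?_, ?_⟩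
  · rw [ProbabilityMeasure.coe_mk]
    refine (ae_map_iff hF.aemeasurable ?_).2 ?_
    · simp only [ofPred_and, ofPred_forall, ofPred_exists]
      exact (MeasurableSet.iInter fun q ↦ measurableSet_lt
        (CountingMeasure.measurable_apply measurableSet_Ioi) measurable_const).inter
        (MeasurableSet.iUnion fun k ↦ CountingMeasure.measurable_apply measurableSet_Ioi
          (measurableSet_singleton 0))
    · filter_upwards [hmem] with N hN
      refine ⟨fun q ↦ ?_, ?_⟩
      · rw [ofTailCounts_Ioi hN]
        simpa [lt_top_iff_ne_top] using hN.2.1 q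
      · obtain ⟨k, hk⟩ := hN.2.2.2
        refine ⟨k, ?_⟩
        have := ofTailCounts_Ioi hN k
        simpa [hk] using this
  · rintro f ⟨s, c, rfl⟩
    rw [ProbabilityMeasure.coe_mk, lintegral_map (by
      exact measurable_expNeg.comp ((Measure.measurable_lintegral
        (IsRatStep.measurable ⟨s, c, rfl⟩)).comp measurable_subtype_coe)) hF, ← hR]
    refine lintegral_congr_ae ?_
    filter_upwards [hmem] with N hN
    rw [lintegral_ratStep]
    simp_rw [ofTailCounts_Ioi hN]

end Cluster

/-! ### Counting measures seen from their rightmost atom -/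

namespace CountingMeasure

lemma measure_ext_of_map_coe {Q Q' : Measure CountingMeasure}
    (h : Q.map (fun μ : CountingMeasure ↦ (μ : Measure ℝ)) =
      Q'.map fun μ : CountingMeasure ↦ (μ : Measure ℝ)) :
    Q = Q' := by
  ext S hS
  obtain ⟨B, hB, rfl⟩ := hS
  have h1 := congrArg (fun ν : Measure (Measure ℝ) ↦ ν B) h
  simp only [Measure.map_apply measurable_subtype_coe hB] at h1
  exact h1

/-- The nonzero counting measures which are bounded to the right. -/
def HasMax : Set CountingMeasure :=
  {μ | (μ : Measure ℝ) univ ≠ 0 ∧ ∃ k : ℕ, (μ : Measure ℝ) (Ioi k) = 0}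

lemma measurableSet_hasMax : MeasurableSet HasMax := by
  simp only [HasMax, ofPred_and, ofPred_exists]
  exact (measurable_apply MeasurableSet.univ (measurableSet_singleton 0)).compl.inter
    (MeasurableSet.iUnion fun k ↦ measurable_apply measurableSet_Ioi (measurableSet_singleton 0))

open Classical in
/-- The position of the rightmost atom, as a real number. -/
noncomputable def maxAtom (μ : CountingMeasure) : ℝ :=
  if μ ∈ HasMax then (rightmost μ).toReal else 0

lemma HasMax.ne_zero {μ : CountingMeasure} (hμ : μ ∈ HasMax) : (μ : Measure ℝ) ≠ 0 := fun h ↦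
  hμ.1 (by simp [h])

lemma rightmost_eq_maxAtom {μ : CountingMeasure} (hμ : μ ∈ HasMax) :
    rightmost μ = (maxAtom μ : EReal) := by
  obtain ⟨k, hk⟩ := hμ.2
  rw [maxAtom, if_pos hμ, EReal.coe_toReal]
  · exact ((rightmost_le_of_measure_Ioi_eq_zero (HasMax.ne_zero hμ) hk).trans_lt
      (EReal.coe_lt_top _)).ne
  · intro hbot
    refine hμ.1 ?_
    have hU : (univ : Set ℝ) = ⋃ n : ℕ, Ioi (-(n : ℝ)) := by
      refine (eq_univ_of_forall fun x ↦ mem_iUnion.2 ?_).symm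
      obtain ⟨n, hn⟩ := exists_nat_gt (-x)
      exact ⟨n, by simp only [mem_Ioi]; linarith⟩
    rw [hU]
    exact measure_iUnion_null fun n ↦ (μ.2.rightmost_le_iff (HasMax.ne_zero hμ) _).1 (by simp [hbot])

lemma maxAtom_le_iff {μ : CountingMeasure} (hμ : μ ∈ HasMax) (x : ℝ) :
    maxAtom μ ≤ x ↔ (μ : Measure ℝ) (Ioi x) = 0 := by
  rw [← μ.2.rightmost_le_iff (HasMax.ne_zero hμ), rightmost_eq_maxAtom hμ, EReal.coe_le_coe_iff]

lemma lt_maxAtom_iff {μ : CountingMeasure} (hμ : μ ∈ HasMax) (x : ℝ) :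
    x < maxAtom μ ↔ (μ : Measure ℝ) (Ioi x) ≠ 0 := by
  rw [← not_le, maxAtom_le_iff hμ]

lemma measurable_maxAtom : Measurable maxAtom := by
  refine measurable_of_Iic fun x ↦ ?_
  have : maxAtom ⁻¹' Iic x = (HasMax ∩ {μ | (μ : Measure ℝ) (Ioi x) = 0}) ∪
      (HasMaxᶜ ∩ {_μ | 0 ≤ x}) := by
    ext μ
    by_cases hμ : μ ∈ HasMax
    · simp [hμ, maxAtom_le_iff hμ]
    · simp [hμ, maxAtom]
  rw [this]
  exact (measurableSet_hasMax.inter (measurable_apply measurableSet_Ioi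
    (measurableSet_singleton 0))).union (measurableSet_hasMax.compl.inter (MeasurableSet.const _))

lemma translate_mem_hasMax {μ : CountingMeasure} (hμ : μ ∈ HasMax) (x : ℝ) :
    translate x μ ∈ HasMax := by
  refine ⟨by rw [coe_translate, translateMeasure_univ]; exact hμ.1, ?_⟩
  obtain ⟨k, hk⟩ := exists_nat_gt (maxAtom μ + x)
  refine ⟨k, ?_⟩
  rw [coe_translate, translateMeasure_apply_Ioi, ← maxAtom_le_iff hμ]
  linarith

lemma maxAtom_translate {μ : CountingMeasure} (hμ : μ ∈ HasMax) (x : ℝ) :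
    maxAtom (translate x μ) = maxAtom μ + x := by
  refine eq_of_forall_ge_iff fun y ↦ ?_
  rw [maxAtom_le_iff (translate_mem_hasMax hμ x), coe_translate, translateMeasure_apply_Ioi,
    ← maxAtom_le_iff hμ, le_sub_iff_add_le]

lemma mem_hasMax_of_rightmost_eq {μ : CountingMeasure} {m : ℝ} (h : rightmost μ = (m : EReal)) :
    μ ∈ HasMax := by
  have h0 : (μ : Measure ℝ) ≠ 0 := fun h0 ↦ by
    rw [h0, rightmost_zero] at h
    exact EReal.coe_ne_top m h.symm
  obtain ⟨k, hk⟩ := exists_nat_gt m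
  refine ⟨by simpa using h0, k, (μ.2.rightmost_le_iff h0 _).1 ?_⟩
  rw [h, EReal.coe_le_coe_iff]
  exact hk.le

lemma maxAtom_eq_of_rightmost_eq {μ : CountingMeasure} {m : ℝ} (h : rightmost μ = (m : EReal)) :
    maxAtom μ = m := by
  have := rightmost_eq_maxAtom (mem_hasMax_of_rightmost_eq h)
  rw [h] at this
  exact_mod_cast this.symm

/-- The translate of a counting measure whose rightmost atom is at `m`. -/
noncomputable def shiftMax (m : ℝ) (μ : CountingMeasure) : CountingMeasure :=
  translate (m - maxAtom μ) μ

lemma measurable_shiftMax (m : ℝ) : Measurable (shiftMax m) :=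
  measurable_translate.comp ((measurable_const.sub measurable_maxAtom).prodMk measurable_id)

/-- Recentring forgets any earlier translation; this is how the shape of a cluster is recovered from
a randomly shifted copy. -/
lemma shiftMax_translate {μ : CountingMeasure} (hμ : μ ∈ HasMax) (m x : ℝ) :
    shiftMax m (translate x μ) = shiftMax m μ := by
  rw [shiftMax, shiftMax, maxAtom_translate hμ, translate_translate]
  congr 1
  ring

lemma maxAtom_shiftMax {μ : CountingMeasure} (hμ : μ ∈ HasMax) (m : ℝ) :
    maxAtom (shiftMax m μ) = m := by
  rw [shiftMax, maxAtom_translate hμ]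
  ring

lemma shiftMax_mem_hasMax {μ : CountingMeasure} (hμ : μ ∈ HasMax) (m : ℝ) :
    shiftMax m μ ∈ HasMax := translate_mem_hasMax hμ _

lemma measurable_lintegral {f : ℝ → ℝ≥0∞} (hf : Measurable f) :
    Measurable fun μ : CountingMeasure ↦ ∫⁻ y, f y ∂(μ : Measure ℝ) :=
  (Measure.measurable_lintegral hf).comp measurable_subtype_coe

lemma measurable_expNeg_lintegral {f : ℝ → ℝ≥0∞} (hf : Measurable f) :
    Measurable fun μ : CountingMeasure ↦ expNeg (∫⁻ y, f y ∂(μ : Measure ℝ)) :=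
  measurable_expNeg.comp (measurable_lintegral hf)

/-- Laws of counting measures which are finite on half-lines `(x, ∞)` are determined by the Laplace
functional on rational step functions. -/
lemma measure_ext_of_ratStep {Q Q' : Measure CountingMeasure} [IsFiniteMeasure Q]
    [IsFiniteMeasure Q']
    (hfin : ∀ᵐ μ : CountingMeasure ∂Q, ∀ q : ℚ, (μ : Measure ℝ) (Ioi (q : ℝ)) < ∞)
    (h : ∀ f : ℝ → ℝ≥0∞, IsRatStep f →
      ∫⁻ μ : CountingMeasure, expNeg (∫⁻ x, f x ∂(μ : Measure ℝ)) ∂Q =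
        ∫⁻ μ : CountingMeasure, expNeg (∫⁻ x, f x ∂(μ : Measure ℝ)) ∂Q') : Q = Q' :=
  measure_ext_of_map_coe (map_eq_of_lintegral_expNeg_ratStep (P := Q) (P' := Q')
    measurable_subtype_coe measurable_subtype_coe (ae_all_iff.1 hfin) h)

end CountingMeasure

/-! ### Uniqueness of the decoration -/

lemma lintegral_topIoi_add (x t : ℝ) (μ : Measure ℝ) :
    ∫⁻ y, topIoi x (y + t) ∂μ = ∞ * μ (Ioi (x - t)) := by
  rw [← lintegral_topIoi, ← topIoi_add x t]

lemma clusterExponent_topIoi (D : Measure CountingMeasure) [IsProbabilityMeasure D] (k : ℝ) :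
    clusterExponent D (topIoi k) =
      ∫⁻ x, D {μ | (μ : Measure ℝ) (Ioi (k - x)) ≠ 0} ∂expIntensity := by
  refine lintegral_congr fun x ↦ ?_
  have hms : MeasurableSet {μ : CountingMeasure | (μ : Measure ℝ) (Ioi (k - x)) = 0} :=
    CountingMeasure.measurable_apply measurableSet_Ioi (measurableSet_singleton 0)
  have h1 : ∫⁻ μ : CountingMeasure, expNeg (∫⁻ y, topIoi k (y + x) ∂(μ : Measure ℝ)) ∂D =
      D {μ | (μ : Measure ℝ) (Ioi (k - x)) = 0} := by
    rw [← lintegral_indicator_one hms]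
    refine lintegral_congr fun μ ↦ ?_
    rw [lintegral_topIoi_add]
    by_cases h : (μ : Measure ℝ) (Ioi (k - x)) = 0
    · rw [indicator_of_mem (by exact h), h]; simp
    · rw [indicator_of_notMem (by exact h), ENNReal.top_mul h]; simp
  rw [h1, ← prob_compl_eq_one_sub hms]
  rfl

/-- A bounded set lies in some (-k, ∞), and after x ↦ -x the integral in the condition is dominated
by the cluster exponent of ∞·1_(-k,∞). -/
lemma decorationCondition_of_clusterExponent {D : ProbabilityMeasure CountingMeasure}
    (h : ∀ k : ℕ, clusterExponent D (topIoi (-(k : ℝ))) < ∞) : DecorationCondition D := by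
  intro A hA hb
  obtain ⟨r, hr⟩ := hb.subset_closedBall 0
  obtain ⟨k, hk⟩ := exists_nat_gt r
  have hsub : A ⊆ Ioi (-(k : ℝ)) := fun y hy ↦ by
    have := hr hy
    rw [Metric.mem_closedBall, dist_zero_right, Real.norm_eq_abs] at this
    have := (abs_le.1 this).1
    simp only [mem_Ioi]
    linarith
  have hm : Measurable fun x : ℝ ↦
      (D : Measure CountingMeasure) {μ | (μ : Measure ℝ) (Ioi (-(k : ℝ) - x)) ≠ 0} := by
    refine Monotone.measurable fun x y hxy ↦ measure_mono fun μ hμ h0 ↦ hμ (measure_mono_null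
      (Ioi_subset_Ioi (by linarith)) h0)
  refine lt_of_le_of_lt ?_ (h k)
  rw [clusterExponent_topIoi, lintegral_expIntensity hm]
  calc _ ≤ ∫⁻ x in Ioi (0 : ℝ), ENNReal.ofReal (Real.exp x) *
        (D : Measure CountingMeasure) {μ | (μ : Measure ℝ) (Ioi (-(k : ℝ) - -x)) ≠ 0} := by
        refine lintegral_mono fun x ↦ ?_
        rw [mul_comm]
        refine mul_le_mul_right (measure_mono fun μ hμ h0 ↦ hμ.ne' (measure_mono_null ?_ h0)) _
        intro y hy
        have := hsub hy
        simp only [mem_Ioi] at this ⊢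
        linarith
    _ ≤ ∫⁻ x, ENNReal.ofReal (Real.exp x) *
        (D : Measure CountingMeasure) {μ | (μ : Measure ℝ) (Ioi (-(k : ℝ) - -x)) ≠ 0} :=
        setLIntegral_le_lintegral _ _
    _ = _ := by
        have := (Measure.measurePreserving_neg (volume : Measure ℝ)).lintegral_comp
          ((by fun_prop : Measurable fun x : ℝ ↦ ENNReal.ofReal (Real.exp (-x))).mul hm)
        simpa using this

/-- A cluster shifted by x reaches (0, ∞) exactly when x > -m. For such x the infinite weight
annihilates the inner Laplace functional; for other x it changes nothing. -/
lemma clusterExponent_add_topIoi {D : Measure CountingMeasure} [IsProbabilityMeasure D] {m : ℝ}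
    (hD : ∀ᵐ μ : CountingMeasure ∂D, rightmost (μ : Measure ℝ) = (m : EReal)) {f : ℝ → ℝ≥0∞}
    (hf : Measurable f) :
    clusterExponent D (fun x ↦ f x + topIoi 0 x) = clusterExponent D f +
      ∫⁻ x in Ioi (-m), ∫⁻ μ : CountingMeasure, expNeg (∫⁻ y, f (y + x) ∂(μ : Measure ℝ)) ∂D
        ∂expIntensity := by
  have hL := measurable_lintegral_expNeg_add D hf
  rw [← lintegral_indicator measurableSet_Ioi]
  unfold clusterExponent
  rw [← lintegral_add_right _ (hL.indicator measurableSet_Ioi)]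
  refine lintegral_congr fun x ↦ ?_
  have h1 : ∀ μ : CountingMeasure, ∫⁻ y, (f (y + x) + topIoi 0 (y + x)) ∂(μ : Measure ℝ) =
      ∫⁻ y, f (y + x) ∂(μ : Measure ℝ) + ∞ * (μ : Measure ℝ) (Ioi (-x)) := fun μ ↦ by
    rw [lintegral_add_left (by fun_prop), lintegral_topIoi_add, zero_sub]
  simp_rw [h1]
  by_cases hx : x ∈ Ioi (-m)
  · rw [indicator_of_mem hx, tsub_add_cancel_of_le (lintegral_expNeg_le_one _)]
    have : ∫⁻ μ : CountingMeasure, expNeg (∫⁻ y, f (y + x) ∂(μ : Measure ℝ) +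
        ∞ * (μ : Measure ℝ) (Ioi (-x))) ∂D = 0 := by
      rw [lintegral_congr_ae (g := fun _ ↦ 0), lintegral_zero]
      filter_upwards [hD] with μ hμ
      have h2 := (CountingMeasure.lt_maxAtom_iff (CountingMeasure.mem_hasMax_of_rightmost_eq hμ)
        (-x)).1 (by
          rw [CountingMeasure.maxAtom_eq_of_rightmost_eq hμ]
          simp only [mem_Ioi] at hx
          linarith)
      rw [ENNReal.top_mul h2]
      simp
    rw [this, tsub_zero]
  · rw [indicator_of_notMem hx, add_zero]
    congr 1
    refine lintegral_congr_ae ?_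
    filter_upwards [hD] with μ hμ
    have h2 := (CountingMeasure.maxAtom_le_iff (CountingMeasure.mem_hasMax_of_rightmost_eq hμ)
        (-x)).1 (by
          rw [CountingMeasure.maxAtom_eq_of_rightmost_eq hμ]
          simp only [mem_Ioi] at hx
          linarith)
    rw [h2]
    simp

section

variable {Ω : Type*} [MeasurableSpace Ω] {P : Measure Ω} [IsProbabilityMeasure P]
  {Z : Ω → CountingMeasure}

lemma HasLePageRepresentation.clusterExponent_eq {D : ProbabilityMeasure CountingMeasure}
    (h : HasLePageRepresentation P Z D) {f : ℝ → ℝ≥0∞} (hf : Measurable f) :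
    clusterExponent D f = laplaceExponent P Z f := by
  apply expNeg_strictAnti.injective
  rw [expNeg_laplaceExponent, h.lintegral_expNeg hf]

lemma HasLePageRepresentation.decorationCondition {D : ProbabilityMeasure CountingMeasure}
    (hD : HasLePageRepresentation P Z D) (h : Superposable P Z) (hZ : Measurable Z) :
    DecorationCondition D := by
  refine decorationCondition_of_clusterExponent fun k ↦ ?_
  rw [hD.clusterExponent_eq (measurable_topIoi _)]
  exact (h.laplaceExponent_topIoi_ne_top hZ _).lt_top

/-- The constant is the mass e^m that e^{-x} dx gives to (-m, ∞). This is what makes m unique. -/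
lemma HasLePageRepresentation.laplaceExponent_topIoi_zero {D : ProbabilityMeasure CountingMeasure}
    (hD : HasLePageRepresentation P Z D) {m : ℝ}
    (hm : ∀ᵐ μ : CountingMeasure ∂(D : Measure CountingMeasure),
      rightmost (μ : Measure ℝ) = (m : EReal)) :
    laplaceExponent P Z (topIoi 0) = ENNReal.ofReal (Real.exp m) := by
  have := clusterExponent_add_topIoi hm (f := fun _ ↦ 0) measurable_const
  simpa [clusterExponent, ← hD.clusterExponent_eq (measurable_topIoi _), expIntensity_Ioi] using this

/-- The law of the decoration is determined by the law of a cluster reaching the positive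
half-line. -/
lemma HasLePageRepresentation.eq_map_shiftMax {D : ProbabilityMeasure CountingMeasure}
    (hD : HasLePageRepresentation P Z D) (h : Superposable P Z) (hZ : Measurable Z) {m : ℝ}
    (hm : ∀ᵐ μ : CountingMeasure ∂(D : Measure CountingMeasure),
      rightmost (μ : Measure ℝ) = (m : EReal))
    {Q : Measure CountingMeasure} [IsProbabilityMeasure Q]
    (hfin : ∀ᵐ μ : CountingMeasure ∂Q, ∀ q : ℚ, (μ : Measure ℝ) (Ioi q) < ∞)
    (hQ : ∀ f, IsRatStep f →
      ∫⁻ μ : CountingMeasure, expNeg (∫⁻ y, f y ∂(μ : Measure ℝ)) ∂Q = tailLaplace P Z f) :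
    (D : Measure CountingMeasure) = Q.map (CountingMeasure.shiftMax m) := by
  -- The law of the shift of a cluster given that it reaches (0, ∞): shifting `D` by an independent
  -- variable of law `ν` gives `Q`.
  let ν : Measure ℝ := ENNReal.ofReal (Real.exp m)⁻¹ • expIntensity.restrict (Ioi (-m))
  have hexp := Real.exp_pos m
  have hν : IsProbabilityMeasure ν := ⟨by
    simp only [ν, Measure.smul_apply, Measure.restrict_apply_univ, expIntensity_Ioi, neg_neg,
      smul_eq_mul]
    rw [← ENNReal.ofReal_mul (by positivity), inv_mul_cancel₀ hexp.ne', ENNReal.ofReal_one]⟩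
  have hT := CountingMeasure.measurable_translate
  have hE : Q = (ν.prod (D : Measure CountingMeasure)).map
      fun p ↦ CountingMeasure.translate p.1 p.2 := by
    have : IsProbabilityMeasure ((ν.prod (D : Measure CountingMeasure)).map
      fun p ↦ CountingMeasure.translate p.1 p.2) := Measure.isProbabilityMeasure_map hT.aemeasurable
    refine CountingMeasure.measure_ext_of_ratStep hfin fun f hf ↦ ?_
    have hfm := hf.measurable
    rw [hQ f hf, tailLaplace, hD.laplaceExponent_topIoi_zero hm,
      ← hD.clusterExponent_eq (f := fun x ↦ f x + topIoi 0 x) (hfm.add (measurable_topIoi 0)),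
      ← hD.clusterExponent_eq hfm,
      clusterExponent_add_topIoi hm hfm, ENNReal.add_sub_cancel_left (by
        rw [hD.clusterExponent_eq hfm]
        exact h.laplaceExponent_ne_top hZ hf),
      lintegral_map (CountingMeasure.measurable_expNeg_lintegral hfm) hT]
    simp_rw [CountingMeasure.coe_translate, lintegral_translateMeasure _ _ hfm]
    rw [lintegral_prod _ (by exact (measurable_expNeg.comp
      (CountingMeasure.measurable_lintegral_add hfm)).aemeasurable)]
    simp only [ν]
    rw [lintegral_smul_measure, ENNReal.ofReal_inv_of_pos hexp, smul_eq_mul,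
      ENNReal.div_eq_inv_mul]
  rw [hE, Measure.map_map (CountingMeasure.measurable_shiftMax m) hT]
  have hsnd : (ν.prod (D : Measure CountingMeasure)).map Prod.snd = D := by
    rw [Measure.map_snd_prod]; simp
  nth_rewrite 1 [← hsnd]
  refine Measure.map_congr ?_
  have hm' : ∀ᵐ p ∂ν.prod (D : Measure CountingMeasure),
      rightmost (p.2 : Measure ℝ) = (m : EReal) := by
    have := Measure.quasiMeasurePreserving_snd (μ := ν) (ν := (D : Measure CountingMeasure))
    exact this.ae hm
  filter_upwards [hm'] with p hp
  have hmem := CountingMeasure.mem_hasMax_of_rightmost_eq hp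
  rw [Function.comp_apply, CountingMeasure.shiftMax_translate hmem, CountingMeasure.shiftMax,
    CountingMeasure.maxAtom_eq_of_rightmost_eq hp, sub_self, CountingMeasure.translate_zero]

end

/-! ### Existence of the decoration -/

lemma topIoi_add_topIoi_of_le {a b : ℝ} (h : b ≤ a) (x : ℝ) :
    topIoi a x + topIoi b x = topIoi b x := by
  by_cases hx : x ∈ Ioi b
  · simp [topIoi, indicator_of_mem hx]
  · have : x ∉ Ioi a := fun hxa ↦ hx (h.trans_lt hxa)
    simp [topIoi, indicator_of_notMem hx, indicator_of_notMem this]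

section Cluster

variable {Ω : Type*} [MeasurableSpace Ω] {P : Measure Ω} [IsProbabilityMeasure P]
  {Z : Ω → CountingMeasure}

lemma Superposable.mul_tailLaplace (h : Superposable P Z) (hZ : Measurable Z)
    (hc : laplaceExponent P Z (topIoi 0) ≠ 0) (f : ℝ → ℝ≥0∞) :
    laplaceExponent P Z (topIoi 0) * tailLaplace P Z f =
      laplaceExponent P Z (fun x ↦ f x + topIoi 0 x) - laplaceExponent P Z f :=
  ENNReal.mul_div_cancel hc (h.laplaceExponent_topIoi_ne_top hZ 0)

/-- For s ≥ 0 the infinite weight on (0, ∞) absorbs the one on (s, ∞), so a common term cancels and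
scaling gives the rest. On the left is the Laplace functional of the limit law restricted to
reaching (s, ∞) and shifted by -s. -/
lemma Superposable.tailLaplace_sub (h : Superposable P Z) (hZ : Measurable Z)
    (hc : laplaceExponent P Z (topIoi 0) ≠ 0) {f : ℝ → ℝ≥0∞} (hf : IsRatStep f) {s : ℚ}
    (hs : 0 ≤ s) :
    tailLaplace P Z (fun x ↦ f (x + -s)) - tailLaplace P Z (fun x ↦ f (x + -s) + topIoi s x) =
      ENNReal.ofReal (Real.exp (-s)) * tailLaplace P Z f := by
  have hct := h.laplaceExponent_topIoi_ne_top hZ 0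
  have hfs : IsRatStep fun x ↦ f (x + -s) := by
    have := hf.comp_add (-s)
    simpa using this
  have hft : IsRatStep fun x ↦ f x + topIoi 0 x := hf.add (by simpa using isRatStep_topIoi 0)
  have h1 : (fun x ↦ f (x + -s) + topIoi s x) = fun x ↦ (fun y ↦ f y + topIoi 0 y) (x + -s) := by
    ext x
    have := congrFun (topIoi_add 0 (-(s : ℝ))) x
    simp only [sub_neg_eq_add, zero_add] at this
    simp only [this]
  have h2 : ∀ x, f (x + -s) + topIoi s x + topIoi 0 x = f (x + -s) + topIoi 0 x := fun x ↦ by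
    rw [add_assoc, topIoi_add_topIoi_of_le (by exact_mod_cast hs)]
  rw [← ENNReal.mul_right_inj hc hct, ENNReal.mul_sub (fun _ _ ↦ hct), mul_left_comm,
    h.mul_tailLaplace hZ hc, h.mul_tailLaplace hZ hc, h.mul_tailLaplace hZ hc]
  simp_rw [h2]
  rw [h1, h.laplaceExponent_add hZ hft.measurable, h.laplaceExponent_add hZ hf.measurable,
    ENNReal.mul_sub (fun _ _ ↦ ENNReal.ofReal_ne_top)]
  have e1 : ENNReal.ofReal (Real.exp (-s)) * laplaceExponent P Z f ≠ ∞ :=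
    ENNReal.mul_ne_top ENNReal.ofReal_ne_top (h.laplaceExponent_ne_top hZ hf)
  have e2 : ENNReal.ofReal (Real.exp (-s)) * laplaceExponent P Z (fun x ↦ f x + topIoi 0 x) ≠ ∞ :=
    ENNReal.mul_ne_top ENNReal.ofReal_ne_top (h.laplaceExponent_ne_top hZ hft)
  have e3 : laplaceExponent P Z (fun x ↦ f (x + -s) + topIoi 0 x) ≠ ∞ :=
    h.laplaceExponent_ne_top hZ (hfs.add (by simpa using isRatStep_topIoi 0))
  have e4 : ENNReal.ofReal (Real.exp (-s)) * laplaceExponent P Z (fun x ↦ f x + topIoi 0 x) ≤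
      laplaceExponent P Z (fun x ↦ f (x + -s) + topIoi 0 x) := by
    rw [← h.laplaceExponent_add hZ hft.measurable, ← h1]
    refine laplaceExponent_mono fun x ↦ ?_
    rw [← h2 x]
    exact le_self_add
  rw [tsub_right_comm, ENNReal.sub_sub_cancel e3 e4]

/-- The law of a cluster reaching the positive half-line, conditioned to reach `(s, ∞)` and shifted
back by `s`, is the original law. -/
lemma Superposable.map_translate_restrict (h : Superposable P Z) (hZ : Measurable Z)
    (hc : laplaceExponent P Z (topIoi 0) ≠ 0)
    {Q : Measure CountingMeasure} [IsProbabilityMeasure Q]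
    (hfin : ∀ᵐ μ : CountingMeasure ∂Q, ∀ q : ℚ, (μ : Measure ℝ) (Ioi q) < ∞)
    (hQ : ∀ f, IsRatStep f →
      ∫⁻ μ : CountingMeasure, expNeg (∫⁻ y, f y ∂(μ : Measure ℝ)) ∂Q = tailLaplace P Z f)
    {s : ℚ} (hs : 0 ≤ s) :
    (Q.restrict {μ | (μ : Measure ℝ) (Ioi s) ≠ 0}).map (CountingMeasure.translate (-s)) =
      ENNReal.ofReal (Real.exp (-s)) • Q := by
  have hT := CountingMeasure.measurable_translate_right (-(s : ℝ))
  have hf1 : IsFiniteMeasure (ENNReal.ofReal (Real.exp (-s)) • Q) :=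
    Q.smul_finite ENNReal.ofReal_ne_top
  symm
  refine CountingMeasure.measure_ext_of_ratStep (Measure.ae_smul_measure hfin _) fun f hf ↦ ?_
  have hfm := hf.measurable
  have hfs : IsRatStep fun x ↦ f (x + -s) := by
    have := hf.comp_add (-s)
    simpa using this
  rw [lintegral_smul_measure, hQ f hf, smul_eq_mul, ← h.tailLaplace_sub hZ hc hf hs, ← hQ _ hfs,
    ← hQ _ (hfs.add (isRatStep_topIoi s)),
    lintegral_map (CountingMeasure.measurable_expNeg_lintegral hfm) hT]
  simp_rw [CountingMeasure.coe_translate, lintegral_translateMeasure _ _ hfm]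
  have := lintegral_expNeg_restrict (P := Q)
    (Y := fun μ : CountingMeasure ↦ ∫⁻ y, f (y + -s) ∂(μ : Measure ℝ))
    (W := fun μ ↦ (μ : Measure ℝ) (Ioi s))
    (CountingMeasure.measurable_apply measurableSet_Ioi)
  rw [this]
  simp_rw [lintegral_add_left hfs.measurable, lintegral_topIoi]

/-- The position of the rightmost atom of a cluster reaching the positive half-line is
independent of the cluster seen from its rightmost atom. -/
lemma Superposable.map_maxAtom_shiftMax (h : Superposable P Z) (hZ : Measurable Z)
    (hc : laplaceExponent P Z (topIoi 0) ≠ 0)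
    {Q : Measure CountingMeasure} [IsProbabilityMeasure Q]
    (hfin : ∀ᵐ μ : CountingMeasure ∂Q, ∀ q : ℚ, (μ : Measure ℝ) (Ioi q) < ∞)
    (hQ : ∀ f, IsRatStep f →
      ∫⁻ μ : CountingMeasure, expNeg (∫⁻ y, f y ∂(μ : Measure ℝ)) ∂Q = tailLaplace P Z f)
    (hmax : ∀ᵐ μ ∂Q, μ ∈ CountingMeasure.HasMax) (hpos : ∀ᵐ μ ∂Q, 0 < CountingMeasure.maxAtom μ) :
    Q.map (fun μ ↦ (CountingMeasure.maxAtom μ, CountingMeasure.shiftMax 0 μ)) =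
      (expIntensity.restrict (Ioi 0)).prod (Q.map (CountingMeasure.shiftMax 0)) := by
  have hM := CountingMeasure.measurable_maxAtom
  have hV := CountingMeasure.measurable_shiftMax 0
  have hexp : ∀ q : ℚ, (expIntensity.restrict (Ioi 0)) (Ioi (q : ℝ)) =
      ENNReal.ofReal (Real.exp (-(max q 0 : ℚ))) := fun q ↦ by
    rw [Measure.restrict_apply measurableSet_Ioi, Ioi_inter_Ioi, expIntensity_Ioi]
    push_cast
    rfl
  have hfinexp : IsFiniteMeasure (expIntensity.restrict (Ioi 0)) := ⟨by
    rw [Measure.restrict_apply_univ, expIntensity_Ioi]; exact ENNReal.ofReal_lt_top⟩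
  -- Recentring ignores the shift by -s, so the self-similarity of `Q` factorises this probability.
  -- The cut is at `max q 0` because the rightmost atom is a.s. positive.
  have hcut : ∀ (q : ℚ) {B : Set CountingMeasure}, MeasurableSet B →
      Q ({μ | (q : ℝ) < CountingMeasure.maxAtom μ} ∩ CountingMeasure.shiftMax 0 ⁻¹' B) =
        ENNReal.ofReal (Real.exp (-(max q 0 : ℚ))) * Q (CountingMeasure.shiftMax 0 ⁻¹' B) := by
    intro q B hB
    have hT := CountingMeasure.measurable_translate_right (-((max q 0 : ℚ) : ℝ))
    have key := h.map_translate_restrict hZ hc hfin hQ (le_max_right q 0)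
    have := congrArg (fun ν : Measure CountingMeasure ↦ ν (CountingMeasure.shiftMax 0 ⁻¹' B)) key
    simp only [Measure.map_apply hT (hV hB), Measure.smul_apply, smul_eq_mul,
      Measure.restrict_apply (hT (hV hB))] at this
    rw [← this]
    refine measure_congr ?_
    filter_upwards [hmax, hpos] with μ hμ hμ0
    refine propext ?_
    change (_ ∧ CountingMeasure.shiftMax 0 μ ∈ B) ↔
      (CountingMeasure.shiftMax 0 (CountingMeasure.translate _ μ) ∈ B ∧ _)
    rw [CountingMeasure.shiftMax_translate hμ, and_comm]
    refine and_congr_right fun _ ↦ ?_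
    change (q : ℝ) < CountingMeasure.maxAtom μ ↔ (μ : Measure ℝ) (Ioi ((max q 0 : ℚ) : ℝ)) ≠ 0
    rw [← CountingMeasure.lt_maxAtom_iff hμ]
    push_cast
    simp [hμ0]
  refine (Measure.prod_eq fun A B hA hB ↦ ?_).symm
  rw [Measure.map_apply (hM.prodMk hV) (hA.prod hB), Measure.map_apply hV hB]
  have hext : (Q.restrict (CountingMeasure.shiftMax 0 ⁻¹' B)).map CountingMeasure.maxAtom =
      Q (CountingMeasure.shiftMax 0 ⁻¹' B) • expIntensity.restrict (Ioi 0) := by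
    have hf1 : IsFiniteMeasure (Q (CountingMeasure.shiftMax 0 ⁻¹' B) •
        expIntensity.restrict (Ioi 0)) := Measure.smul_finite _ (measure_ne_top _ _)
    refine ext_of_generate_finite _ Real.borel_eq_generateFrom_Ioi_rat Real.isPiSystem_Ioi_rat ?_ ?_
    · intro S hS
      obtain ⟨q, rfl⟩ := mem_iUnion.1 hS
      rw [Measure.map_apply hM measurableSet_Ioi, Measure.restrict_apply (hM measurableSet_Ioi),
        Measure.smul_apply, hexp, smul_eq_mul, mul_comm, ← hcut q hB]
      rfl
    · rw [Measure.map_apply hM MeasurableSet.univ, preimage_univ, Measure.restrict_apply_univ,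
        Measure.smul_apply, Measure.restrict_apply_univ, expIntensity_Ioi]
      simp
  have := congrArg (fun ν : Measure ℝ ↦ ν A) hext
  simp only [Measure.map_apply hM hA, Measure.smul_apply, Measure.restrict_apply (hM hA),
    smul_eq_mul] at this
  rw [mul_comm, ← this]
  rfl

end Cluster

/-- Shifting the decoration trades against multiplying the intensity; this lets the constant C be
absorbed into the decoration. -/
lemma clusterExponent_map_translate (D : Measure CountingMeasure) [SFinite D] {f : ℝ → ℝ≥0∞}
    (hf : Measurable f) (m : ℝ) :
    clusterExponent (D.map (CountingMeasure.translate m)) f =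
      ENNReal.ofReal (Real.exp m) * clusterExponent D f := by
  rw [← clusterExponent_add D hf]
  refine lintegral_congr fun x ↦ ?_
  rw [lintegral_map (CountingMeasure.measurable_expNeg_lintegral (by fun_prop))
    (CountingMeasure.measurable_translate_right m)]
  simp_rw [CountingMeasure.coe_translate]
  congr 1
  refine lintegral_congr fun μ ↦ ?_
  rw [lintegral_translateMeasure _ _ (by fun_prop)]
  congr 1
  refine lintegral_congr fun y ↦ ?_
  rw [add_right_comm]

section Cluster

variable {Ω : Type*} [MeasurableSpace Ω] {P : Measure Ω} [IsProbabilityMeasure P]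
  {Z : Ω → CountingMeasure}

lemma Superposable.laplaceExponent_eq_mul_clusterExponent (h : Superposable P Z)
    (hZ : Measurable Z) (hc : laplaceExponent P Z (topIoi 0) ≠ 0)
    {Q : Measure CountingMeasure} [IsProbabilityMeasure Q]
    (hfin : ∀ᵐ μ : CountingMeasure ∂Q, ∀ q : ℚ, (μ : Measure ℝ) (Ioi q) < ∞)
    (hQ : ∀ f, IsRatStep f →
      ∫⁻ μ : CountingMeasure, expNeg (∫⁻ y, f y ∂(μ : Measure ℝ)) ∂Q = tailLaplace P Z f)
    (hmax : ∀ᵐ μ ∂Q, μ ∈ CountingMeasure.HasMax) (hpos : ∀ᵐ μ ∂Q, 0 < CountingMeasure.maxAtom μ)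
    {f : ℝ → ℝ≥0∞} (hf : IsRatStep f) :
    laplaceExponent P Z f = laplaceExponent P Z (topIoi 0) *
      clusterExponent (Q.map (CountingMeasure.shiftMax 0)) f := by
  have hM := CountingMeasure.measurable_maxAtom
  have hV := CountingMeasure.measurable_shiftMax 0
  have hD0 : IsProbabilityMeasure (Q.map (CountingMeasure.shiftMax 0)) :=
    Measure.isProbabilityMeasure_map hV.aemeasurable
  have hV0 : ∀ᵐ μ : CountingMeasure ∂(Q.map (CountingMeasure.shiftMax 0)),
      (μ : Measure ℝ) (Ioi 0) = 0 := by
    refine (ae_map_iff hV.aemeasurable (CountingMeasure.measurable_apply measurableSet_Ioi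
      (measurableSet_singleton 0))).2 ?_
    filter_upwards [hmax] with μ hμ
    rw [mem_singleton_iff,
      ← CountingMeasure.maxAtom_le_iff (CountingMeasure.shiftMax_mem_hasMax hμ 0),
      CountingMeasure.maxAtom_shiftMax hμ]
  -- For g supported in (0, ∞) the limit functional reduces to L(g) = C (1 - `tailLaplace` g), and
  -- under `Q` the cluster is its recentred version shifted by an independent exponential variable.
  have base : ∀ g : ℝ → ℝ≥0∞, IsRatStep g → (∀ x, g x ≤ topIoi 0 x) →
      laplaceExponent P Z g = laplaceExponent P Z (topIoi 0) *
        clusterExponent (Q.map (CountingMeasure.shiftMax 0)) g := by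
    intro g hg hg0
    have hgm := hg.measurable
    have hct := h.laplaceExponent_topIoi_ne_top hZ 0
    have h1 : laplaceExponent P Z g =
        laplaceExponent P Z (topIoi 0) * (1 - tailLaplace P Z g) := by
      have hadd : (fun x ↦ g x + topIoi 0 x) = topIoi 0 := by
        ext x
        by_cases hx : x ∈ Ioi (0 : ℝ)
        · simp [topIoi, indicator_of_mem hx]
        · have := hg0 x
          rw [topIoi, indicator_of_notMem hx] at this
          simp [topIoi, indicator_of_notMem hx, le_zero_iff.1 this]
      rw [ENNReal.mul_sub (fun _ _ ↦ hct), mul_one, h.mul_tailLaplace hZ hc, hadd,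
        ENNReal.sub_sub_cancel hct (laplaceExponent_mono hg0)]
    rw [h1]
    congr 1
    let ν := expIntensity.restrict (Ioi 0)
    have hν : IsProbabilityMeasure ν := ⟨by
      simp only [ν]
      rw [Measure.restrict_apply_univ, expIntensity_Ioi]; simp⟩
    have hL := measurable_lintegral_expNeg_add (Q.map (CountingMeasure.shiftMax 0)) hgm
    have h2 : tailLaplace P Z g = ∫⁻ x, ∫⁻ μ : CountingMeasure,
        expNeg (∫⁻ y, g (y + x) ∂(μ : Measure ℝ)) ∂(Q.map (CountingMeasure.shiftMax 0)) ∂ν := by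
      rw [← hQ g hg, ← lintegral_prod (fun p : ℝ × CountingMeasure ↦
          expNeg (∫⁻ y, g (y + p.1) ∂(p.2 : Measure ℝ))) (by exact (measurable_expNeg.comp
          (CountingMeasure.measurable_lintegral_add hgm)).aemeasurable),
        ← h.map_maxAtom_shiftMax hZ hc hfin hQ hmax hpos,
        lintegral_map (by exact (measurable_expNeg.comp
          (CountingMeasure.measurable_lintegral_add hgm))) (hM.prodMk hV)]
      refine lintegral_congr fun μ ↦ ?_
      rw [← lintegral_translateMeasure _ _ hgm, CountingMeasure.shiftMax,
        CountingMeasure.coe_translate, translateMeasure_translateMeasure]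
      simp [translateMeasure_zero]
    have h3 : 1 - tailLaplace P Z g = ∫⁻ x, (1 - ∫⁻ μ : CountingMeasure,
        expNeg (∫⁻ y, g (y + x) ∂(μ : Measure ℝ)) ∂(Q.map (CountingMeasure.shiftMax 0))) ∂ν := by
      rw [h2, lintegral_sub hL]
      · simp
      · exact ne_top_of_le_ne_top ENNReal.one_ne_top ((lintegral_mono fun x ↦
          lintegral_expNeg_le_one _).trans (by simp))
      · exact ae_of_all _ fun x ↦ lintegral_expNeg_le_one _
    rw [h3, clusterExponent, ← lintegral_indicator measurableSet_Ioi]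
    refine lintegral_congr fun x ↦ ?_
    by_cases hx : x ∈ Ioi (0 : ℝ)
    · rw [indicator_of_mem hx]
    -- A recentred cluster has no atom in (0, ∞), so its shift by x ≤ 0 does not meet the support of
    -- g and contributes nothing.
    · rw [indicator_of_notMem hx]
      have h4 : ∫⁻ μ : CountingMeasure, expNeg (∫⁻ y, g (y + x) ∂(μ : Measure ℝ))
          ∂(Q.map (CountingMeasure.shiftMax 0)) = 1 := by
        rw [lintegral_congr_ae (g := fun _ ↦ 1)]
        · simp
        · filter_upwards [hV0] with μ hμ
          have h5 : ∫⁻ y, g (y + x) ∂(μ : Measure ℝ) = 0 := by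
            refine le_zero_iff.1 ((lintegral_mono fun y ↦ hg0 (y + x)).trans ?_)
            rw [lintegral_topIoi_add, measure_mono_null (Ioi_subset_Ioi ?_) hμ, mul_zero]
            simp only [mem_Ioi] at hx
            linarith
          rw [h5, expNeg_zero]
      rw [h4, tsub_self]
  -- A general step function vanishes left of some -k. Translating it into (0, ∞) multiplies both
  -- sides by the same factor e^{-k}, which cancels.
  obtain ⟨k, hk⟩ := hf.exists_le_topIoi
  have hg : IsRatStep fun x ↦ f (x + -(k : ℝ)) := by
    have := hf.comp_add (-(k : ℚ))
    simpa using this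
  have := base _ hg fun x ↦ by
    have := hk (x + -(k : ℝ))
    have h2 := congrFun (topIoi_add (-(k : ℝ)) (-(k : ℝ))) x
    simp only [sub_self] at h2
    rwa [h2] at this
  rw [h.laplaceExponent_add hZ hf.measurable, clusterExponent_add _ hf.measurable,
    mul_left_comm] at this
  exact (ENNReal.mul_right_inj (by simp [Real.exp_pos]) ENNReal.ofReal_ne_top).1 this

/-- Every nonzero superposable point process is a Poisson process of clusters, decorated by a point
process whose rightmost atom is deterministic. -/
lemma Superposable.exists_hasLePageRepresentation (h : Superposable P Z) (hZ : Measurable Z)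
    (h0 : 0 < P {ω | (Z ω : Measure ℝ) ≠ 0}) :
    ∃ (m : ℝ) (D : ProbabilityMeasure CountingMeasure), HasLePageRepresentation P Z D ∧
      ∀ᵐ μ : CountingMeasure ∂(D : Measure CountingMeasure),
        rightmost (μ : Measure ℝ) = (m : EReal) := by
  have hc := h.laplaceExponent_topIoi_zero_ne_zero hZ h0
  have hct := h.laplaceExponent_topIoi_ne_top hZ 0
  obtain ⟨Q, hQ1, hQ⟩ := h.exists_cluster_law hZ hc
  -- The limit functional vanishes at ∞·1_(0,∞), so `Q` charges only measures with an atom in (0,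
  -- ∞).
  have hne : ∀ᵐ μ : CountingMeasure ∂(Q : Measure CountingMeasure), (μ : Measure ℝ) (Ioi 0) ≠ 0 := by
    have h1 := hQ (topIoi 0) (by simpa using isRatStep_topIoi 0)
    have h2 : tailLaplace P Z (topIoi 0) = 0 := by
      simp [tailLaplace, topIoi_add_topIoi_of_le le_rfl]
    rw [h2, lintegral_eq_zero_iff
      (CountingMeasure.measurable_expNeg_lintegral (measurable_topIoi 0))] at h1
    filter_upwards [h1] with μ hμ hμ0
    rw [lintegral_topIoi, hμ0] at hμ
    simp at hμ
  have hmax : ∀ᵐ μ ∂(Q : Measure CountingMeasure), μ ∈ CountingMeasure.HasMax := by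
    filter_upwards [hQ1, hne] with μ hμ hμ0
    exact ⟨fun h ↦ hμ0 (measure_mono_null (subset_univ _) h), hμ.2⟩
  have hpos : ∀ᵐ μ ∂(Q : Measure CountingMeasure), 0 < CountingMeasure.maxAtom μ := by
    filter_upwards [hmax, hne] with μ hμ hμ0 using (CountingMeasure.lt_maxAtom_iff hμ 0).2 hμ0
  have hfin : ∀ᵐ μ : CountingMeasure ∂(Q : Measure CountingMeasure),
      ∀ q : ℚ, (μ : Measure ℝ) (Ioi q) < ∞ := hQ1.mono fun μ hμ ↦ hμ.1
  let m := Real.log (laplaceExponent P Z (topIoi 0)).toReal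
  have hm : ENNReal.ofReal (Real.exp m) = laplaceExponent P Z (topIoi 0) := by
    rw [Real.exp_log (ENNReal.toReal_pos hc hct), ENNReal.ofReal_toReal hct]
  have hV := CountingMeasure.measurable_shiftMax 0
  have hT := CountingMeasure.measurable_translate_right m
  have hTV : Measurable fun μ ↦ CountingMeasure.translate m (CountingMeasure.shiftMax 0 μ) :=
    hT.comp hV
  have hD : ∀ᵐ μ ∂((Q : Measure CountingMeasure).map fun μ ↦
      CountingMeasure.translate m (CountingMeasure.shiftMax 0 μ)),
      μ ∈ CountingMeasure.HasMax ∧ CountingMeasure.maxAtom μ = m := by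
    refine (ae_map_iff hTV.aemeasurable (CountingMeasure.measurableSet_hasMax.inter
      (CountingMeasure.measurable_maxAtom (measurableSet_singleton m)))).2 ?_
    filter_upwards [hmax] with μ hμ
    have hμ' := CountingMeasure.shiftMax_mem_hasMax hμ 0
    exact ⟨CountingMeasure.translate_mem_hasMax hμ' m, by
      rw [mem_preimage, mem_singleton_iff, CountingMeasure.maxAtom_translate hμ',
        CountingMeasure.maxAtom_shiftMax hμ, zero_add]⟩
  refine ⟨m, ⟨(Q : Measure CountingMeasure).map fun μ ↦
      CountingMeasure.translate m (CountingMeasure.shiftMax 0 μ),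
    Measure.isProbabilityMeasure_map hTV.aemeasurable⟩, ?_, ?_⟩
  · refine hasLePageRepresentation_of_ratStep hZ
      (fun q ↦ (h.ae_Ioi_lt_top hZ).mono fun ω hω ↦ hω q) fun f hf ↦ ?_
    rw [ProbabilityMeasure.coe_mk, ← Function.comp_def (CountingMeasure.translate m),
      ← Measure.map_map hT hV, clusterExponent_map_translate _ hf.measurable, hm,
      ← h.laplaceExponent_eq_mul_clusterExponent hZ hc hfin hQ hmax hpos hf, expNeg_laplaceExponent]
  · filter_upwards [hD] with μ hμ
    rw [CountingMeasure.rightmost_eq_maxAtom hμ.1, hμ.2]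

end Cluster

lemma clusterExponent_dirac_zero (f : ℝ → ℝ≥0∞) (hf : Measurable f) :
    clusterExponent (Measure.dirac ⟨0, isCountingMeasure_zero⟩) f = 0 := by
  unfold clusterExponent
  rw [lintegral_congr (g := fun _ ↦ 0), lintegral_zero]
  intro x
  rw [lintegral_dirac' _ (CountingMeasure.measurable_expNeg_lintegral (by fun_prop))]
  simp

/-- The a.s. zero process, where conditioning on an atom is impossible, is handled separately by the
zero decoration. -/
lemma Superposable.exists_decoration {Ω : Type*} [MeasurableSpace Ω] {P : Measure Ω}
    [IsProbabilityMeasure P] {Z : Ω → CountingMeasure} (h : Superposable P Z) (hZ : Measurable Z) :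
    ∃ D : ProbabilityMeasure CountingMeasure, HasLePageRepresentation P Z D := by
  by_cases h0 : P {ω | (Z ω : Measure ℝ) ≠ 0} = 0
  · have hZ0 : ∀ᵐ ω ∂P, (Z ω : Measure ℝ) = 0 := h0
    refine ⟨⟨Measure.dirac ⟨0, isCountingMeasure_zero⟩, inferInstance⟩,
      hasLePageRepresentation_of_ratStep hZ
        (fun q ↦ hZ0.mono fun ω hω ↦ by simp [hω]) fun f hf ↦ ?_⟩
    rw [ProbabilityMeasure.coe_mk, clusterExponent_dirac_zero f hf.measurable, expNeg_zero,
      lintegral_congr_ae (g := fun _ ↦ 1) (hZ0.mono fun ω hω ↦ by simp [hω])]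
    simp
  · obtain ⟨m, D, hD, -⟩ := h.exists_hasLePageRepresentation hZ (pos_iff_ne_zero.2 h0)
    exact ⟨D, hD⟩

/-! ### The characterisation and the uniqueness of the decoration -/

theorem corollary3p2 {Ω : Type*} [MeasurableSpace Ω] (P : Measure Ω) [IsProbabilityMeasure P]
    (Z : Ω → CountingMeasure) (hZ : Measurable Z) :
    (Superposable P Z ↔
      ∃ D : ProbabilityMeasure CountingMeasure,
        DecorationCondition D ∧ HasLePageRepresentation P Z D) ∧
    (Superposable P Z → 0 < P {ω | (Z ω : Measure ℝ) ≠ 0} →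
      ∃! p : ℝ × ProbabilityMeasure CountingMeasure,
        DecorationCondition p.2 ∧ HasLePageRepresentation P Z p.2 ∧
          ∀ᵐ (μ : CountingMeasure) ∂(p.2 : Measure CountingMeasure), rightmost (μ : Measure ℝ) = (p.1 : EReal)) := by
  refine ⟨⟨fun h ↦ ?_, fun ⟨D, _, hD⟩ ↦ hD.superposable hZ⟩, fun h h0 ↦ ?_⟩
  · obtain ⟨D, hD⟩ := h.exists_decoration hZ
    exact ⟨D, hD.decorationCondition h hZ, hD⟩
  · have hc := h.laplaceExponent_topIoi_zero_ne_zero hZ h0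
    obtain ⟨Q, hQ1, hQ⟩ := h.exists_cluster_law hZ hc
    have hfin := hQ1.mono fun μ hμ ↦ hμ.1
    obtain ⟨m, D, hD, hm⟩ := h.exists_hasLePageRepresentation hZ h0
    refine ⟨(m, D), ⟨hD.decorationCondition h hZ, hD, hm⟩, ?_⟩
    rintro ⟨m', D'⟩ ⟨-, hD', hm'⟩
    -- Both e^m and e^{m'} equal the exponent of ∞·1_(0,∞). Once the positions agree, both
    -- decorations are the same image of `Q`.
    have hmm : m' = m := by
      have := (hD'.laplaceExponent_topIoi_zero hm').symm.trans (hD.laplaceExponent_topIoi_zero hm)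
      rw [ENNReal.ofReal_eq_ofReal_iff (Real.exp_pos _).le (Real.exp_pos _).le] at this
      exact Real.exp_injective this
    subst hmm
    exact Prod.ext rfl (Subtype.ext ((hD'.eq_map_shiftMax h hZ hm' hfin hQ).trans
      (hD.eq_map_shiftMax h hZ hm hfin hQ).symm))
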